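/- **Setting.** Let $1\le m\le n$ and let $\Omega\subset\mathbb R^n$ be a bounded domain of class $C^2$ with boundary $S=\partial\Omega$ and interior unit normal $\nu^S$. Identify the Grassmannian $G(m,n)$ with the set of orthogonal projections $P\in\mathbb R^{n\times n}$ of rank $m$. An $m$-varifold in $\mathbb R^n$ is a Radon measure on $\mathbb R^n\times G(m,n)$; an $(m-1)$-varifold in $S$ is a Radon measure on $G_{m-1}(TS)=\{(x,Q): x\in S,\ Q\in G(m-1,n),\ Q\subset T_xS\}$. Let $V$ be an $m$-varifold with support in $\overline\Omega$, $\Gamma$ an $(m-1)$-varifold in $S$, and let $B\in L^1(V)$ have values $B(x,P)$ in the bilinear maps $\mathbb R^n\times\mathbb R^n\to\mathbb R^n$. We say that $V$, with curvature $B_V=B$, is *orthogonal to $S$ along $\Gamma$* if for all $\phi\in C^1(\mathbb R^n\times\mathbb R^{n\times n},\mathbb R^n)$ $$\int \big(D_P\phi\cdot B+\langle \operatorname{tr}B,\phi\rangle+\langle D_x\phi,P\rangle\big)\,dV(x,P)=-\int_{G_{m-1}(TS)}\langle\nu^S(x),\phi(x,\nu^S(x)\wedge Q)\rangle\,d\Gamma(x,Q),$$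 where $D_P\phi\cdot B=\sum_i\langle D_P\phi\,[B(e_i,\cdot)],e_i\rangle$, $\operatorname{tr}B=\sum_i B(e_i,e_i)$, $\langle D_x\phi,P\rangle$ is the Hilbert–Schmidt product, and $\nu^S(x)\wedge Q$ is the span of $\nu^S(x)$ and $Q$. For $P\in G(m,n)$ and $z\in\mathbb R^n$, an *$m$-slice* of $\Omega$ in the affine plane $z+P$ is a connected component $\Delta\ne\emptyset$ of the interior of $\overline\Omega\cap(z+P)$ relative to $z+P$. It is *orthogonal* if $\nu^S(x)\in P$ for all $x\in\partial\Delta$, where $\partial\Delta$ is the boundary relative to $z+P$. Let $S^m_\perp(\Omega,z+P)$ be the set of orthogonal $m$-slices of $\Omega$ in $z+P$. Let $\nu$ be the image of $V$ under the projection to $G(m,n)$, let $(\mu_P)$ be a disintegration of $V$ with respect to $\nu$ into probability measures on $\mathbb R^n$ depending measurably on $P$, that is $\int f\,dV=\int_{G(m,n)}\int_{\mathbb R^n} f(x,P)\,d\mu_P(x)\,d\nu(P)$ for all Borel $f\ge0$, and let $\mu_P^\perp$ be the image of $\mu_P$ under the orthogonal projection of $\mathbb R^n$ onto $P^\perp$.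 **Theorem 2.10 (Orthogonal Varifolds with Curvature Zero).** Let $V$ be an $m$-varifold in $\mathbb R^n$ with support in $\overline\Omega$ which is orthogonal to $S$ along an $(m-1)$-varifold $\Gamma$ and has curvature $B_V=0$. Then each set $S^m_\perp(\Omega,z+P)$ is finite (possibly empty), and there are constants $\theta_\Delta\ge0$ such that for all $\phi\in C^0(\mathbb R^n\times G(m,n))$ and all $\varphi\in C^0(G_{m-1}(TS))$ $$\int\phi\,dV=\int_{G(m,n)}\int_{P^\perp}\sum_{\Delta\in S^m_\perp(\Omega,z+P)}\theta_\Delta\int_\Delta\phi(x,P)\,d\mathcal L^m(x)\,d\mu_P^\perp(z)\,d\nu(P),$$ $$\int\varphi\,d\Gamma=\int_{G(m,n)}\int_{P^\perp}\sum_{\Delta\in S^m_\perp(\Omega,z+P)}\theta_\Delta\int_{\partial\Delta}\varphi(x,P\cap T_xS)\,d\mathcal H^{m-1}(x)\,d\mu_P^\perp(z)\,d\nu(P),$$ where all the integrals that occur exist (for $\nu$-almost every $P$, in the case of the integral over $P^\perp$). -/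

import Mathlib

open MeasureTheory ProbabilityTheory Topology Set
open scoped RealInnerProductSpace

noncomputable section

namespace OrthVarifold

/-- Euclidean `n`-space. -/
abbrev E (n : ℕ) : Type := EuclideanSpace ℝ (Fin n)

/-- The space `ℝ^{n × n}` of endomorphisms of Euclidean `n`-space. -/
abbrev Op (n : ℕ) : Type := E n →L[ℝ] E n

/-- The space of bilinear maps `ℝⁿ × ℝⁿ → ℝⁿ`, in curried form. -/
abbrev Bil (n : ℕ) : Type := E n →L[ℝ] Op n

/-- The `i`-th standard basis vector. -/
def stdVec (n : ℕ) (i : Fin n) : E n := EuclideanSpace.single i (1 : ℝ)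

/-- The Grassmannian `G(m,n)`: an `m`-plane is identified with the orthogonal projection
onto it, so `G(m,n)` is the set of orthogonal projections of rank `m`. The plane itself is
recovered as `P.range`. -/
def Gr (n m : ℕ) : Set (Op n) :=
  {P | IsStarProjection P ∧ Module.finrank ℝ P.range = m}

/-- The orthogonal projection onto a linear subspace, as an endomorphism. -/
def planeProj {n : ℕ} (K : Submodule ℝ (E n)) : Op n := K.starProjection

/-! ### Bounded domains of class `C²` and their interior unit normal -/

/-- `ρ` is a `C²` defining function of `Ω` near `x`: it is of class `C²` near `x`, has
nonvanishing gradient at `x`, and near `x` the set `Ω` is `{ρ > 0}`. -/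
def IsDefiningFunctionAt {n : ℕ} (Ω : Set (E n)) (x : E n) (ρ : E n → ℝ) : Prop :=
  ContDiffAt ℝ 2 ρ x ∧ gradient ρ x ≠ 0 ∧ ∀ᶠ y in 𝓝 x, (y ∈ Ω ↔ 0 < ρ y)

/-- A bounded domain (nonempty, open, connected set) of class `C²`. -/
structure IsBoundedC2Domain {n : ℕ} (Ω : Set (E n)) : Prop where
  isOpen : IsOpen Ω
  isConnected : IsConnected Ω
  isBounded : Bornology.IsBounded Ω
  regular : ∀ x ∈ frontier Ω, ∃ ρ : E n → ℝ, IsDefiningFunctionAt Ω x ρ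

/-- `v` is the interior unit normal of `Ω` at the boundary point `x`. -/
def IsInnerNormalAt {n : ℕ} (Ω : Set (E n)) (x v : E n) : Prop :=
  ∃ ρ : E n → ℝ, IsDefiningFunctionAt Ω x ρ ∧ v = ‖gradient ρ x‖⁻¹ • gradient ρ x

open Classical in
/-- The interior unit normal `ν^S` along `S = ∂Ω`. At a boundary point the vector does not
depend on the defining function; away from the regular boundary the value is irrelevant. -/
def innerNormal {n : ℕ} (Ω : Set (E n)) (x : E n) : E n :=
  if h : ∃ v, IsInnerNormalAt Ω x v then h.choose else 0

/-- The tangent space `T_x S` of `S = ∂Ω`. -/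
def tangentSpace {n : ℕ} (Ω : Set (E n)) (x : E n) : Submodule ℝ (E n) :=
  (Submodule.span ℝ {innerNormal Ω x})ᗮ

/-- The bundle `G_k(TS)` of pairs `(x, Q)` with `x ∈ S = ∂Ω` and `Q ⊆ T_x S` a `k`-plane. -/
def boundaryGr {n : ℕ} (Ω : Set (E n)) (k : ℕ) : Set (E n × Op n) :=
  {q | q.1 ∈ frontier Ω ∧ q.2 ∈ Gr n k ∧ q.2.range ≤ tangentSpace Ω q.1}

/-! ### Slices -/

/-- The affine plane `z + P`. -/
def affPlane {n : ℕ} (P : Op n) (z : E n) : Set (E n) := {x | x - z ∈ P.range}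

/-- The interior of `closure Ω ∩ (z + P)` relative to the affine plane `z + P`. -/
def planeInterior {n : ℕ} (Ω : Set (E n)) (P : Op n) (z : E n) : Set (E n) :=
  {x | x ∈ affPlane P z ∧ closure Ω ∈ 𝓝[affPlane P z] x}

/-- `Δ` is a slice of `Ω` in `z + P`: a (nonempty) connected component of the relative
interior of `closure Ω ∩ (z + P)`. -/
def IsSlice {n : ℕ} (Ω : Set (E n)) (P : Op n) (z : E n) (Δ : Set (E n)) : Prop :=
  ∃ x ∈ planeInterior Ω P z, Δ = connectedComponentIn (planeInterior Ω P z) x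

/-- The boundary of a slice relative to its affine plane. A slice is relatively open and the
plane is closed, so this is the closure minus the slice. -/
def sliceBoundary {n : ℕ} (Δ : Set (E n)) : Set (E n) := closure Δ \ Δ

/-- The set of orthogonal slices of `Ω` in `z + P`: slices `Δ` with `ν^S(x) ∈ P` for all
`x ∈ ∂Δ`. -/
def orthSlices {n : ℕ} (Ω : Set (E n)) (P : Op n) (z : E n) : Set (Set (E n)) :=
  {Δ | IsSlice Ω P z Δ ∧ ∀ x ∈ sliceBoundary Δ, innerNormal Ω x ∈ P.range}

/-! ### Varifolds, curvature, orthogonal boundary -/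

/-- An `m`-varifold in `ℝⁿ`: a Radon measure on `ℝⁿ × G(m,n)`, seen as a locally finite
Borel measure on `ℝⁿ × ℝ^{n × n}` that is concentrated on `ℝⁿ × G(m,n)`. -/
structure IsVarifold {n : ℕ} (m : ℕ) (V : Measure (E n × Op n)) : Prop where
  locallyFinite : IsLocallyFiniteMeasure V
  concentrated : V ((univ : Set (E n)) ×ˢ Gr n m)ᶜ = 0

/-- A `k`-varifold in `S = ∂Ω`: a Radon measure on `G_k(TS)`. -/
structure IsBoundaryVarifold {n : ℕ} (Ω : Set (E n)) (k : ℕ) (Γ : Measure (E n × Op n)) :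
    Prop where
  locallyFinite : IsLocallyFiniteMeasure Γ
  concentrated : Γ (boundaryGr Ω k)ᶜ = 0

/-- The trace `tr B = ∑ᵢ B(eᵢ, eᵢ)`. -/
def traceBil {n : ℕ} (B : Bil n) : E n := ∑ i, B (stdVec n i) (stdVec n i)

/-- `D_P φ · B = ∑ᵢ ⟨D_P φ(x,P) B(eᵢ,·), eᵢ⟩`. -/
def derivPDot {n : ℕ} (φ : E n × Op n → E n) (p : E n × Op n) (B : Bil n) : ℝ :=
  ∑ i, ⟪fderiv ℝ φ p (0, B (stdVec n i)), stdVec n i⟫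

/-- The Hilbert-Schmidt product `⟨D_x φ(x,P), P⟩`. -/
def derivXDot {n : ℕ} (φ : E n × Op n → E n) (p : E n × Op n) : ℝ :=
  ∑ i, ⟪fderiv ℝ φ p (stdVec n i, 0), p.2 (stdVec n i)⟫

/-- `v ∧ Q`: the span of `v` and the plane `Q`. -/
def wedge {n : ℕ} (v : E n) (Q : Op n) : Op n :=
  planeProj (Submodule.span ℝ {v} ⊔ Q.range)

/-- The `m`-varifold `V`, with support in `closure Ω` and with curvature `B ∈ L¹(V)`, is
orthogonal to `S = ∂Ω` along the `(m-1)`-varifold `Γ` in `S`. Integrability of `B` is stated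
through its components, the target space being finite-dimensional. -/
structure IsOrthogonalAlong {n : ℕ} (Ω : Set (E n)) (m : ℕ) (V : Measure (E n × Op n))
    (B : E n × Op n → Bil n) (Γ : Measure (E n × Op n)) : Prop where
  varifold : IsVarifold m V
  support : V (closure Ω ×ˢ (univ : Set (Op n)))ᶜ = 0
  integrable : ∀ v w : E n, Integrable (fun p => B p v w) V
  boundary : IsBoundaryVarifold Ω (m - 1) Γ
  identity : ∀ φ : E n × Op n → E n, ContDiff ℝ 1 φ →
    ∫ p, (derivPDot φ p (B p) + ⟪traceBil (B p), φ p⟫ + derivXDot φ p) ∂V =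
      - ∫ q, ⟪innerNormal Ω q.1, φ (q.1, wedge (innerNormal Ω q.1) q.2)⟫ ∂Γ

/-! ### Disintegration -/

/-- The image `ν` of `V` under the projection onto the Grassmannian. -/
def grassMarginal {n : ℕ} (V : Measure (E n × Op n)) : Measure (Op n) := V.map Prod.snd

/-- The probability measures `μ P`, depending measurably on `P`, disintegrate `V` with respect
to its image `ν` on the Grassmannian. -/
def IsDisintegration {n : ℕ} (V : Measure (E n × Op n)) (μ : Kernel (Op n) (E n)) : Prop :=
  IsMarkovKernel μ ∧ ∀ f : E n × Op n → ENNReal, Measurable f →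
    ∫⁻ p, f p ∂V = ∫⁻ P, ∫⁻ x, f (x, P) ∂(μ P) ∂(grassMarginal V)

/-- The image `μ_P^⊥` of `μ_P` under the orthogonal projection `x ↦ x - P x` onto the
orthogonal complement `P^⊥`, as a measure on `ℝⁿ` concentrated on `P^⊥`. -/
def perpMarginal {n : ℕ} (μ : Kernel (Op n) (E n)) (P : Op n) : Measure (E n) :=
  (μ P).map (fun x => x - P x)

/-! ### Superposition of orthogonal slices

`μHE[k]` is the `k`-dimensional Hausdorff measure, normalized so as to agree with Lebesgue
measure on `k`-dimensional Euclidean spaces. On an affine `m`-plane `μHE[m]` is `𝓛ᵐ`. -/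

/-- The sum of `θ_Δ ∫_Δ φ(x,P) d𝓛ᵐ(x)` over the orthogonal slices `Δ` of `Ω` in `z + P`. -/
def sliceSum {n : ℕ} (Ω : Set (E n)) (m : ℕ) (θ : Set (E n) → ℝ) (φ : E n × Op n → ℝ)
    (P : Op n) (z : E n) : ℝ :=
  ∑ᶠ Δ ∈ orthSlices Ω P z, θ Δ * ∫ x in Δ, φ (x, P) ∂μHE[m]

/-- The sum of `θ_Δ ∫_∂Δ ψ(x, P ∩ T_x S) d𝓗^{m-1}(x)` over the orthogonal slices `Δ` of `Ω`
in `z + P`. -/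
def sliceBoundarySum {n : ℕ} (Ω : Set (E n)) (m : ℕ) (θ : Set (E n) → ℝ)
    (ψ : E n × Op n → ℝ) (P : Op n) (z : E n) : ℝ :=
  ∑ᶠ Δ ∈ orthSlices Ω P z,
    θ Δ * ∫ x in sliceBoundary Δ, ψ (x, planeProj (P.range ⊓ tangentSpace Ω x)) ∂μHE[m - 1]

/-- The iterated integral `∫ ∫ F(P,z) dμ_P^⊥(z) dν(P)` exists and has the value `a`. -/
def HasIteratedIntegral {n : ℕ} (V : Measure (E n × Op n)) (μ : Kernel (Op n) (E n))
    (F : Op n → E n → ℝ) (a : ℝ) : Prop :=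
  (∀ᵐ P ∂(grassMarginal V), Integrable (F P) (perpMarginal μ P)) ∧
  Integrable (fun P => ∫ z, F P z ∂(perpMarginal μ P)) (grassMarginal V) ∧
  a = ∫ P, ∫ z, F P z ∂(perpMarginal μ P) ∂(grassMarginal V)

end OrthVarifold

end

open OrthVarifold

/-!
Curvature zero makes the varifold `V` fall apart into its restrictions to the affine `m`-planes.
In the boundary identity take `φ(x, P) = g(P, x - P x) e(x) h`. The derivative of `g` drops out,
since `x - P x` does not change in the directions of `P` (`derivXDot_test`), so the identity
contains an arbitrary weight `g` on the space of affine planes `z + P`, `z = x - P x`. Writing `V`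
and `Γ` as measures on pairs of an affine plane and a point and disintegrating over the plane, one
obtains measures `κ` and `γ` on almost every plane such that the gradient of `κ` along the plane
is the vector measure `ν^S γ` (`IsOrthogonalAlong.exists_fibers`, tested on characters). That `Γ`
disintegrates over the same measure on the space of planes as `V` is part of the identity: over a
`V`-null set of planes the measure `ν^S Γ` vanishes, and `ν^S` is a unit vector
(`IsOrthogonalAlong.fst_absolutelyContinuous`).

It remains to analyse a single plane. There `κ` is a measure on the compact section `C` of
`closure Ω` and `γ` lives on the closed set `T` of the boundary points with normal tangent to the
plane. Near such a point `C` is bounded by a `C¹` graph with normal `ν^S`, which is expressed by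
cone conditions (`IsConeBoundary`); at the other points of `frontier C` nothing is known about its
shape. In integrated form, the gradient identity compares `κ` with its translates
(`HasNormalGradient`), with the following consequences.

* Away from `T` the measure `κ` is locally invariant under translations, so it is a locally
  constant multiple of Lebesgue measure. At points of `frontier C \ T` the constant is zero,
  because `C` omits points nearby. Hence a component of the interior of `C` has constant density,
  and density zero if its boundary is not contained in `T`.
* `T` is `κ`-null: small pieces of it are moved off `C` by translations against the normal.
* The region swept out by a small piece `A` of `T` when it moves inwards by `s` has `κ`-measure `s
  ∫_A ⟨ν^S, v⟩ dγ`, and its volume is `s` times the area of the projection of `A` along `v`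
  (`HasNormalGradient.measure_sweep`, `volume_sweep`). As `A` shrinks to a point and `v` is the
  normal there, projected area and Hausdorff measure become equal. So on the boundary of each
  component `γ` is the density times Hausdorff measure
  (`HasNormalGradient.boundary_measure_component`).

The components with boundary in `T` are the orthogonal slices. There are finitely many, since
their boundaries are nonempty, `T` is compact and near each point of `T` the interior of `C` has a
single component. This gives `eq_sum_orthSlices`. Since a slice determines its affine plane
(`slice_plane_unique`), the densities found on the various planes define one function `θ`, and
integration over the planes gives the two formulas.
-/

/-! ### Components of the interior of a set with a cone condition -/

namespace OrthVarifold

section ConeGeometry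

set_option linter.unusedSectionVars false

variable {F : Type*} [NormedAddCommGroup F] [InnerProductSpace ℝ F]

theorem tendsto_add_smul_nhdsGT (x w : F) :
    Filter.Tendsto (fun t : ℝ => x + t • w) (𝓝[>] 0) (𝓝 x) := by
  have : Filter.Tendsto (fun t : ℝ => x + t • w) (𝓝 0) (𝓝 (x + (0 : ℝ) • w)) :=
    Continuous.tendsto (by fun_prop) 0
  rw [zero_smul, add_zero] at this
  exact this.mono_left nhdsWithin_le_nhds

/-- Inside the ball of radius `r` about `x₀`, every point lying in the open cone of axis `v` and
aperture parameter `ε` above a point of `C` is interior to `C`. For a unit vector `v`, a boundary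
point `x₀` of a closed set `C` and `ε < 1` this says that near `x₀` the set `C` is the region above
a Lipschitz graph over the hyperplane orthogonal to `v`. -/
def ConeAt (C : Set F) (x₀ v : F) (ε r : ℝ) : Prop :=
  ∀ x ∈ C ∩ Metric.ball x₀ r, ∀ y ∈ Metric.ball x₀ r, ε * ‖y - x‖ < ⟪v, y - x⟫ → y ∈ interior C

theorem ConeAt.mono {C : Set F} {x₀ v : F} {ε r r' : ℝ} (h : ConeAt C x₀ v ε r) (hr : r' ≤ r) :
    ConeAt C x₀ v ε r' := fun x hx y hy hxy =>
  h x ⟨hx.1, Metric.ball_subset_ball hr hx.2⟩ y (Metric.ball_subset_ball hr hy) hxy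

theorem ConeAt.add_smul_mem {C : Set F} {x₀ v x : F} {ε r t : ℝ} (h : ConeAt C x₀ v ε r)
    (hv : ‖v‖ = 1) (hε : ε < 1) (hx : x ∈ C) (hxr : x ∈ Metric.ball x₀ r) (ht : 0 < t)
    (hxt : x + t • v ∈ Metric.ball x₀ r) : x + t • v ∈ interior C := by
  refine h x ⟨hx, hxr⟩ _ hxt ?_
  rw [add_sub_cancel_left, norm_smul, inner_smul_right, real_inner_self_eq_norm_sq, hv,
    Real.norm_of_nonneg ht.le]
  nlinarith

theorem ConeAt.sub_smul_notMem {C : Set F} {x₀ v x : F} {ε r t : ℝ} (h : ConeAt C x₀ v ε r)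
    (hv : ‖v‖ = 1) (hε : ε < 1) (hx : x ∉ interior C) (hxr : x ∈ Metric.ball x₀ r) (ht : 0 < t)
    (hxt : x - t • v ∈ Metric.ball x₀ r) : x - t • v ∉ C := fun hC => hx <| by
  have := h.add_smul_mem hv hε hC hxt ht (by simpa using hxr)
  simpa using this

/-- Two points of `C` off its interior differ by a vector outside the cone. -/
theorem ConeAt.abs_inner_le {C : Set F} {x₀ v x y : F} {ε r : ℝ} (h : ConeAt C x₀ v ε r)
    (hx : x ∈ C \ interior C) (hy : y ∈ C \ interior C) (hxr : x ∈ Metric.ball x₀ r)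
    (hyr : y ∈ Metric.ball x₀ r) : |⟪v, y - x⟫| ≤ ε * ‖y - x‖ := by
  refine abs_le.2 ⟨?_, ?_⟩
  · by_contra! hlt
    refine hx.2 (h y ⟨hy.1, hyr⟩ x hxr ?_)
    rw [← neg_sub y x, inner_neg_right, norm_neg]
    linarith
  · by_contra! hlt
    exact hy.2 (h x ⟨hx.1, hxr⟩ y hyr hlt)

/-- `C` is compact and `T` is a closed part of its boundary along which `C` satisfies cone
conditions of arbitrarily wide aperture with axis the unit vector field `N`, continuous along `T`.
In other words, near the points of `T` the set `C` looks like a domain of class `C¹` with interior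
unit normal `N`; nothing is assumed on the rest of the boundary. -/
structure IsConeBoundary (C T : Set F) (N : F → F) : Prop where
  isCompact : IsCompact C
  isClosed : IsClosed T
  subset_frontier : T ⊆ frontier C
  norm_eq_one : ∀ x ∈ T, ‖N x‖ = 1
  continuousOn : ContinuousOn N T
  cone : ∀ x₀ ∈ T, ∀ ε > 0, ∃ r > 0, ConeAt C x₀ (N x₀) ε r

/-- `D` is a connected component of the interior of `C`. -/
def IsComponent (C D : Set F) : Prop := ∃ x ∈ interior C, D = connectedComponentIn (interior C) x

/-- The components of the interior of `C` whose boundary is contained in `T`. -/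
def componentsWithin (C T : Set F) : Set (Set F) := {D | IsComponent C D ∧ frontier D ⊆ T}

namespace IsComponent

variable {C D D' : Set F}

theorem subset (h : IsComponent C D) : D ⊆ interior C := by
  obtain ⟨x, -, rfl⟩ := h
  exact connectedComponentIn_subset _ _

theorem nonempty (h : IsComponent C D) : D.Nonempty := by
  obtain ⟨x, hx, rfl⟩ := h
  exact ⟨x, mem_connectedComponentIn hx⟩

theorem isOpen (h : IsComponent C D) : IsOpen D := by
  obtain ⟨x, -, rfl⟩ := h
  exact isOpen_interior.connectedComponentIn

theorem isPreconnected (h : IsComponent C D) : IsPreconnected D := by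
  obtain ⟨x, -, rfl⟩ := h
  exact isPreconnected_connectedComponentIn

theorem eq_of_inter (h : IsComponent C D) (h' : IsComponent C D') (hne : (D ∩ D').Nonempty) :
    D = D' := by
  obtain ⟨x, -, rfl⟩ := h
  obtain ⟨x', -, rfl⟩ := h'
  obtain ⟨y, hy, hy'⟩ := hne
  rw [connectedComponentIn_eq hy, connectedComponentIn_eq hy']

theorem mem_of_mem_closure (h : IsComponent C D) {x : F} (hx : x ∈ closure D)
    (hxC : x ∈ interior C) : x ∈ D := by
  have h' : IsComponent C (connectedComponentIn (interior C) x) := ⟨x, hxC, rfl⟩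
  have hmem := mem_connectedComponentIn hxC
  obtain ⟨y, hy, hyD⟩ := mem_closure_iff.1 hx _ h'.isOpen hmem
  rw [h.eq_of_inter h' ⟨y, hyD, hy⟩]
  exact hmem

theorem frontier_subset (h : IsComponent C D) : frontier D ⊆ closure D \ interior C :=
  fun _ hx => ⟨hx.1, fun hxC => hx.2 (h.isOpen.interior_eq.symm ▸ h.mem_of_mem_closure hx.1 hxC)⟩

theorem frontier_subset_frontier (h : IsComponent C D) : frontier D ⊆ frontier C := fun _ hx =>
  ⟨closure_mono (h.subset.trans interior_subset) (h.frontier_subset hx).1, (h.frontier_subset hx).2⟩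

theorem frontier_nonempty [FiniteDimensional ℝ F] [Nontrivial F] (h : IsComponent C D)
    (hC : IsCompact C) : (frontier D).Nonempty := by
  by_contra hne
  rw [not_nonempty_iff_eq_empty, ← isClopen_iff_frontier_eq_empty, isClopen_iff] at hne
  rcases hne with h0 | h1
  · exact h.nonempty.ne_empty h0
  · have : C = univ := univ_subset_iff.1 (h1 ▸ h.subset.trans interior_subset)
    have : NoncompactSpace F := NormedSpace.noncompactSpace ℝ F
    exact noncompact_univ F (‹C = univ› ▸ hC)

end IsComponent

theorem isComponent_of_mem {C : Set F} {x : F} (hx : x ∈ interior C) :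
    IsComponent C (connectedComponentIn (interior C) x) := ⟨x, hx, rfl⟩

namespace IsConeBoundary

variable {C T D D' : Set F} {N : F → F}

theorem mem_sdiff (h : IsConeBoundary C T N) {x : F} (hx : x ∈ T) : x ∈ C \ interior C :=
  ⟨h.isCompact.isClosed.closure_subset (h.subset_frontier hx).1, (h.subset_frontier hx).2⟩

/-- Near a point of `T` the interior of `C` meets a single component: moving along the normal takes
all nearby interior points into a common ball. -/
theorem exists_ball_subset_component (h : IsConeBoundary C T N) {x₀ : F} (hx₀ : x₀ ∈ T) :
    ∃ r > 0, ∃ D, IsComponent C D ∧ interior C ∩ Metric.ball x₀ r ⊆ D ∧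
      frontier C ∩ Metric.ball x₀ r ⊆ frontier D := by
  obtain ⟨R, hR, hcone⟩ := h.cone x₀ hx₀ (1 / 2) (by norm_num)
  set v := N x₀ with hvdef
  have hv : ‖v‖ = 1 := h.norm_eq_one x₀ hx₀
  set s := R / 2 with hs
  have hs0 : 0 < s := by positivity
  have hx₀C : x₀ ∈ C := (h.mem_sdiff hx₀).1
  have hball : Metric.ball (x₀ + s • v) (s / 3) ⊆ interior C := by
    intro y hy
    rw [Metric.mem_ball, dist_eq_norm] at hy
    set w := y - (x₀ + s • v) with hw
    have hyx : y - x₀ = s • v + w := by rw [hw]; abel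
    have hn : ‖y - x₀‖ ≤ s + ‖w‖ := by
      rw [hyx]
      refine (norm_add_le _ _).trans ?_
      rw [norm_smul, hv, Real.norm_of_nonneg hs0.le, mul_one]
    refine hcone x₀ ⟨hx₀C, Metric.mem_ball_self hR⟩ y ?_ ?_
    · rw [Metric.mem_ball, dist_eq_norm]; linarith
    · have h1 : ⟪v, y - x₀⟫ = s + ⟪v, w⟫ := by
        rw [hyx, inner_add_right, inner_smul_right, real_inner_self_eq_norm_sq, hv]; ring
      have h2 : -‖w‖ ≤ ⟪v, w⟫ := by
        have := neg_le_of_abs_le (abs_real_inner_le_norm v w)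
        rwa [hv, one_mul] at this
      rw [h1]; linarith
  have hcomp : interior C ∩ Metric.ball x₀ (s / 3) ⊆
      connectedComponentIn (interior C) (x₀ + s • v) := by
    rintro x ⟨hxC, hx⟩
    have hxs : x + s • v ∈ Metric.ball (x₀ + s • v) (s / 3) := by
      rw [Metric.mem_ball, dist_eq_norm] at hx ⊢
      rwa [add_sub_add_right_eq_sub]
    have hseg : segment ℝ x (x + s • v) ⊆ interior C := by
      rintro y hy
      rw [segment_eq_image'] at hy
      obtain ⟨t, ht, rfl⟩ := hy
      simp only [add_sub_cancel_left, smul_smul]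
      rcases eq_or_lt_of_le ht.1 with h0 | h0
      · simpa [← h0] using hxC
      · have hxR : x ∈ Metric.ball x₀ R := Metric.ball_subset_ball (by linarith) hx
        refine hcone.add_smul_mem hv (by norm_num) (interior_subset hxC) hxR (by positivity) ?_
        rw [Metric.mem_ball, dist_eq_norm] at hx ⊢
        calc ‖x + (t * s) • v - x₀‖ = ‖(x - x₀) + (t * s) • v‖ := by congr 1; abel
          _ ≤ ‖x - x₀‖ + ‖(t * s) • v‖ := norm_add_le _ _
          _ = ‖x - x₀‖ + t * s := by
            rw [norm_smul, hv, Real.norm_of_nonneg (by positivity), mul_one]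
          _ < R := by nlinarith [ht.2]
    have hpre : IsPreconnected (segment ℝ x (x + s • v) ∪ Metric.ball (x₀ + s • v) (s / 3)) :=
      IsPreconnected.union (x + s • v) (right_mem_segment ℝ _ _) hxs
        (convex_segment _ _).isPreconnected (convex_ball _ _).isPreconnected
    exact hpre.subset_connectedComponentIn (Or.inr (Metric.mem_ball_self (by positivity)))
      (union_subset hseg hball) (Or.inl (left_mem_segment ℝ _ _))
  have hDc : IsComponent C (connectedComponentIn (interior C) (x₀ + s • v)) :=
    isComponent_of_mem (hball (Metric.mem_ball_self (by positivity)))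
  refine ⟨s / 3, by positivity, _, hDc, hcomp, ?_⟩
  rintro x ⟨hxC, hx⟩
  have hxC' : x ∈ C := h.isCompact.isClosed.closure_subset hxC.1
  refine ⟨?_, fun hxi => hxC.2 (hDc.subset (interior_subset hxi))⟩
  have hlim : Filter.Tendsto (fun t : ℝ => x + t • v) (𝓝[>] 0) (𝓝 x) :=
    tendsto_add_smul_nhdsGT _ _
  refine mem_closure_of_tendsto hlim ?_
  filter_upwards [hlim (Metric.isOpen_ball.mem_nhds hx), self_mem_nhdsWithin] with t ht ht0
  have hsub : Metric.ball x₀ (s / 3) ⊆ Metric.ball x₀ R := Metric.ball_subset_ball (by linarith)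
  exact hcomp ⟨hcone.add_smul_mem hv (by norm_num) hxC' (hsub hx) ht0 (hsub ht), ht⟩

/-- A point of `T` is on the boundary of at most one component. -/
theorem eq_of_mem_frontier (h : IsConeBoundary C T N) (hD : IsComponent C D)
    (hD' : IsComponent C D') {x₀ : F} (hx₀ : x₀ ∈ T) (hx : x₀ ∈ frontier D)
    (hx' : x₀ ∈ frontier D') : D = D' := by
  obtain ⟨r, hr, D₀, hD₀, hsub, -⟩ := h.exists_ball_subset_component hx₀
  have key : ∀ {G : Set F}, IsComponent C G → x₀ ∈ frontier G → G = D₀ := by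
    intro G hG hxG
    obtain ⟨y, hyb, hyG⟩ := mem_closure_iff.1 hxG.1 _ Metric.isOpen_ball (Metric.mem_ball_self hr)
    exact hG.eq_of_inter hD₀ ⟨y, hyG, hsub ⟨hG.subset hyG, hyb⟩⟩
  rw [key hD hx, key hD' hx']

/-- Each component with boundary in `T` meets one of finitely many balls that cover `T` and see a
single component each. -/
theorem finite_componentsWithin [FiniteDimensional ℝ F] [Nontrivial F]
    (h : IsConeBoundary C T N) : (componentsWithin C T).Finite := by
  have hT : IsCompact T := h.isCompact.of_isClosed_subset h.isClosed fun x hx => (h.mem_sdiff hx).1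
  choose! r hr D hD hsub _ using fun x₀ (hx₀ : x₀ ∈ T) => h.exists_ball_subset_component hx₀
  obtain ⟨t, htT, hcov⟩ := hT.elim_nhds_subcover (fun x => Metric.ball x (r x))
    fun x hx => Metric.ball_mem_nhds x (hr x hx)
  refine (t.finite_toSet.image D).subset ?_
  rintro G ⟨hG, hGT⟩
  obtain ⟨x, hx⟩ := hG.frontier_nonempty h.isCompact
  obtain ⟨y, hyt, hxy⟩ := mem_iUnion₂.1 (hcov (hGT hx))
  obtain ⟨w, hwb, hwG⟩ := mem_closure_iff.1 hx.1 _ Metric.isOpen_ball hxy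
  exact ⟨y, hyt, (hG.eq_of_inter (hD y (htT y hyt))
    ⟨w, hwG, hsub y (htT y hyt) ⟨hG.subset hwG, hwb⟩⟩).symm⟩

end IsConeBoundary

end ConeGeometry

end OrthVarifold

/-! ### Local comparison of measures, and Hausdorff measure of Lipschitz graphs -/

namespace OrthVarifold

open scoped ENNReal NNReal

section Local

/-- An inequality between measures that holds locally holds globally, by the Lindelöf property. -/
theorem measure_le_of_locally_le {X : Type*} [TopologicalSpace X] [SecondCountableTopology X]
    [MeasurableSpace X] [OpensMeasurableSpace X] {μ₁ μ₂ : Measure X} {K : Set X}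
    (h : ∀ x ∈ K, ∃ U, IsOpen U ∧ x ∈ U ∧ ∀ A, MeasurableSet A → A ⊆ K ∩ U → μ₁ A ≤ μ₂ A)
    {A : Set X} (hA : MeasurableSet A) (hAK : A ⊆ K) : μ₁ A ≤ μ₂ A := by
  choose! U hU hxU hle using h
  obtain ⟨t, htK, htc, hcov⟩ := TopologicalSpace.countable_cover_nhdsWithin
    (f := U) (s := K) fun x hx => mem_nhdsWithin_of_mem_nhds ((hU x hx).mem_nhds (hxU x hx))
  rcases t.eq_empty_or_nonempty with rfl | hne
  · have : A = ∅ := by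
      have := hAK.trans hcov
      simpa [subset_empty_iff] using this
    simp [this]
  obtain ⟨f, rfl⟩ := htc.exists_eq_range hne
  have hfK : ∀ i, f i ∈ K := fun i => htK ⟨i, rfl⟩
  have hUm : ∀ i, MeasurableSet (U (f i)) := fun i => (hU _ (hfK i)).measurableSet
  have hAeq : A = ⋃ i, A ∩ disjointed (fun i => U (f i)) i := by
    rw [← inter_iUnion, iUnion_disjointed]
    refine (inter_eq_left.2 (hAK.trans (hcov.trans ?_))).symm
    simp
  have hdm : ∀ i, MeasurableSet (A ∩ disjointed (fun i => U (f i)) i) := fun i =>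
    hA.inter (MeasurableSet.disjointed hUm i)
  have hdisj : Pairwise (Function.onFun Disjoint fun i => A ∩ disjointed (fun i => U (f i)) i) :=
    fun i j hij => ((disjoint_disjointed _) hij).mono inter_subset_right inter_subset_right
  rw [hAeq, measure_iUnion hdisj hdm, measure_iUnion hdisj hdm]
  exact ENNReal.tsum_le_tsum fun i => hle _ (hfK i) _ (hdm i)
    (inter_subset_inter hAK (disjointed_subset _ i))

set_option linter.unusedSectionVars false

variable {F : Type*} [NormedAddCommGroup F] [InnerProductSpace ℝ F] [FiniteDimensional ℝ F]
  [MeasurableSpace F] [BorelSpace F]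

/-- Local uniqueness of Haar measure: a finite measure that is invariant under those translations
that stay inside a ball is a multiple of Lebesgue measure on a smaller ball. The proof is the usual
one, exchanging the order of integration in `∫∫ 1_A(x - k) dk dμ(x)` over small `k`. -/
theorem exists_eq_const_mul_volume_of_locally_invariant {μ : Measure F} [IsFiniteMeasure μ] {x₀ : F}
    {r : ℝ} (hr : 0 < r)
    (hinv : ∀ A, MeasurableSet A → A ⊆ Metric.ball x₀ r → ∀ h : F,
      (fun x => x - h) ⁻¹' A ⊆ Metric.ball x₀ r → μ ((fun x => x - h) ⁻¹' A) = μ A) :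
    ∃ c : ℝ≥0∞, c ≠ ∞ ∧ ∀ A, MeasurableSet A → A ⊆ Metric.ball x₀ (r / 4) →
      μ A = c * volume A := by
  set ρ := r / 4 with hρ
  have hρ0 : 0 < ρ := by positivity
  set B : Set F := Metric.ball 0 ρ with hB
  have hB0 : volume B ≠ 0 := (Metric.measure_ball_pos volume _ hρ0).ne'
  have hBt : volume B ≠ ∞ := measure_ball_lt_top.ne
  have hBm : MeasurableSet B := measurableSet_ball
  refine ⟨μ (Metric.ball x₀ ρ) / volume B, ENNReal.div_ne_top (measure_ne_top _ _) hB0, ?_⟩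
  intro A hA hAsub
  have hball : ∀ w ∈ A, μ ((fun x => x - w) ⁻¹' B) = μ (Metric.ball x₀ ρ) := by
    intro w hw
    have hw' := mem_ball_iff_norm.1 (hAsub hw)
    have : (fun x => x - w) ⁻¹' B = (fun x => x - (w - x₀)) ⁻¹' (Metric.ball x₀ ρ) := by
      ext x
      simp only [hB, mem_preimage, Metric.mem_ball, dist_eq_norm]
      rw [show x - (w - x₀) - x₀ = x - w - 0 by abel]
    rw [this]
    refine hinv _ measurableSet_ball (Metric.ball_subset_ball (by linarith)) _ ?_
    intro x hx
    simp only [mem_preimage, Metric.mem_ball, dist_eq_norm] at hx ⊢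
    calc ‖x - x₀‖ = ‖(x - (w - x₀) - x₀) + (w - x₀)‖ := by congr 1; abel
      _ ≤ _ := norm_add_le _ _
      _ < r := by linarith
  have hshift : ∀ k ∈ B, μ ((fun x => x - k) ⁻¹' A) = μ A := by
    intro k hk
    rw [hB, mem_ball_zero_iff] at hk
    refine hinv A hA (hAsub.trans (Metric.ball_subset_ball (by linarith))) k ?_
    intro x hx
    have hx' := mem_ball_iff_norm.1 (hAsub hx)
    rw [Metric.mem_ball, dist_eq_norm]
    calc ‖x - x₀‖ = ‖(x - k - x₀) + k‖ := by congr 1; abel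
      _ ≤ _ := norm_add_le _ _
      _ < r := by linarith
  have hmeas1 : Measurable fun p : F × F => A.indicator (1 : F → ℝ≥0∞) (p.1 - p.2) *
      B.indicator (1 : F → ℝ≥0∞) p.2 :=
    ((measurable_one.indicator hA).comp (measurable_fst.sub measurable_snd)).mul
      ((measurable_one.indicator hBm).comp measurable_snd)
  have hmeas2 : Measurable fun p : F × F => A.indicator (1 : F → ℝ≥0∞) p.2 *
      B.indicator (1 : F → ℝ≥0∞) (p.1 - p.2) :=
    ((measurable_one.indicator hA).comp measurable_snd).mul
      ((measurable_one.indicator hBm).comp (measurable_fst.sub measurable_snd))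
  have hind : ∀ {A' : Set F}, MeasurableSet A' → ∀ w,
      ∫⁻ x, A'.indicator (1 : F → ℝ≥0∞) (x - w) ∂μ = μ ((fun x => x - w) ⁻¹' A') :=
    fun hA' w => lintegral_indicator_one (hA'.preimage (measurable_id.sub_const w))
  have key : volume B * μ A = μ (Metric.ball x₀ ρ) * volume A := by
    calc volume B * μ A = ∫⁻ k in B, μ A := by rw [lintegral_const, Measure.restrict_apply_univ,
          mul_comm]
      _ = ∫⁻ k in B, ∫⁻ x, A.indicator (1 : F → ℝ≥0∞) (x - k) ∂μ := by
          refine setLIntegral_congr_fun hBm fun k hk => ?_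
          rw [← hshift k hk]
          exact (hind hA k).symm
      _ = ∫⁻ k, ∫⁻ x, A.indicator (1 : F → ℝ≥0∞) (x - k) * B.indicator (1 : F → ℝ≥0∞) k ∂μ := by
          rw [← lintegral_indicator hBm]
          refine lintegral_congr fun k => ?_
          by_cases hk : k ∈ B <;> simp [hk]
      _ = ∫⁻ x, ∫⁻ k, A.indicator (1 : F → ℝ≥0∞) (x - k) * B.indicator (1 : F → ℝ≥0∞) k
          ∂volume ∂μ := by
          rw [lintegral_lintegral_swap]
          exact (hmeas1.comp measurable_swap).aemeasurable
      _ = ∫⁻ x, ∫⁻ w, A.indicator (1 : F → ℝ≥0∞) w * B.indicator (1 : F → ℝ≥0∞) (x - w)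
          ∂volume ∂μ := by
          refine lintegral_congr fun x => ?_
          rw [← lintegral_sub_left_eq_self _ x]
          simp
      _ = ∫⁻ w, ∫⁻ x, A.indicator (1 : F → ℝ≥0∞) w * B.indicator (1 : F → ℝ≥0∞) (x - w) ∂μ := by
          rw [lintegral_lintegral_swap]
          exact hmeas2.aemeasurable
      _ = ∫⁻ w, A.indicator (fun _ => μ (Metric.ball x₀ ρ)) w := by
          refine lintegral_congr fun w => ?_
          by_cases hw : w ∈ A
          · simp only [indicator_of_mem hw, Pi.one_apply, one_mul]
            rw [← hball w hw]
            exact hind hBm w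
          · simp [hw]
      _ = μ (Metric.ball x₀ ρ) * volume A := by rw [lintegral_indicator_const hA]
  rw [ENNReal.div_eq_inv_mul, mul_assoc, ← key, ← mul_assoc, ENNReal.inv_mul_cancel hB0 hBt,
    one_mul]

/-- The points `a + t v` with `a ∈ A` and `0 < t < s`. -/
def sweep (A : Set F) (v : F) (s : ℝ) : Set F := {y | ∃ a ∈ A, ∃ t ∈ Ioo 0 s, y = a + t • v}

/-- The projection of `F` onto the hyperplane orthogonal to a unit vector `v`. -/
def dropProj (v x : F) : F := x - ⟪v, x⟫ • v

theorem dropProj_add_smul {v : F} (hv : ‖v‖ = 1) (x : F) (t : ℝ) :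
    dropProj v (x + t • v) = dropProj v x := by
  simp only [dropProj, inner_add_right, inner_smul_right, real_inner_self_eq_norm_sq, hv]
  module

theorem measurePreserving_smul_add {v : F} (hv : ‖v‖ = 1) :
    MeasurePreserving (fun q : ℝ × (ℝ ∙ v)ᗮ => q.1 • v + q.2) := by
  have h1 : MeasurePreserving (Prod.map (LinearIsometryEquiv.toSpanUnitSingleton (𝕜 := ℝ) v hv)
      (id : (ℝ ∙ v)ᗮ → (ℝ ∙ v)ᗮ)) (volume.prod volume) (volume.prod volume) :=
    (LinearIsometryEquiv.measurePreserving _).prod (MeasurePreserving.id _)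
  have h2 := ((ℝ ∙ v).measurePreserving_measurableEquivProd (0 : F)).symm
  rw [InnerProductSpace.euclideanHausdorffMeasure_eq_volume] at h2
  have h3 := h2.comp h1
  have : (fun q : ℝ × (ℝ ∙ v)ᗮ => q.1 • v + q.2) = ((ℝ ∙ v).measurableEquivProd (0 : F)).symm ∘
      Prod.map (LinearIsometryEquiv.toSpanUnitSingleton (𝕜 := ℝ) v hv) id := by
    ext q
    simp
  rw [this]
  exact h3

theorem coe_orthogonalProjectionOnto_eq_dropProj {v : F} (hv : ‖v‖ = 1) (x : F) :
    ((ℝ ∙ v)ᗮ.orthogonalProjectionOnto x : F) = dropProj v x := by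
  have h := Submodule.starProjection_orthogonal_val (K := ℝ ∙ v) x
  rw [Submodule.starProjection_unit_singleton ℝ hv] at h
  exact h

theorem measurableSet_sweep {A : Set F} {v : F} {s : ℝ} (hA : MeasurableSet A) (hv : ‖v‖ = 1)
    (hinj : InjOn (dropProj v) A) : MeasurableSet (sweep A v s) := by
  have : sweep A v s = (fun p : F × ℝ => p.1 + p.2 • v) '' (A ×ˢ Ioo 0 s) := by
    ext y
    simp only [sweep, mem_ofPred_eq, mem_image, mem_prod, Prod.exists]
    constructor
    · rintro ⟨a, ha, t, ht, rfl⟩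
      exact ⟨a, t, ⟨ha, ht⟩, rfl⟩
    · rintro ⟨a, t, ⟨ha, ht⟩, rfl⟩
      exact ⟨a, ha, t, ht, rfl⟩
  rw [this]
  refine (hA.prod measurableSet_Ioo).image_of_continuousOn_injOn (by fun_prop) ?_
  rintro ⟨a, t⟩ ⟨ha, -⟩ ⟨b, u⟩ ⟨hb, -⟩ hab
  simp only at ha hb hab
  have hab' : a = b := hinj ha hb <| by
    rw [← dropProj_add_smul hv a t, hab, dropProj_add_smul hv]
  subst hab'
  have hv0 : v ≠ 0 := fun h => by simp [h] at hv
  simpa [hv0] using hab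

/-- Cavalieri's principle for the region swept out by a graph `A` over the hyperplane orthogonal
to `v` when it is moved by `s` in the direction `v`. -/
theorem volume_sweep {A : Set F} {v : F} {s : ℝ} (hA : MeasurableSet A) (hv : ‖v‖ = 1)
    (hinj : InjOn (dropProj v) A) :
    volume (sweep A v s) = ENNReal.ofReal s * μHE[Module.finrank ℝ F - 1] (dropProj v '' A) := by
  have hv0 : v ≠ 0 := fun h => by simp [h] at hv
  have hS := measurableSet_sweep (s := s) hA hv hinj
  have hmp := measurePreserving_smul_add hv
  have hrank : Module.finrank ℝ (ℝ ∙ v)ᗮ = Module.finrank ℝ F - 1 := by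
    have := (ℝ ∙ v).finrank_add_finrank_orthogonal
    rw [finrank_span_singleton hv0] at this
    omega
  set π : F → (ℝ ∙ v)ᗮ := (ℝ ∙ v)ᗮ.orthogonalProjectionOnto with hπ
  have hπv : ∀ x, (π x : F) = dropProj v x := coe_orthogonalProjectionOnto_eq_dropProj hv
  have hπm : MeasurableSet (π '' A) := by
    refine hA.image_of_continuousOn_injOn (ContinuousLinearMap.continuous _).continuousOn ?_
    intro a ha b hb hab
    exact hinj ha hb (by rw [← hπv, ← hπv, hab])
  have himg : μHE[Module.finrank ℝ F - 1] (dropProj v '' A) = volume (π '' A) := by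
    have : dropProj v '' A = Subtype.val '' (π '' A) := by
      rw [image_image]
      exact image_congr fun x _ => (hπv x).symm
    rw [this, ← hrank, isometry_subtype_coe.euclideanHausdorffMeasure_image,
      InnerProductSpace.euclideanHausdorffMeasure_eq_volume]
  rw [himg, ← hmp.measure_preimage hS.nullMeasurableSet, Measure.volume_eq_prod,
    Measure.prod_apply_symm (hmp.measurable hS), ← lintegral_indicator_const hπm]
  refine lintegral_congr fun y => ?_
  by_cases hy : y ∈ π '' A
  · rw [indicator_of_mem hy]
    obtain ⟨a, ha, rfl⟩ := hy
    have hdec : ∀ τ : ℝ, τ • v + (π a : F) = a + (τ - ⟪v, a⟫) • v := fun τ => by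
      rw [hπv, dropProj]; module
    have : (fun τ : ℝ => (τ, π a)) ⁻¹' ((fun q : ℝ × (ℝ ∙ v)ᗮ => q.1 • v + q.2) ⁻¹' sweep A v s) =
        Ioo ⟪v, a⟫ (⟪v, a⟫ + s) := by
      ext τ
      simp only [mem_preimage, hdec, sweep, mem_ofPred_eq, mem_Ioo]
      constructor
      · rintro ⟨b, hb, t, ht, hbt⟩
        have hab : a = b := hinj ha hb <| by
          rw [← dropProj_add_smul hv a (τ - ⟪v, a⟫), hbt, dropProj_add_smul hv]
        subst hab
        have : τ - ⟪v, a⟫ = t := by simpa [hv0] using hbt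
        constructor <;> linarith [ht.1, ht.2]
      · intro h
        exact ⟨a, ha, _, ⟨by linarith, by linarith⟩, rfl⟩
    rw [this, Real.volume_Ioo, add_sub_cancel_left]
  · rw [indicator_of_notMem hy]
    have : (fun τ : ℝ => (τ, y)) ⁻¹' ((fun q : ℝ × (ℝ ∙ v)ᗮ => q.1 • v + q.2) ⁻¹' sweep A v s) =
        ∅ := by
      ext τ
      simp only [mem_preimage, sweep, mem_ofPred_eq, mem_empty_iff_false, iff_false]
      rintro ⟨b, hb, t, ht, hbt⟩
      refine hy ⟨b, hb, Subtype.ext ?_⟩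
      rw [hπv, ← dropProj_add_smul hv b t, ← hbt, add_comm, dropProj_add_smul hv]
      have hy0 : ⟪v, (y : F)⟫ = 0 := Submodule.mem_orthogonal_singleton_iff_inner_right.1 y.2
      simp [dropProj, hy0]
    rw [this, measure_empty]

theorem norm_dropProj_le {v : F} (hv : ‖v‖ = 1) (x : F) : ‖dropProj v x‖ ≤ ‖x‖ := by
  rw [← coe_orthogonalProjectionOnto_eq_dropProj hv]
  exact Submodule.norm_orthogonalProjectionOnto_apply_le _ _

theorem dropProj_sub (v x y : F) : dropProj v (x - y) = dropProj v x - dropProj v y := by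
  simp only [dropProj, inner_sub_right]; module

theorem norm_le_norm_dropProj {v x : F} {ε : ℝ} (hv : ‖v‖ = 1) (h : |⟪v, x⟫| ≤ ε * ‖x‖) :
    (1 - ε) * ‖x‖ ≤ ‖dropProj v x‖ := by
  have : ‖x‖ ≤ ‖dropProj v x‖ + |⟪v, x⟫| := by
    calc ‖x‖ = ‖dropProj v x + ⟪v, x⟫ • v‖ := by rw [dropProj, sub_add_cancel]
      _ ≤ _ := norm_add_le _ _
      _ = _ := by rw [norm_smul, hv, mul_one, Real.norm_eq_abs]
  linarith

theorem injOn_dropProj {A : Set F} {v : F} {ε : ℝ} (hv : ‖v‖ = 1) (hε : ε < 1)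
    (h : ∀ x ∈ A, ∀ y ∈ A, |⟪v, y - x⟫| ≤ ε * ‖y - x‖) : InjOn (dropProj v) A := by
  intro x hx y hy hxy
  have h1 := norm_le_norm_dropProj hv (h x hx y hy)
  rw [dropProj_sub, hxy, sub_self, norm_zero] at h1
  have : ‖y - x‖ ≤ 0 := by nlinarith [norm_nonneg (y - x)]
  exact (sub_eq_zero.1 (norm_le_zero_iff.1 this)).symm

theorem euclideanHausdorffMeasure_image_le {X Y : Type*} [EMetricSpace X] [EMetricSpace Y]
    [MeasurableSpace X] [BorelSpace X] [MeasurableSpace Y] [BorelSpace Y] {K : ℝ≥0} {f : X → Y}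
    {s : Set X} (h : LipschitzOnWith K f s) (k : ℕ) :
    μHE[k] (f '' s) ≤ (K : ℝ≥0∞) ^ k * μHE[k] s := by
  simp only [Measure.euclideanHausdorffMeasure_def, Measure.smul_apply, ENNReal.smul_def,
    smul_eq_mul]
  have := h.hausdorffMeasure_image_le (d := (k : ℝ)) (by positivity)
  rw [ENNReal.rpow_natCast] at this
  rw [mul_left_comm]
  gcongr

theorem euclideanHausdorffMeasure_dropProj_image_le {A : Set F} {v : F} (hv : ‖v‖ = 1) (k : ℕ) :
    μHE[k] (dropProj v '' A) ≤ μHE[k] A := by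
  have : LipschitzOnWith 1 (dropProj v) A := LipschitzOnWith.of_dist_le_mul fun x _ y _ => by
    rw [dist_eq_norm, dist_eq_norm, ← dropProj_sub, NNReal.coe_one, one_mul]
    exact norm_dropProj_le hv _
  simpa using euclideanHausdorffMeasure_image_le this k

/-- On a graph of small slope the projection to the hyperplane is inverted by a map with Lipschitz
constant `(1 - ε)⁻¹`. -/
theorem euclideanHausdorffMeasure_le_dropProj_image {A : Set F} {v : F} {ε : ℝ} (hv : ‖v‖ = 1)
    (hε : ε < 1) (h : ∀ x ∈ A, ∀ y ∈ A, |⟪v, y - x⟫| ≤ ε * ‖y - x‖) (k : ℕ) :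
    ENNReal.ofReal ((1 - ε) ^ k) * μHE[k] A ≤ μHE[k] (dropProj v '' A) := by
  have hinj := injOn_dropProj hv hε h
  have h1 : 0 < 1 - ε := by linarith
  set K : ℝ≥0 := (Real.toNNReal (1 - ε))⁻¹ with hK
  have hlip : LipschitzOnWith K (Function.invFunOn (dropProj v) A) (dropProj v '' A) := by
    refine LipschitzOnWith.of_dist_le_mul ?_
    rintro _ ⟨x, hx, rfl⟩ _ ⟨y, hy, rfl⟩
    rw [hinj.leftInvOn_invFunOn hx, hinj.leftInvOn_invFunOn hy, dist_eq_norm, dist_eq_norm,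
      ← dropProj_sub, hK, NNReal.coe_inv, Real.coe_toNNReal _ h1.le, inv_mul_eq_div, le_div_iff₀ h1,
      mul_comm]
    exact norm_le_norm_dropProj hv (h y hy x hx)
  have h2 := euclideanHausdorffMeasure_image_le hlip k
  rw [hinj.leftInvOn_invFunOn.image_image] at h2
  have h3 : ENNReal.ofReal ((1 - ε) ^ k) * (K : ℝ≥0∞) ^ k = 1 := by
    rw [ENNReal.ofReal_pow h1.le, ← mul_pow, hK, ENNReal.coe_inv (by simpa using h1),
      ENNReal.ofReal, ENNReal.mul_inv_cancel (by simpa using h1) ENNReal.coe_ne_top, one_pow]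
  calc _ ≤ ENNReal.ofReal ((1 - ε) ^ k) * ((K : ℝ≥0∞) ^ k * μHE[k] (dropProj v '' A)) := by gcongr
    _ = _ := by rw [← mul_assoc, h3, one_mul]

end Local

end OrthVarifold

/-! ### Measures whose gradient is carried by the normal field of a boundary -/

namespace OrthVarifold

open scoped ENNReal NNReal

section Stationary

set_option linter.unusedSectionVars false

variable {F : Type*} [NormedAddCommGroup F] [InnerProductSpace ℝ F] [FiniteDimensional ℝ F]
  [MeasurableSpace F] [BorelSpace F]

/-- The positive measure `∫₀¹ τ_{th} (⟨N, h⟩⁺ γ) dt`, where `τ_{th}` is the push-forward under the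
translation by `t h`. -/
noncomputable def drift (γ : Measure F) (N : F → F) (h : F) : Measure F :=
  ((volume.restrict (Icc (0 : ℝ) 1)).prod
    (γ.withDensity fun x => ENNReal.ofReal ⟪N x, h⟫)).map fun p => p.2 + p.1 • h

theorem drift_apply {γ : Measure F} [IsFiniteMeasure γ] {N : F → F} (hN : Measurable N) (h : F)
    {A : Set F} (hA : MeasurableSet A) :
    drift γ N h A =
      ∫⁻ x, ENNReal.ofReal ⟪N x, h⟫ * volume ({t : ℝ | x + t • h ∈ A} ∩ Icc 0 1) ∂γ := by
  have hm : Measurable fun p : ℝ × F => p.2 + p.1 • h := by fun_prop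
  have hd : Measurable fun x => ENNReal.ofReal ⟪N x, h⟫ := by fun_prop
  rw [drift, Measure.map_apply hm hA, Measure.prod_apply_symm (hm hA),
    lintegral_withDensity_eq_lintegral_mul _ hd (measurable_measure_prodMk_right (hm hA))]
  refine lintegral_congr fun x => ?_
  rw [Pi.mul_apply, Measure.restrict_apply (measurable_prodMk_right (hm hA))]
  rfl

/-- `μ` is a measure on `C` with distributional gradient `N γ`, where `γ` lives on the part `T` of
the boundary of `C` along which `N` is the interior normal. The gradient identity is stated in
integrated form, as an identity between positive measures. -/
structure HasNormalGradient (C T : Set F) (N : F → F) (μ γ : Measure F) : Prop where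
  boundary : IsConeBoundary C T N
  measurable : Measurable N
  support : μ Cᶜ = 0
  support_boundary : γ Tᶜ = 0
  map_add_drift : ∀ h : F, μ.map (· + h) + drift γ N h = μ + drift γ (-N) h

namespace HasNormalGradient

variable {C T D : Set F} {N : F → F} {μ γ : Measure F} [IsFiniteMeasure μ] [IsFiniteMeasure γ]

theorem apply (H : HasNormalGradient C T N μ γ) (h : F) {A : Set F} (hA : MeasurableSet A) :
    μ ((· + h) ⁻¹' A) +
      ∫⁻ x, ENNReal.ofReal ⟪N x, h⟫ * volume ({t : ℝ | x + t • h ∈ A} ∩ Icc 0 1) ∂γ =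
    μ A + ∫⁻ x, ENNReal.ofReal ⟪-N x, h⟫ * volume ({t : ℝ | x + t • h ∈ A} ∩ Icc 0 1) ∂γ := by
  have := congrArg (fun ν : Measure F => ν A) (H.map_add_drift h)
  simp only [Measure.add_apply] at this
  rwa [Measure.map_apply (measurable_add_const h) hA, drift_apply H.measurable h hA,
    drift_apply H.measurable.neg h hA] at this

theorem ae_mem (H : HasNormalGradient C T N μ γ) : ∀ᵐ x ∂γ, x ∈ T :=
  H.support_boundary

/-- Where the gradient vanishes the measure is invariant under translations. -/
theorem measure_translate (H : HasNormalGradient C T N μ γ) {x₀ : F} {r : ℝ}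
    (hγ : γ (Metric.ball x₀ r) = 0) {A : Set F} (hA : MeasurableSet A)
    (hAr : A ⊆ Metric.ball x₀ r) (h : F) (hAh : (fun x => x - h) ⁻¹' A ⊆ Metric.ball x₀ r) :
    μ ((fun x => x - h) ⁻¹' A) = μ A := by
  have hA' : MeasurableSet ((fun x => x - h) ⁻¹' A) := hA.preimage (measurable_id.sub_const h)
  have hae : ∀ᵐ x ∂γ, {t : ℝ | x + t • h ∈ (fun x => x - h) ⁻¹' A} ∩ Icc 0 1 = ∅ := by
    filter_upwards [measure_eq_zero_iff_ae_notMem.1 hγ] with x hx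
    refine eq_empty_of_forall_notMem ?_
    rintro t ⟨ht, ht01⟩
    refine hx ((convex_ball x₀ r).segment_subset (hAr ht)
      (hAh (show x + t • h ∈ (fun x => x - h) ⁻¹' A from ht)) ?_)
    refine ⟨t, 1 - t, ht01.1, by linarith [ht01.2], by ring, ?_⟩
    module
  have h0 : ∀ M : F → F, ∫⁻ x, ENNReal.ofReal ⟪M x, h⟫ *
      volume ({t : ℝ | x + t • h ∈ (fun x => x - h) ⁻¹' A} ∩ Icc 0 1) ∂γ = 0 := fun M => by
    rw [lintegral_congr_ae (g := 0), lintegral_zero_fun]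
    filter_upwards [hae] with x hx
    rw [hx, measure_empty, mul_zero, Pi.zero_apply]
  have := H.apply h hA'
  rw [h0 N, h0 (fun x => -N x), add_zero, add_zero] at this
  rw [← this, ← preimage_comp]
  congr 2
  ext x
  simp

theorem exists_density_off (H : HasNormalGradient C T N μ γ) {x₀ : F} (hx₀ : x₀ ∉ T) :
    ∃ r > 0, ∃ c : ℝ≥0∞, c ≠ ∞ ∧ ∀ A, MeasurableSet A → A ⊆ Metric.ball x₀ r →
      μ A = c * volume A := by
  obtain ⟨r, hr, hsub⟩ := Metric.isOpen_iff.1 H.boundary.isClosed.isOpen_compl x₀ hx₀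
  have hγ : γ (Metric.ball x₀ r) = 0 := measure_mono_null hsub H.support_boundary
  obtain ⟨c, hc, hcA⟩ := exists_eq_const_mul_volume_of_locally_invariant (μ := μ) (x₀ := x₀) hr
    fun A hA hAr h hAh => H.measure_translate hγ hA hAr h hAh
  exact ⟨r / 4, by positivity, c, hc, hcA⟩

/-- At boundary points off `T` the locally constant density vanishes, since `C` omits points
nearby. -/
theorem exists_ball_null (H : HasNormalGradient C T N μ γ) {x₀ : F} (hx₀ : x₀ ∉ T)
    (hx₀C : x₀ ∉ interior C) : ∃ r > 0, μ (Metric.ball x₀ r) = 0 := by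
  obtain ⟨r, hr, c, hc, hcA⟩ := H.exists_density_off hx₀
  refine ⟨r, hr, ?_⟩
  have hex : ∃ y ∈ Metric.ball x₀ r, y ∉ C := by
    by_contra! hcon
    exact hx₀C (mem_interior.2 ⟨_, hcon, Metric.isOpen_ball, Metric.mem_ball_self hr⟩)
  obtain ⟨y, hy, hyC⟩ := hex
  have hopen : IsOpen (Metric.ball x₀ r ∩ Cᶜ) :=
    Metric.isOpen_ball.inter H.boundary.isCompact.isClosed.isOpen_compl
  have h1 := hcA _ hopen.measurableSet inter_subset_left
  rw [measure_mono_null inter_subset_right H.support] at h1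
  have h2 : volume (Metric.ball x₀ r ∩ Cᶜ) ≠ 0 := (hopen.measure_pos volume ⟨y, hy, hyC⟩).ne'
  have h3 : c = 0 := by
    rcases mul_eq_zero.1 h1.symm with h | h
    · exact h
    · exact absurd h h2
  rw [hcA _ measurableSet_ball Subset.rfl, h3, zero_mul]

/-- `T` is null: its small subsets are moved off `C` by small translations against the normal. -/
theorem measure_eq_zero_of_subset (H : HasNormalGradient C T N μ γ) {x₀ : F} {ε R : ℝ}
    (hx₀ : x₀ ∈ T) (hε : ε < 1) (hR : 0 < R) (hcone : ConeAt C x₀ (N x₀) ε R) {A : Set F}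
    (hA : MeasurableSet A) (hAT : A ⊆ T ∩ Metric.ball x₀ (R / 2)) : μ A = 0 := by
  set v := N x₀ with hv'
  have hv : ‖v‖ = 1 := H.boundary.norm_eq_one x₀ hx₀
  set s := R / 4 with hs
  have hs0 : 0 < s := by positivity
  have hnot : ∀ a ∈ A, ∀ t, 0 < t → t ≤ s → a - t • v ∉ C := by
    intro a ha t ht hts
    have haR := mem_ball_iff_norm.1 (hAT ha).2
    refine hcone.sub_smul_notMem hv hε (H.boundary.mem_sdiff (hAT ha).1).2
      (Metric.ball_subset_ball (by linarith) (hAT ha).2) ht ?_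
    rw [Metric.mem_ball, dist_eq_norm]
    calc ‖a - t • v - x₀‖ = ‖(a - x₀) - t • v‖ := by congr 1; abel
      _ ≤ ‖a - x₀‖ + ‖t • v‖ := norm_sub_le _ _
      _ = ‖a - x₀‖ + t := by rw [norm_smul, hv, Real.norm_of_nonneg ht.le, mul_one]
      _ < R := by linarith
  have h1 := H.apply (s • v) hA
  have h2 : μ ((· + s • v) ⁻¹' A) = 0 := by
    refine measure_mono_null ?_ H.support
    intro x hx hxC
    refine hnot _ hx s hs0 le_rfl ?_
    simpa using hxC
  have h3 : ∫⁻ x, ENNReal.ofReal ⟪N x, s • v⟫ *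
      volume ({t : ℝ | x + t • s • v ∈ A} ∩ Icc 0 1) ∂γ = 0 := by
    rw [lintegral_congr_ae (g := 0), lintegral_zero_fun]
    filter_upwards [H.ae_mem] with x hx
    have : volume ({t : ℝ | x + t • s • v ∈ A} ∩ Icc 0 1) = 0 := by
      refine measure_mono_null (t := {0}) ?_ Real.volume_singleton
      rintro t ⟨ht, ht01⟩
      by_contra ht0
      have ht0' : 0 < t := lt_of_le_of_ne ht01.1 (Ne.symm ht0)
      refine hnot _ ht (t * s) (by positivity) (by nlinarith [ht01.2]) ?_
      rw [smul_smul, add_sub_cancel_right]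
      exact (H.boundary.mem_sdiff hx).1
    simp [this]
  rw [h2, h3, zero_add] at h1
  exact (add_eq_zero.1 h1.symm).1

/-- The flux through a small piece `A` of the boundary, in terms of the mass of the region swept out
by `A` when it is moved inwards. -/
theorem measure_sweep (H : HasNormalGradient C T N μ γ) {x₀ : F} {ε R s : ℝ}
    (hx₀ : x₀ ∈ T) (hε : ε < 1) (hcone : ConeAt C x₀ (N x₀) ε R) {A : Set F}
    (hA : MeasurableSet A) (hAT : A ⊆ T ∩ Metric.ball x₀ (R / 2)) (hs : 0 < s) (hsR : s < R / 2)
    (hpos : ∀ x ∈ A, 0 ≤ ⟪N x, N x₀⟫) :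
    μ (sweep A (N x₀) s) = ∫⁻ x in A, ENNReal.ofReal (s * ⟪N x, N x₀⟫) ∂γ := by
  set v := N x₀ with hv'
  have hv : ‖v‖ = 1 := H.boundary.norm_eq_one x₀ hx₀
  have hball : ∀ a ∈ A, ∀ t : ℝ, |t| ≤ s → a + t • v ∈ Metric.ball x₀ R := by
    intro a ha t hts
    have haR := mem_ball_iff_norm.1 (hAT ha).2
    rw [Metric.mem_ball, dist_eq_norm]
    calc ‖a + t • v - x₀‖ = ‖(a - x₀) + t • v‖ := by congr 1; abel
      _ ≤ ‖a - x₀‖ + ‖t • v‖ := norm_add_le _ _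
      _ = ‖a - x₀‖ + |t| := by rw [norm_smul, hv, Real.norm_eq_abs, mul_one]
      _ < R := by linarith
  have hballA : ∀ a ∈ A, a ∈ Metric.ball x₀ R := fun a ha => by
    simpa using hball a ha 0 (by simpa using hs.le)
  have hnot : ∀ a ∈ A, ∀ t, 0 < t → t ≤ s → a - t • v ∉ C := by
    intro a ha t ht hts
    refine hcone.sub_smul_notMem hv hε (H.boundary.mem_sdiff (hAT ha).1).2 (hballA a ha) ht ?_
    rw [sub_eq_add_neg, ← neg_smul]
    exact hball a ha _ (by rwa [abs_neg, abs_of_pos ht])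
  -- A line in the direction `v` meets the boundary at most once near `x₀`.
  have huniq : ∀ a ∈ A, ∀ t : ℝ, |t| ≤ s → a + t • v ∈ T → t = 0 := by
    intro a ha t hts hT
    by_contra ht0
    rcases lt_or_gt_of_ne ht0 with ht | ht
    · refine hnot a ha (-t) (by linarith) (by rw [abs_of_neg ht] at hts; exact hts) ?_
      rw [neg_smul, sub_neg_eq_add]
      exact (H.boundary.mem_sdiff hT).1
    · exact (H.boundary.mem_sdiff hT).2 (hcone.add_smul_mem hv hε
        (H.boundary.mem_sdiff (hAT ha).1).1 (hballA a ha) ht (hball a ha t hts))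
  have hinj : InjOn (dropProj v) A := injOn_dropProj hv hε fun x hx y hy =>
    hcone.abs_inner_le (H.boundary.mem_sdiff (hAT hx).1) (H.boundary.mem_sdiff (hAT hy).1)
      (hballA x hx) (hballA y hy)
  have hS : MeasurableSet (sweep A v s) := measurableSet_sweep hA hv hinj
  have hsec : ∀ x ∈ T, volume ({t : ℝ | x + t • s • v ∈ sweep A v s} ∩ Icc 0 1) =
      A.indicator 1 x := by
    intro x hx
    have key : ∀ t ∈ Icc (0 : ℝ) 1, x + t • s • v ∈ sweep A v s → x ∈ A ∧ t ∈ Ioo (0 : ℝ) 1 := by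
      rintro t ht ⟨a, ha, t', ht', hat⟩
      have hxa : x = a + (t' - t * s) • v := by
        rw [sub_smul, ← add_sub_assoc, ← hat, smul_smul]; abel
      have h0 : t' - t * s = 0 := by
        refine huniq a ha _ (abs_le.2 ⟨?_, ?_⟩) (hxa ▸ hx)
        · nlinarith [ht.1, ht.2, ht'.1, ht'.2]
        · nlinarith [ht.1, ht.2, ht'.1, ht'.2, mul_nonneg ht.1 hs.le]
      rw [h0, zero_smul, add_zero] at hxa
      refine ⟨hxa ▸ ha, ?_, ?_⟩
      · by_contra hcon
        nlinarith [ht.1, ht'.1]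
      · by_contra hcon
        nlinarith [ht.1, ht'.2]
    by_cases hxA : x ∈ A
    · have : {t : ℝ | x + t • s • v ∈ sweep A v s} ∩ Icc 0 1 = Ioo 0 1 := by
        ext t
        constructor
        · rintro ⟨ht, ht01⟩
          exact (key t ht01 ht).2
        · intro ht
          refine ⟨⟨x, hxA, t * s, ⟨mul_pos ht.1 hs, by nlinarith [ht.2]⟩, by rw [smul_smul]⟩,
            Ioo_subset_Icc_self ht⟩
      rw [this, indicator_of_mem hxA, Real.volume_Ioo]
      simp
    · have : {t : ℝ | x + t • s • v ∈ sweep A v s} ∩ Icc 0 1 = ∅ := by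
        refine eq_empty_of_forall_notMem ?_
        rintro t ⟨ht, ht01⟩
        exact hxA (key t ht01 ht).1
      rw [this, indicator_of_notMem hxA, measure_empty]
  have h1 := H.apply (s • v) hS
  have h2 : μ ((· + s • v) ⁻¹' sweep A v s) = 0 := by
    refine measure_mono_null ?_ H.support
    rintro x ⟨a, ha, t, ht, hat⟩ hxC
    refine hnot a ha (s - t) (by linarith [ht.2]) (by linarith [ht.1]) ?_
    have : x = a - (s - t) • v := by
      rw [sub_smul, sub_sub_eq_add_sub, ← hat, add_sub_cancel_right]
    exact this ▸ hxC
  have h3 : ∫⁻ x, ENNReal.ofReal ⟪N x, s • v⟫ *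
      volume ({t : ℝ | x + t • s • v ∈ sweep A v s} ∩ Icc 0 1) ∂γ =
      ∫⁻ x in A, ENNReal.ofReal (s * ⟪N x, v⟫) ∂γ := by
    rw [← lintegral_indicator hA]
    refine lintegral_congr_ae ?_
    filter_upwards [H.ae_mem] with x hx
    rw [hsec x hx, inner_smul_right]
    by_cases hxA : x ∈ A <;> simp [hxA]
  have h4 : ∫⁻ x, ENNReal.ofReal ⟪-N x, s • v⟫ *
      volume ({t : ℝ | x + t • s • v ∈ sweep A v s} ∩ Icc 0 1) ∂γ = 0 := by
    rw [lintegral_congr_ae (g := 0), lintegral_zero_fun]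
    filter_upwards [H.ae_mem] with x hx
    rw [hsec x hx, inner_smul_right]
    by_cases hxA : x ∈ A
    · have : s * ⟪-N x, v⟫ ≤ 0 := by
        rw [inner_neg_left]
        nlinarith [hpos x hxA]
      rw [ENNReal.ofReal_of_nonpos this, zero_mul, Pi.zero_apply]
    · simp [hxA]
  rw [h2, h3, h4, zero_add, add_zero] at h1
  exact h1.symm

end HasNormalGradient

end Stationary

end OrthVarifold

/-! ### Decomposition into components -/

namespace OrthVarifold

open scoped ENNReal NNReal

section Decomposition

set_option linter.unusedSectionVars false

variable {F : Type*} [NormedAddCommGroup F] [InnerProductSpace ℝ F] [FiniteDimensional ℝ F]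
  [MeasurableSpace F] [BorelSpace F]

theorem le_of_forall_one_sub_pow_mul_le {a b : ℝ≥0∞} (k : ℕ)
    (h : ∀ ε : ℝ, 0 < ε → ε < 1 → ENNReal.ofReal ((1 - ε) ^ k) * a ≤ b) : a ≤ b := by
  have hlim : Filter.Tendsto (fun ε : ℝ => ENNReal.ofReal ((1 - ε) ^ k) * a) (𝓝[>] 0) (𝓝 a) := by
    have h1 : Filter.Tendsto (fun ε : ℝ => ENNReal.ofReal ((1 - ε) ^ k)) (𝓝[>] 0) (𝓝 1) := by
      have hc : Continuous fun ε : ℝ => ENNReal.ofReal ((1 - ε) ^ k) :=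
        ENNReal.continuous_ofReal.comp (by fun_prop)
      have := hc.tendsto 0
      simp only [sub_zero, one_pow, ENNReal.ofReal_one] at this
      exact this.mono_left nhdsWithin_le_nhds
    simpa using ENNReal.Tendsto.mul_const h1 (Or.inl one_ne_zero)
  refine le_of_tendsto hlim ?_
  filter_upwards [Ioo_mem_nhdsGT (zero_lt_one' ℝ)] with ε hε
  exact h ε hε.1 hε.2

theorem IsComponent.volume_ne_zero {C D : Set F} (hD : IsComponent C D) : volume D ≠ 0 :=
  (hD.isOpen.measure_pos volume hD.nonempty).ne'

theorem IsComponent.volume_ne_top {C D : Set F} (hD : IsComponent C D) (hC : IsCompact C) :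
    volume D ≠ ∞ :=
  ((measure_mono (hD.subset.trans interior_subset)).trans_lt hC.measure_lt_top).ne

/-- Lipschitz graphs have locally finite Hausdorff measure. -/
theorem IsConeBoundary.euclideanHausdorffMeasure_frontier_lt_top {C T D : Set F} {N : F → F}
    (h : IsConeBoundary C T N) (hD : D ∈ componentsWithin C T) :
    μHE[Module.finrank ℝ F - 1] (frontier D) < ∞ := by
  have hcomp : IsCompact (frontier D) := h.isCompact.of_isClosed_subset isClosed_frontier
    fun x hx => (h.mem_sdiff (hD.2 hx)).1
  refine hcomp.measure_lt_top_of_nhdsWithin fun x₀ hx₀ => ?_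
  have hx₀T := hD.2 hx₀
  obtain ⟨R, hR, hcone⟩ := h.cone x₀ hx₀T (1 / 2) (by norm_num)
  have hv := h.norm_eq_one x₀ hx₀T
  set A := frontier D ∩ Metric.ball x₀ R with hA
  refine ⟨A, inter_mem_nhdsWithin _ (Metric.ball_mem_nhds x₀ hR), ?_⟩
  have hle := euclideanHausdorffMeasure_le_dropProj_image (A := A) hv (ε := 1 / 2) (by norm_num)
    (fun x hx y hy => hcone.abs_inner_le (h.mem_sdiff (hD.2 hx.1)) (h.mem_sdiff (hD.2 hy.1))
      hx.2 hy.2) (Module.finrank ℝ F - 1)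
  have hv0 : N x₀ ≠ 0 := fun h0 => by simp [h0] at hv
  have hrank : Module.finrank ℝ (ℝ ∙ N x₀)ᗮ = Module.finrank ℝ F - 1 := by
    have := (ℝ ∙ N x₀).finrank_add_finrank_orthogonal
    rw [finrank_span_singleton hv0] at this
    omega
  have himg : dropProj (N x₀) '' A =
      Subtype.val '' ((ℝ ∙ N x₀)ᗮ.orthogonalProjectionOnto '' A) := by
    rw [image_image]
    exact image_congr fun x _ => (coe_orthogonalProjectionOnto_eq_dropProj hv x).symm
  have hfin : μHE[Module.finrank ℝ F - 1] (dropProj (N x₀) '' A) < ∞ := by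
    rw [himg, ← hrank, isometry_subtype_coe.euclideanHausdorffMeasure_image,
      InnerProductSpace.euclideanHausdorffMeasure_eq_volume]
    refine Bornology.IsBounded.measure_lt_top ?_
    have : Bornology.IsBounded A := Metric.isBounded_ball.subset inter_subset_right
    exact (ContinuousLinearMap.lipschitz
      ((ℝ ∙ N x₀)ᗮ.orthogonalProjectionOnto)).isBounded_image this
  have hlt := hle.trans_lt hfin
  by_contra hcon
  rw [not_lt, top_le_iff] at hcon
  rw [hcon, ENNReal.mul_top (by
    rw [Ne, ENNReal.ofReal_eq_zero, not_le]; positivity)] at hlt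
  exact lt_irrefl _ hlt

namespace HasNormalGradient

variable {C T D : Set F} {N : F → F} {μ γ : Measure F} [IsFiniteMeasure μ] [IsFiniteMeasure γ]

/-- On a component of the interior of `C` the density is constant. -/
theorem exists_density_component (H : HasNormalGradient C T N μ γ) (hD : IsComponent C D) :
    ∃ c : ℝ≥0∞, ∀ A, MeasurableSet A → A ⊆ D → μ A = c * volume A := by
  have hoff : ∀ x ∈ interior C, x ∉ T := fun x hx hxT => (H.boundary.mem_sdiff hxT).2 hx
  choose! r hr c hc hcA using fun x (hx : x ∉ T) => H.exists_density_off hx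
  have hloc : ∀ x ∈ interior C, ∀ y ∈ Metric.ball x (r x) ∩ interior C, c y = c x := by
    rintro x hx y ⟨hyx, hy⟩
    have hopen : IsOpen (Metric.ball x (r x) ∩ Metric.ball y (r y)) :=
      Metric.isOpen_ball.inter Metric.isOpen_ball
    have h1 := hcA x (hoff x hx) _ hopen.measurableSet inter_subset_left
    rw [hcA y (hoff y hy) _ hopen.measurableSet inter_subset_right] at h1
    refine (ENNReal.mul_left_inj ?_ ?_).1 h1
    · exact (hopen.measure_pos volume ⟨y, hyx, Metric.mem_ball_self (hr y (hoff y hy))⟩).ne'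
    · exact ((measure_mono inter_subset_left).trans_lt measure_ball_lt_top).ne
  obtain ⟨x₀, hx₀⟩ := hD.nonempty
  have hopenset : ∀ p : ℝ≥0∞ → Prop, IsOpen {x | x ∈ D ∧ p (c x)} := by
    intro p
    refine isOpen_iff_mem_nhds.2 ?_
    rintro x ⟨hxD, hpx⟩
    have hxC := hD.subset hxD
    filter_upwards [Metric.ball_mem_nhds x (hr x (hoff x hxC)), hD.isOpen.mem_nhds hxD]
      with y hy hyD
    exact ⟨hyD, by rwa [hloc x hxC y ⟨hy, hD.subset hyD⟩]⟩
  have hconst : D ⊆ {x | x ∈ D ∧ c x = c x₀} := by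
    refine hD.isPreconnected.subset_left_of_subset_union (hopenset (· = c x₀))
      (hopenset (· ≠ c x₀)) ?_ ?_ ⟨x₀, hx₀, hx₀, rfl⟩
    · rw [Set.disjoint_left]
      rintro x ⟨-, h1⟩ ⟨-, h2⟩
      exact h2 h1
    · intro x hx
      by_cases h : c x = c x₀
      · exact Or.inl ⟨hx, h⟩
      · exact Or.inr ⟨hx, h⟩
  refine ⟨c x₀, fun A hA hAD => ?_⟩
  have hlocal : ∀ x ∈ D, ∃ U, IsOpen U ∧ x ∈ U ∧ ∀ A, MeasurableSet A → A ⊆ D ∩ U →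
      μ A = (c x₀ • volume : Measure F) A := fun x hx => by
    have hx' := hoff x (hD.subset hx)
    refine ⟨Metric.ball x (r x), Metric.isOpen_ball, Metric.mem_ball_self (hr x hx'), ?_⟩
    intro A hA hAD
    rw [hcA x hx' A hA (hAD.trans inter_subset_right), (hconst hx).2]
    rfl
  refine le_antisymm ?_ ?_
  · refine (measure_le_of_locally_le (μ₂ := c x₀ • volume) (fun x hx => ?_) hA hAD)
    obtain ⟨U, hU, hxU, h⟩ := hlocal x hx
    exact ⟨U, hU, hxU, fun A hA hAU => (h A hA hAU).le⟩
  · refine (measure_le_of_locally_le (μ₁ := c x₀ • volume) (fun x hx => ?_) hA hAD)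
    obtain ⟨U, hU, hxU, h⟩ := hlocal x hx
    exact ⟨U, hU, hxU, fun A hA hAU => (h A hA hAU).ge⟩

theorem measure_eq_density_mul (H : HasNormalGradient C T N μ γ) (hD : IsComponent C D)
    {A : Set F} (hA : MeasurableSet A) (hAD : A ⊆ D) : μ A = μ D / volume D * volume A := by
  obtain ⟨c, hc⟩ := H.exists_density_component hD
  rw [hc A hA hAD, hc D hD.isOpen.measurableSet Subset.rfl,
    ENNReal.mul_div_cancel_right hD.volume_ne_zero (hD.volume_ne_top H.boundary.isCompact)]

/-- A component with a boundary point off `T` carries no mass: its constant density vanishes near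
that point. -/
theorem measure_component_eq_zero (H : HasNormalGradient C T N μ γ) (hD : IsComponent C D)
    (hDT : ¬ frontier D ⊆ T) : μ D = 0 := by
  obtain ⟨x, hx, hxT⟩ := not_subset.1 hDT
  obtain ⟨r, hr, hnull⟩ := H.exists_ball_null hxT (hD.frontier_subset hx).2
  obtain ⟨y, hyb, hyD⟩ := mem_closure_iff.1 hx.1 _ Metric.isOpen_ball (Metric.mem_ball_self hr)
  have hopen : IsOpen (D ∩ Metric.ball x r) := hD.isOpen.inter Metric.isOpen_ball
  have h1 := H.measure_eq_density_mul hD hopen.measurableSet inter_subset_left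
  rw [measure_mono_null inter_subset_right hnull] at h1
  have h2 : volume (D ∩ Metric.ball x r) ≠ 0 := (hopen.measure_pos volume ⟨y, hyD, hyb⟩).ne'
  rcases mul_eq_zero.1 h1.symm with h | h
  · exact (ENNReal.div_eq_zero_iff.1 h).resolve_right (hD.volume_ne_top H.boundary.isCompact)
  · exact absurd h h2

/-- The measure is carried by the components with boundary in `T`. -/
theorem measure_compl_components (H : HasNormalGradient C T N μ γ) :
    μ (⋃ D ∈ componentsWithin C T, D)ᶜ = 0 := by
  have h1 : μ (frontier C \ T) = 0 := by
    refine measure_null_of_locally_null _ fun x hx => ?_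
    obtain ⟨r, hr, h⟩ := H.exists_ball_null hx.2 hx.1.2
    exact ⟨_, mem_nhdsWithin_of_mem_nhds (Metric.ball_mem_nhds x hr), h⟩
  have h2 : μ T = 0 := by
    refine measure_null_of_locally_null _ fun x hx => ?_
    obtain ⟨R, hR, hcone⟩ := H.boundary.cone x hx (1 / 2) (by norm_num)
    refine ⟨T ∩ Metric.ball x (R / 2),
      inter_mem_nhdsWithin _ (Metric.ball_mem_nhds x (by positivity)), ?_⟩
    exact H.measure_eq_zero_of_subset hx (by norm_num) hR hcone
      (H.boundary.isClosed.measurableSet.inter measurableSet_ball) Subset.rfl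
  have h3 : μ (interior C \ ⋃ D ∈ componentsWithin C T, D) = 0 := by
    refine measure_null_of_locally_null _ fun x hx => ?_
    have hc := isComponent_of_mem hx.1
    have hmem := mem_connectedComponentIn hx.1
    refine ⟨_, mem_nhdsWithin_of_mem_nhds (hc.isOpen.mem_nhds hmem),
      H.measure_component_eq_zero hc fun hT => hx.2 ?_⟩
    exact mem_iUnion₂.2 ⟨_, ⟨hc, hT⟩, hmem⟩
  refine measure_mono_null (t := Cᶜ ∪ (frontier C \ T) ∪ T ∪
    (interior C \ ⋃ D ∈ componentsWithin C T, D)) ?_ ?_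
  · intro x hx
    by_cases hxC : x ∈ C
    · by_cases hxi : x ∈ interior C
      · exact Or.inr ⟨hxi, hx⟩
      · by_cases hxT : x ∈ T
        · exact Or.inl (Or.inr hxT)
        · exact Or.inl (Or.inl (Or.inr ⟨⟨subset_closure hxC, hxi⟩, hxT⟩))
    · exact Or.inl (Or.inl (Or.inl hxC))
  · simp [H.support, h1, h2, h3, measure_union_null_iff]

/-- Continuity of the normal and the cone conditions combined. -/
theorem exists_radius (H : HasNormalGradient C T N μ γ) {x₀ : F} (hx₀ : x₀ ∈ T) {ε : ℝ}
    (hε : 0 < ε) : ∃ R > 0, ConeAt C x₀ (N x₀) ε R ∧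
      ∀ x ∈ T ∩ Metric.ball x₀ R, 1 - ε ≤ ⟪N x, N x₀⟫ ∧ ⟪N x, N x₀⟫ ≤ 1 := by
  obtain ⟨R, hR, hcone⟩ := H.boundary.cone x₀ hx₀ ε hε
  have hv := H.boundary.norm_eq_one x₀ hx₀
  have hcont : ContinuousWithinAt (fun x => ⟪N x, N x₀⟫) T x₀ :=
    (H.boundary.continuousOn x₀ hx₀).inner continuousWithinAt_const
  have hmem : ∀ᶠ x in 𝓝[T] x₀, 1 - ε < ⟪N x, N x₀⟫ := by
    refine hcont.eventually (lt_mem_nhds ?_)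
    have : ⟪N x₀, N x₀⟫ = 1 := by rw [real_inner_self_eq_norm_sq, hv, one_pow]
    linarith
  obtain ⟨R', hR', hsub⟩ := Metric.mem_nhdsWithin_iff.1 hmem
  refine ⟨min R R', lt_min hR hR', hcone.mono (min_le_left _ _), fun x hx => ⟨?_, ?_⟩⟩
  · exact (hsub ⟨Metric.ball_subset_ball (min_le_right _ _) hx.2, hx.1⟩ : _ < _).le
  · have := real_inner_le_norm (N x) (N x₀)
    rwa [hv, H.boundary.norm_eq_one x hx.1, one_mul] at this

theorem sweep_subset (H : HasNormalGradient C T N μ γ) {x₀ : F} {ε R s : ℝ}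
    (hx₀ : x₀ ∈ T) (hε : ε < 1) (hcone : ConeAt C x₀ (N x₀) ε R) {A : Set F}
    (hAT : A ⊆ T ∩ Metric.ball x₀ (R / 2)) (hsR : s < R / 2) :
    sweep A (N x₀) s ⊆ interior C ∩ Metric.ball x₀ R := by
  rintro _ ⟨a, ha, t, ht, rfl⟩
  have hv := H.boundary.norm_eq_one x₀ hx₀
  have haR := mem_ball_iff_norm.1 (hAT ha).2
  have hball : a + t • N x₀ ∈ Metric.ball x₀ R := by
    rw [Metric.mem_ball, dist_eq_norm]
    calc ‖a + t • N x₀ - x₀‖ = ‖(a - x₀) + t • N x₀‖ := by congr 1; abel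
      _ ≤ ‖a - x₀‖ + ‖t • N x₀‖ := norm_add_le _ _
      _ = ‖a - x₀‖ + t := by rw [norm_smul, hv, Real.norm_of_nonneg ht.1.le, mul_one]
      _ < R := by linarith [ht.2]
  refine ⟨hcone.add_smul_mem hv hε (H.boundary.mem_sdiff (hAT ha).1).1 ?_ ht.1 hball, hball⟩
  exact Metric.ball_subset_ball (by linarith [ht.1, ht.2]) (hAT ha).2

/-- Bounds for the flux through a small piece `A` of the boundary of a component. -/
theorem flux_bounds (H : HasNormalGradient C T N μ γ) {x₀ : F} (hx₀ : x₀ ∈ T) {ε : ℝ}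
    (hε : 0 < ε) (hε1 : ε < 1) : ∃ r > 0, ∃ D, IsComponent C D ∧ x₀ ∈ frontier D ∧
      ∀ A, MeasurableSet A → A ⊆ T ∩ Metric.ball x₀ r →
        (∀ x ∈ A, ∀ y ∈ A, |⟪N x₀, y - x⟫| ≤ ε * ‖y - x‖) ∧
        ENNReal.ofReal (1 - ε) * γ A ≤
          μ D / volume D * μHE[Module.finrank ℝ F - 1] (dropProj (N x₀) '' A) ∧
        μ D / volume D * μHE[Module.finrank ℝ F - 1] (dropProj (N x₀) '' A) ≤ γ A := by
  obtain ⟨R₁, hR₁, hcone, hN⟩ := H.exists_radius hx₀ hε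
  obtain ⟨R₂, hR₂, D, hD, hsub, hfr⟩ := H.boundary.exists_ball_subset_component hx₀
  set R := min R₁ R₂ with hRdef
  have hR : 0 < R := lt_min hR₁ hR₂
  have hv := H.boundary.norm_eq_one x₀ hx₀
  have hconeR : ConeAt C x₀ (N x₀) ε R := hcone.mono (min_le_left _ _)
  refine ⟨R / 2, by positivity, D, hD,
    hfr ⟨H.boundary.subset_frontier hx₀, Metric.mem_ball_self hR₂⟩, fun A hA hAT => ?_⟩
  have hballR : Metric.ball x₀ (R / 2) ⊆ Metric.ball x₀ R :=
    Metric.ball_subset_ball (by linarith)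
  have hgraph : ∀ x ∈ A, ∀ y ∈ A, |⟪N x₀, y - x⟫| ≤ ε * ‖y - x‖ := fun x hx y hy =>
    hconeR.abs_inner_le (H.boundary.mem_sdiff (hAT hx).1) (H.boundary.mem_sdiff (hAT hy).1)
      (hballR (hAT hx).2) (hballR (hAT hy).2)
  have hNA : ∀ x ∈ A, 1 - ε ≤ ⟪N x, N x₀⟫ ∧ ⟪N x, N x₀⟫ ≤ 1 := fun x hx =>
    hN x ⟨(hAT hx).1, Metric.ball_subset_ball (min_le_left _ _) (hballR (hAT hx).2)⟩
  set s := R / 4 with hs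
  have hs0 : 0 < s := by positivity
  have hinj := injOn_dropProj hv hε1 hgraph
  have hsweep := H.measure_sweep hx₀ hε1 hconeR hA hAT hs0 (by linarith)
    fun x hx => by linarith [(hNA x hx).1]
  have hsubD : sweep A (N x₀) s ⊆ D := (H.sweep_subset hx₀ hε1 hconeR hAT (by linarith)).trans
    ((inter_subset_inter_right _ (Metric.ball_subset_ball (min_le_right _ _))).trans hsub)
  rw [H.measure_eq_density_mul hD (measurableSet_sweep hA hv hinj) hsubD,
    volume_sweep hA hv hinj] at hsweep
  have hs1 : ENNReal.ofReal s ≠ 0 := by simpa using hs0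
  refine ⟨hgraph, ?_, ?_⟩
  · refine (ENNReal.mul_le_mul_iff_right hs1 ENNReal.ofReal_ne_top).1 ?_
    rw [mul_left_comm _ (μ D / volume D), hsweep, ← mul_assoc, ← ENNReal.ofReal_mul hs0.le,
      ← setLIntegral_const]
    refine setLIntegral_mono_ae' hA (Filter.Eventually.of_forall fun x hx => ?_)
    exact ENNReal.ofReal_le_ofReal (mul_le_mul_of_nonneg_left (hNA x hx).1 hs0.le)
  · refine (ENNReal.mul_le_mul_iff_right hs1 ENNReal.ofReal_ne_top).1 ?_
    rw [mul_left_comm _ (μ D / volume D), hsweep, ← setLIntegral_const]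
    refine setLIntegral_mono_ae' hA (Filter.Eventually.of_forall fun x hx => ?_)
    exact ENNReal.ofReal_le_ofReal (by nlinarith [(hNA x hx).2])

/-- The boundary measure is carried by the boundaries of the components with boundary in `T`. -/
theorem boundary_measure_compl (H : HasNormalGradient C T N μ γ) :
    γ (⋃ D ∈ componentsWithin C T, frontier D)ᶜ = 0 := by
  have h1 : γ (T \ ⋃ D ∈ componentsWithin C T, frontier D) = 0 := by
    refine measure_null_of_locally_null _ fun x hx => ?_
    obtain ⟨r, hr, D, hD, hxD, hA⟩ := H.flux_bounds hx.1 (ε := 1 / 2) (by norm_num) (by norm_num)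
    have hnot : ¬ frontier D ⊆ T := fun hT => hx.2 (mem_iUnion₂.2 ⟨D, ⟨hD, hT⟩, hxD⟩)
    have hm : MeasurableSet (T ∩ Metric.ball x r) :=
      H.boundary.isClosed.measurableSet.inter measurableSet_ball
    have h0 := (hA _ hm Subset.rfl).2.1
    rw [H.measure_component_eq_zero hD hnot, ENNReal.zero_div, zero_mul, nonpos_iff_eq_zero,
      mul_eq_zero] at h0
    refine ⟨T ∩ Metric.ball x r, mem_nhdsWithin.2 ⟨Metric.ball x r, Metric.isOpen_ball,
      Metric.mem_ball_self hr, fun y hy => ⟨hy.2.1, hy.1⟩⟩, h0.resolve_left ?_⟩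
    norm_num
  refine measure_mono_null (t := Tᶜ ∪ (T \ ⋃ D ∈ componentsWithin C T, frontier D)) ?_
    (measure_union_null H.support_boundary h1)
  intro x hx
  by_cases hxT : x ∈ T
  · exact Or.inr ⟨hxT, hx⟩
  · exact Or.inl hxT

/-- On the boundary of a component `γ` is the density times the Hausdorff measure: locally the two
agree up to factors `(1 - ε)ᵏ`, and `ε` is arbitrary. -/
theorem boundary_measure_component (H : HasNormalGradient C T N μ γ)
    (hD : D ∈ componentsWithin C T) {A : Set F} (hA : MeasurableSet A) (hAD : A ⊆ frontier D) :
    γ A = μ D / volume D * μHE[Module.finrank ℝ F - 1] A := by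
  set k := Module.finrank ℝ F - 1 with hk
  have hloc : ∀ ε : ℝ, 0 < ε → ε < 1 → ∀ x ∈ frontier D, ∃ U, IsOpen U ∧ x ∈ U ∧
      ∀ A, MeasurableSet A → A ⊆ frontier D ∩ U →
        ENNReal.ofReal ((1 - ε) ^ 1) * γ A ≤ μ D / volume D * μHE[k] A ∧
        ENNReal.ofReal ((1 - ε) ^ k) * (μ D / volume D * μHE[k] A) ≤ γ A := by
    intro ε hε hε1 x hx
    have hxT := hD.2 hx
    obtain ⟨r, hr, D', hD', hxD', hb⟩ := H.flux_bounds hxT hε hε1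
    obtain rfl := H.boundary.eq_of_mem_frontier hD.1 hD' hxT hx hxD'
    refine ⟨Metric.ball x r, Metric.isOpen_ball, Metric.mem_ball_self hr, fun A hA hAU => ?_⟩
    obtain ⟨hg, h1, h2⟩ := hb A hA (hAU.trans (inter_subset_inter_left _ hD.2))
    have hv := H.boundary.norm_eq_one x hxT
    constructor
    · rw [pow_one]
      exact h1.trans (mul_le_mul_right (euclideanHausdorffMeasure_dropProj_image_le hv k) _)
    · rw [mul_left_comm]
      refine le_trans ?_ h2
      exact mul_le_mul_right (euclideanHausdorffMeasure_le_dropProj_image hv hε1 hg k) _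
  refine le_antisymm ?_ ?_
  · refine le_of_forall_one_sub_pow_mul_le 1 fun ε hε hε1 => ?_
    refine measure_le_of_locally_le (μ₁ := ENNReal.ofReal ((1 - ε) ^ 1) • γ)
      (μ₂ := (μ D / volume D) • μHE[k]) (fun x hx => ?_) hA hAD
    obtain ⟨U, hU, hxU, h⟩ := hloc ε hε hε1 x hx
    exact ⟨U, hU, hxU, fun A hA hAU => (h A hA hAU).1⟩
  · refine le_of_forall_one_sub_pow_mul_le k fun ε hε hε1 => ?_
    refine measure_le_of_locally_le
      (μ₁ := ENNReal.ofReal ((1 - ε) ^ k) • (μ D / volume D) • μHE[k]) (μ₂ := γ)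
      (fun x hx => ?_) hA hAD
    obtain ⟨U, hU, hxU, h⟩ := hloc ε hε hε1 x hx
    exact ⟨U, hU, hxU, fun A hA hAU => (h A hA hAU).2⟩

theorem pairwiseDisjoint_components : (componentsWithin C T).PairwiseDisjoint fun D => D := by
  intro D hD D' hD' hne
  rw [Function.onFun, Set.disjoint_iff_inter_eq_empty]
  by_contra hcon
  exact hne (hD.1.eq_of_inter hD'.1 (nonempty_iff_ne_empty.2 hcon))

theorem pairwiseDisjoint_frontier (h : IsConeBoundary C T N) :
    (componentsWithin C T).PairwiseDisjoint frontier := by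
  intro D hD D' hD' hne
  rw [Function.onFun, Set.disjoint_left]
  exact fun x hx hx' => hne (h.eq_of_mem_frontier hD.1 hD'.1 (hD.2 hx) hx hx')

theorem eq_sum_restrict [Nontrivial F] (H : HasNormalGradient C T N μ γ) :
    μ = ∑ D ∈ H.boundary.finite_componentsWithin.toFinset,
      (μ D / volume D) • volume.restrict D := by
  ext A hA
  have hfin := H.boundary.finite_componentsWithin
  have hm : ∀ D ∈ hfin.toFinset, MeasurableSet (A ∩ D) := fun D hD =>
    hA.inter (hfin.mem_toFinset.1 hD).1.isOpen.measurableSet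
  have h1 : μ A = μ (⋃ D ∈ hfin.toFinset, A ∩ D) := by
    rw [← inter_iUnion₂]
    refine (measure_inter_conull ?_).symm
    simpa using H.measure_compl_components
  rw [h1, measure_biUnion_finset (fun D hD D' hD' hne =>
    (pairwiseDisjoint_components (C := C) (T := T) (hfin.mem_toFinset.1 hD)
      (hfin.mem_toFinset.1 hD') hne).mono
      inter_subset_right inter_subset_right) hm, Measure.finsetSum_apply]
  refine Finset.sum_congr rfl fun D hD => ?_
  rw [H.measure_eq_density_mul (hfin.mem_toFinset.1 hD).1 (hm D hD) inter_subset_right,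
    Measure.smul_apply, Measure.restrict_apply hA, smul_eq_mul]

theorem boundary_eq_sum_restrict [Nontrivial F] (H : HasNormalGradient C T N μ γ) :
    γ = ∑ D ∈ H.boundary.finite_componentsWithin.toFinset,
      (μ D / volume D) • μHE[Module.finrank ℝ F - 1].restrict (frontier D) := by
  ext A hA
  have hfin := H.boundary.finite_componentsWithin
  have hm : ∀ D ∈ hfin.toFinset, MeasurableSet (A ∩ frontier D) := fun D hD =>
    hA.inter isClosed_frontier.measurableSet
  have h1 : γ A = γ (⋃ D ∈ hfin.toFinset, A ∩ frontier D) := by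
    rw [← inter_iUnion₂]
    refine (measure_inter_conull ?_).symm
    simpa using H.boundary_measure_compl
  rw [h1, measure_biUnion_finset (fun D hD D' hD' hne =>
    (pairwiseDisjoint_frontier H.boundary (hfin.mem_toFinset.1 hD) (hfin.mem_toFinset.1 hD')
      hne).mono inter_subset_right inter_subset_right) hm, Measure.finsetSum_apply]
  refine Finset.sum_congr rfl fun D hD => ?_
  rw [H.boundary_measure_component (hfin.mem_toFinset.1 hD) (hm D hD) inter_subset_right,
    Measure.smul_apply, Measure.restrict_apply hA, smul_eq_mul]

end HasNormalGradient

end Decomposition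

end OrthVarifold

/-! ### From Fourier transforms to the integrated gradient identity -/

namespace OrthVarifold

open scoped ENNReal NNReal

section Fourier

set_option linter.unusedSectionVars false

variable {F : Type*} [NormedAddCommGroup F] [InnerProductSpace ℝ F] [FiniteDimensional ℝ F]
  [MeasurableSpace F] [BorelSpace F]

theorem integrable_cexp_inner (ν : Measure F) [IsFiniteMeasure ν] (ξ : F) :
    Integrable (fun x => Complex.exp (⟪x, ξ⟫ * Complex.I)) ν := by
  refine Integrable.of_bound (by fun_prop) 1 (Filter.Eventually.of_forall fun x => ?_)
  rw [Complex.norm_exp_ofReal_mul_I]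

theorem isFiniteMeasure_drift {γ : Measure F} [IsFiniteMeasure γ] {N : F → F} (hN : Measurable N)
    (hN1 : ∀ᵐ x ∂γ, ‖N x‖ ≤ 1) (h : F) : IsFiniteMeasure (drift γ N h) := by
  refine ⟨?_⟩
  rw [drift_apply hN h MeasurableSet.univ]
  refine lt_of_le_of_lt (b := ∫⁻ _, ENNReal.ofReal ‖h‖ ∂γ) (lintegral_mono_ae ?_) ?_
  · filter_upwards [hN1] with x hx
    have h1 : volume ({t : ℝ | x + t • h ∈ univ} ∩ Icc 0 1) ≤ 1 := by simp
    calc _ ≤ ENNReal.ofReal ⟪N x, h⟫ * 1 := by gcongr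
      _ ≤ ENNReal.ofReal ‖h‖ := by
        rw [mul_one]
        refine ENNReal.ofReal_le_ofReal ((real_inner_le_norm _ _).trans ?_)
        nlinarith [norm_nonneg h]
  · rw [lintegral_const]
    exact ENNReal.mul_lt_top ENNReal.ofReal_lt_top (measure_lt_top _ _)

theorem charFun_drift {γ : Measure F} [IsFiniteMeasure γ] {N : F → F} (hN : Measurable N)
    (hN1 : ∀ᵐ x ∂γ, ‖N x‖ ≤ 1) (h ξ : F) :
    charFun (drift γ N h) ξ = (∫ t in (0 : ℝ)..1, Complex.exp (⟪h, ξ⟫ * Complex.I * t)) *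
      ∫ x, (max ⟪N x, h⟫ 0 : ℝ) * Complex.exp (⟪x, ξ⟫ * Complex.I) ∂γ := by
  have hfin := isFiniteMeasure_drift hN hN1 h
  have hm : Measurable fun p : ℝ × F => p.2 + p.1 • h := by fun_prop
  have hd : Measurable fun x => ENNReal.ofReal ⟪N x, h⟫ := by fun_prop
  have hint := integrable_cexp_inner (drift γ N h) ξ
  rw [charFun_apply]
  rw [drift] at hint ⊢
  rw [integrable_map_measure (by fun_prop) hm.aemeasurable, Function.comp_def] at hint
  rw [integral_map hm.aemeasurable (by fun_prop), integral_prod_symm _ hint,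
    integral_withDensity_eq_integral_toReal_smul hd (by simp), ← integral_const_mul]
  refine integral_congr_ae (Filter.Eventually.of_forall fun x => ?_)
  simp only
  rw [intervalIntegral.integral_of_le zero_le_one, ← integral_Icc_eq_integral_Ioc,
    ENNReal.toReal_ofReal', Complex.real_smul, mul_left_comm, ← integral_mul_const]
  congr 2
  funext t
  rw [← Complex.exp_add, inner_add_left, inner_smul_left]
  push_cast
  congr 1
  simp
  ring

theorem integral_cexp_mul (a : ℝ) :
    (∫ t in (0 : ℝ)..1, Complex.exp (a * Complex.I * t)) * (a * Complex.I) =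
      Complex.exp (a * Complex.I) - 1 := by
  by_cases ha : (a * Complex.I : ℂ) = 0
  · simp [ha]
  · rw [integral_exp_mul_complex ha, div_mul_cancel₀ _ ha]
    simp

/-- If the gradient of `μ` in the sense of distributions is `N γ`, tested on characters, then the
increments of `μ` under translations are obtained by integrating `N γ`. -/
theorem map_add_drift_of_charFun {μ γ : Measure F} [IsFiniteMeasure μ] [IsFiniteMeasure γ]
    {N : F → F} (hN : Measurable N) (hN1 : ∀ᵐ x ∂γ, ‖N x‖ ≤ 1)
    (hgrad : ∀ ξ h : F, ⟪h, ξ⟫ * Complex.I * charFun μ ξ =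
      -∫ x, (⟪N x, h⟫ : ℝ) * Complex.exp (⟪x, ξ⟫ * Complex.I) ∂γ) (h : F) :
    μ.map (· + h) + drift γ N h = μ + drift γ (-N) h := by
  have hN1' : ∀ᵐ x ∂γ, ‖(-N) x‖ ≤ 1 := by
    filter_upwards [hN1] with x hx
    simpa using hx
  have hf1 := isFiniteMeasure_drift hN hN1 h
  have hf2 := isFiniteMeasure_drift hN.neg hN1' h
  have hintN : ∀ {M : F → F}, Measurable M → (∀ᵐ x ∂γ, ‖M x‖ ≤ 1) → ∀ ξ,
      Integrable (fun x => ((max ⟪M x, h⟫ 0 : ℝ) : ℂ) * Complex.exp (⟪x, ξ⟫ * Complex.I)) γ := by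
    intro M hM hM1 ξ
    refine Integrable.of_bound (by fun_prop) ‖h‖ ?_
    filter_upwards [hM1] with x hx
    rw [norm_mul, Complex.norm_exp_ofReal_mul_I, mul_one, Complex.norm_real, Real.norm_eq_abs]
    refine abs_max_le_max_abs_abs.trans (max_le ?_ (by simp))
    refine (abs_real_inner_le_norm _ _).trans ?_
    nlinarith [norm_nonneg h]
  have hmap : IsFiniteMeasure (μ.map (· + h)) := by infer_instance
  refine Measure.ext_of_charFun ?_
  funext ξ
  have h1 : charFun (μ.map (· + h)) ξ = Complex.exp (⟪h, ξ⟫ * Complex.I) * charFun μ ξ := by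
    rw [charFun_map_add_const, mul_comm]
  have hadd : ∀ ν₁ ν₂ : Measure F, IsFiniteMeasure ν₁ → IsFiniteMeasure ν₂ →
      charFun (ν₁ + ν₂) ξ = charFun ν₁ ξ + charFun ν₂ ξ := fun ν₁ ν₂ _ _ => by
    simp only [charFun_apply]
    exact integral_add_measure (integrable_cexp_inner _ ξ) (integrable_cexp_inner _ ξ)
  rw [hadd _ _ hmap hf1, hadd _ _ inferInstance hf2, h1, charFun_drift hN hN1,
    charFun_drift hN.neg hN1']
  have h2 : (∫ x, (max ⟪N x, h⟫ 0 : ℝ) * Complex.exp (⟪x, ξ⟫ * Complex.I) ∂γ) -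
      ∫ x, (max ⟪(-N) x, h⟫ 0 : ℝ) * Complex.exp (⟪x, ξ⟫ * Complex.I) ∂γ =
      -(⟪h, ξ⟫ * Complex.I * charFun μ ξ) := by
    rw [hgrad, neg_neg, ← integral_sub (hintN hN hN1 ξ) (hintN hN.neg hN1' ξ)]
    refine integral_congr_ae (Filter.Eventually.of_forall fun x => ?_)
    simp only [Pi.neg_apply, inner_neg_left]
    rw [← sub_mul, ← Complex.ofReal_sub]
    congr 2
    rcases le_total 0 ⟪N x, h⟫ with h0 | h0
    · rw [max_eq_left h0, max_eq_right (by linarith), sub_zero]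
    · rw [max_eq_right h0, max_eq_left (by linarith)]; ring
  linear_combination (∫ t in (0 : ℝ)..1, Complex.exp (⟪h, ξ⟫ * Complex.I * t)) * h2 -
    charFun μ ξ * integral_cexp_mul ⟪h, ξ⟫

end Fourier

end OrthVarifold

/-! ### The boundary of a domain of class `C²` -/

namespace OrthVarifold

open scoped ENNReal NNReal

section Domain

variable {n m : ℕ} {Ω : Set (E n)}

theorem IsBoundedC2Domain.innerNormal_spec (hΩ : IsBoundedC2Domain Ω) {x : E n}
    (hx : x ∈ frontier Ω) : ∃ ρ : E n → ℝ, IsDefiningFunctionAt Ω x ρ ∧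
      innerNormal Ω x = ‖gradient ρ x‖⁻¹ • gradient ρ x := by
  obtain ⟨ρ, hρ⟩ := hΩ.regular x hx
  have hex : ∃ v, IsInnerNormalAt Ω x v := ⟨_, ρ, hρ, rfl⟩
  rw [innerNormal, dif_pos hex]
  exact hex.choose_spec

theorem IsBoundedC2Domain.norm_innerNormal (hΩ : IsBoundedC2Domain Ω) {x : E n}
    (hx : x ∈ frontier Ω) : ‖innerNormal Ω x‖ = 1 := by
  obtain ⟨ρ, hρ, h⟩ := hΩ.innerNormal_spec hx
  rw [h, norm_smul, norm_inv, norm_norm, inv_mul_cancel₀ (norm_ne_zero_iff.2 hρ.2.1)]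

theorem IsBoundedC2Domain.notMem_of_mem_frontier (hΩ : IsBoundedC2Domain Ω) {x : E n}
    (hx : x ∈ frontier Ω) : x ∉ Ω := fun h => hx.2 (hΩ.isOpen.interior_eq.symm ▸ h)

theorem IsBoundedC2Domain.mem_frontier_iff (hΩ : IsBoundedC2Domain Ω) {x : E n} :
    x ∈ frontier Ω ↔ x ∈ closure Ω ∧ x ∉ Ω := by
  rw [frontier, hΩ.isOpen.interior_eq]; rfl

/-- Strict differentiability of a defining function gives cone conditions at each boundary point,
with axis the interior normal and arbitrarily wide aperture. -/
theorem IsBoundedC2Domain.exists_cone (hΩ : IsBoundedC2Domain Ω) {x₀ : E n}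
    (hx₀ : x₀ ∈ frontier Ω) {ε : ℝ} (hε : 0 < ε) : ∃ r > 0,
      ∀ x ∈ closure Ω ∩ Metric.ball x₀ r, ∀ y ∈ Metric.ball x₀ r,
        ε * ‖y - x‖ < ⟪innerNormal Ω x₀, y - x⟫ → y ∈ Ω := by
  obtain ⟨ρ, ⟨hsmooth, hgrad, hdef⟩, hN⟩ := hΩ.innerNormal_spec hx₀
  set c := ‖gradient ρ x₀‖ with hc
  have hc0 : 0 < c := norm_pos_iff.2 hgrad
  have hstrict := hsmooth.hasStrictFDerivAt two_ne_zero
  have hev := (Asymptotics.isLittleO_iff.1 hstrict.isLittleO) (mul_pos hε hc0)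
  rw [nhds_prod_eq] at hev
  obtain ⟨U, hU, hUsub⟩ := (Filter.eventually_prod_self_iff (r := fun y x =>
    ‖ρ y - ρ x - fderiv ℝ ρ x₀ (y - x)‖ ≤ ε * c * ‖y - x‖)).1 hev
  obtain ⟨r, hr, hball⟩ := Metric.mem_nhds_iff.1 (Filter.inter_mem hU hdef)
  have hinner : ∀ w, fderiv ℝ ρ x₀ w = c * ⟪innerNormal Ω x₀, w⟫ := fun w => by
    have hd : fderiv ℝ ρ x₀ w = ⟪gradient ρ x₀, w⟫ := by
      rw [gradient, InnerProductSpace.toDual_symm_apply]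
    rw [hN, inner_smul_left, hd, conj_trivial, mul_inv_cancel_left₀ hc0.ne']
  refine ⟨r, hr, ?_⟩
  rintro x ⟨hxcl, hx⟩ y hy hxy
  have hopen : IsOpen {x' | ε * ‖y - x'‖ < ⟪innerNormal Ω x₀, y - x'⟫} :=
    isOpen_lt (by fun_prop) (by fun_prop)
  obtain ⟨x', ⟨hx'1, hx'2⟩, hx'Ω⟩ :=
    mem_closure_iff.1 hxcl _ (hopen.inter Metric.isOpen_ball) ⟨hxy, hx⟩
  have hρx' : 0 < ρ x' := ((hball hx'2).2 : x' ∈ Ω ↔ 0 < ρ x').1 hx'Ω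
  refine ((hball hy).2 : y ∈ Ω ↔ 0 < ρ y).2 ?_
  have h1 := hUsub y (hball hy).1 x' (hball hx'2).1
  simp only [hinner] at h1
  have h2 := (abs_le.1 h1).1
  have h3 : ε * c * ‖y - x'‖ < c * ⟪innerNormal Ω x₀, y - x'⟫ := by
    have := mul_lt_mul_of_pos_left (show ε * ‖y - x'‖ < ⟪innerNormal Ω x₀, y - x'⟫ from hx'1) hc0
    linarith
  linarith

/-- A direction that enters `closure Ω` at a boundary point has nonnegative normal component. -/
theorem IsBoundedC2Domain.inner_innerNormal_nonneg (hΩ : IsBoundedC2Domain Ω) {x w : E n}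
    (hx : x ∈ frontier Ω) (hw : ∃ᶠ t in 𝓝[>] (0 : ℝ), x + t • w ∈ closure Ω) :
    0 ≤ ⟪innerNormal Ω x, w⟫ := by
  by_contra! hneg
  have hw0 : 0 < ‖w‖ := by
    rw [norm_pos_iff]
    rintro rfl
    simp at hneg
  obtain ⟨r, hr, hcone⟩ := hΩ.exists_cone hx (ε := -⟪innerNormal Ω x, w⟫ / (2 * ‖w‖))
    (div_pos (by linarith) (by positivity))
  have hlim : Filter.Tendsto (fun t : ℝ => x + t • w) (𝓝[>] 0) (𝓝 x) :=
    tendsto_add_smul_nhdsGT _ _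
  obtain ⟨t, htcl, htball, ht0⟩ := (hw.and_eventually
    ((hlim.eventually (Metric.ball_mem_nhds x hr)).and self_mem_nhdsWithin)).exists
  have ht0' : 0 < t := ht0
  refine hΩ.notMem_of_mem_frontier hx (hcone _ ⟨htcl, htball⟩ x (Metric.mem_ball_self hr) ?_)
  rw [sub_add_cancel_left, norm_neg, norm_smul, Real.norm_of_nonneg ht0'.le, inner_neg_right,
    inner_smul_right]
  have : -⟪innerNormal Ω x, w⟫ / (2 * ‖w‖) * (t * ‖w‖) = t * (-⟪innerNormal Ω x, w⟫) / 2 := by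
    field_simp
  rw [this]
  nlinarith

/-- The interior normal is continuous along the boundary: by the cone condition at `x₀`, the normal
at a nearby point belongs to the dual of a cone that is nearly a half space. -/
theorem IsBoundedC2Domain.continuousOn_innerNormal (hΩ : IsBoundedC2Domain Ω) :
    ContinuousOn (innerNormal Ω) (frontier Ω) := by
  intro x₀ hx₀
  rw [ContinuousWithinAt, Metric.tendsto_nhds]
  intro η hη
  obtain ⟨ε, hε0, hε1, hεη⟩ : ∃ ε : ℝ, 0 < ε ∧ ε < 1 / 2 ∧ 2 * ε < η :=
    ⟨min (1 / 4) (η / 4), by positivity,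
      (min_le_left _ _).trans_lt (by norm_num), by
        have := min_le_right (1 / 4) (η / 4); linarith⟩
  obtain ⟨r, hr, hcone⟩ := hΩ.exists_cone hx₀ hε0
  filter_upwards [inter_mem_nhdsWithin _ (Metric.ball_mem_nhds x₀ hr)] with x hx
  set v := innerNormal Ω x₀ with hvdef
  set N := innerNormal Ω x with hNdef
  have hv : ‖v‖ = 1 := hΩ.norm_innerNormal hx₀
  have hN : ‖N‖ = 1 := hΩ.norm_innerNormal hx.1
  have hdual : ∀ w, ε * ‖w‖ < ⟪v, w⟫ → 0 ≤ ⟪N, w⟫ := by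
    intro w hw
    refine hΩ.inner_innerNormal_nonneg hx.1 (Filter.Eventually.frequently ?_)
    have hlim : Filter.Tendsto (fun t : ℝ => x + t • w) (𝓝[>] 0) (𝓝 x) :=
      tendsto_add_smul_nhdsGT _ _
    filter_upwards [hlim (Metric.isOpen_ball.mem_nhds hx.2), self_mem_nhdsWithin] with t ht ht0
    have ht0' : 0 < t := ht0
    refine subset_closure (hcone x ⟨hx.1.1, hx.2⟩ _ ht ?_)
    rw [add_sub_cancel_left, norm_smul, Real.norm_of_nonneg ht0'.le, inner_smul_right]
    nlinarith
  set a := ⟪N, v⟫ with ha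
  have hva : ⟪v, N⟫ = a := real_inner_comm _ _
  -- If `a` were smaller, then `v - l N` with `l = 1 - 2 ε²` would belong to the cone about `v` and
  -- have negative inner product with `N`.
  have hal : 1 - 2 * ε ^ 2 ≤ a := by
    by_contra! hlt
    set l := 1 - 2 * ε ^ 2 with hl
    have hε2 : 0 < ε ^ 2 := by positivity
    have hl0 : 0 < l := by nlinarith
    have hNw : ⟪N, v - l • N⟫ = a - l := by
      rw [inner_sub_right, inner_smul_right, real_inner_self_eq_norm_sq, hN]; ring
    have hvw : ⟪v, v - l • N⟫ = 1 - l * a := by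
      rw [inner_sub_right, inner_smul_right, real_inner_self_eq_norm_sq, hv, hva]; ring
    have hww : ‖v - l • N‖ ^ 2 = 1 - 2 * (l * a) + l ^ 2 := by
      rw [norm_sub_sq_real, inner_smul_right, norm_smul, hv, hN, hva, Real.norm_of_nonneg hl0.le]
      ring
    have hX : 2 * ε ^ 2 < 1 - l * a := by nlinarith
    have hlt' : ε * ‖v - l • N‖ < 1 - l * a := by
      refine lt_of_pow_lt_pow_left₀ 2 (by nlinarith) ?_
      rw [mul_pow, hww]
      have hY : 1 - 2 * (l * a) + l ^ 2 ≤ 2 * (1 - l * a) := by nlinarith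
      have h1 := mul_le_mul_of_nonneg_left hY hε2.le
      have h2 := mul_lt_mul_of_pos_right hX (show 0 < 1 - l * a by linarith)
      nlinarith
    have := hdual _ (by rw [hvw]; exact hlt')
    rw [hNw] at this
    linarith
  rw [dist_eq_norm]
  have hsq : ‖N - v‖ ^ 2 ≤ (2 * ε) ^ 2 := by
    rw [norm_sub_sq_real, hN, hv, ← ha]
    nlinarith
  have := abs_le_of_sq_le_sq hsq (by positivity)
  rw [abs_of_nonneg (norm_nonneg _)] at this
  linarith

/-- The interior normal, extended by zero off the boundary; unlike `innerNormal` it is a Borel map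
on the whole space. -/
noncomputable def normalField (Ω : Set (E n)) : E n → E n :=
  (frontier Ω).indicator (innerNormal Ω)

theorem normalField_of_mem {x : E n} (hx : x ∈ frontier Ω) :
    normalField Ω x = innerNormal Ω x := indicator_of_mem hx _

theorem IsBoundedC2Domain.measurable_normalField (hΩ : IsBoundedC2Domain Ω) :
    Measurable (normalField Ω) := by
  classical
  rw [normalField, ← piecewise_eq_indicator]
  exact hΩ.continuousOn_innerNormal.measurable_piecewise continuousOn_const
    isClosed_frontier.measurableSet

theorem IsBoundedC2Domain.norm_normalField_le (hΩ : IsBoundedC2Domain Ω) (x : E n) :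
    ‖normalField Ω x‖ ≤ 1 := by
  by_cases hx : x ∈ frontier Ω
  · rw [normalField_of_mem hx, hΩ.norm_innerNormal hx]
  · simp [normalField, hx]

theorem IsBoundedC2Domain.isCompact_closure (hΩ : IsBoundedC2Domain Ω) : IsCompact (closure Ω) :=
  hΩ.isBounded.isCompact_closure

end Domain

end OrthVarifold

/-! ### Plane sections of the domain -/

namespace OrthVarifold

open scoped ENNReal NNReal

section PlaneSection

variable {n m : ℕ} {Ω : Set (E n)} {P : Op n} {z : E n} {j : E m →ₗᵢ[ℝ] E n}

/-- The isometric parametrization `w ↦ z + j w` of the affine plane through `z` with direction the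
range of `j`. -/
noncomputable def planeMap (j : E m →ₗᵢ[ℝ] E n) (z : E n) (w : E m) : E n := z + j w

/-- The section of `closure Ω` by an affine plane, in the coordinates of the plane. -/
noncomputable def planeBody (Ω : Set (E n)) (j : E m →ₗᵢ[ℝ] E n) (z : E n) : Set (E m) :=
  planeMap j z ⁻¹' closure Ω

/-- The points of the plane on `∂Ω` at which the normal of `Ω` is tangent to the plane. -/
noncomputable def orthPoints (Ω : Set (E n)) (P : Op n) (j : E m →ₗᵢ[ℝ] E n) (z : E n) :
    Set (E m) :=
  {w | planeMap j z w ∈ frontier Ω ∧ innerNormal Ω (planeMap j z w) ∈ P.range}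

/-- The component of the normal of `Ω` in the direction of the plane, in the coordinates of the
plane. -/
noncomputable def planeNormal (Ω : Set (E n)) (j : E m →ₗᵢ[ℝ] E n) (z : E n) (w : E m) : E m :=
  j.toContinuousLinearMap.adjoint (normalField Ω (planeMap j z w))

theorem isometry_planeMap (j : E m →ₗᵢ[ℝ] E n) (z : E n) : Isometry (planeMap j z) :=
  Isometry.of_dist_eq fun x y => by
    rw [planeMap, planeMap, dist_add_left, j.isometry.dist_eq]

theorem exists_linearIsometry_range (hP : P ∈ Gr n m) :
    ∃ j : E m →ₗᵢ[ℝ] E n, range j = (P.range : Set (E n)) := by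
  let b : OrthonormalBasis (Fin m) ℝ P.range :=
    (stdOrthonormalBasis ℝ P.range).reindex (finCongr hP.2)
  refine ⟨P.range.subtypeₗᵢ.comp b.repr.symm.toLinearIsometry, ?_⟩
  ext x
  constructor
  · rintro ⟨w, rfl⟩
    exact (b.repr.symm w).2
  · intro hx
    exact ⟨b.repr ⟨x, hx⟩, by simp⟩

theorem range_planeMap (hj : range j = (P.range : Set (E n))) :
    range (planeMap j z) = affPlane P z := by
  ext x
  have : x ∈ affPlane P z ↔ x - z ∈ range j := by rw [hj]; rfl
  rw [this]
  constructor
  · rintro ⟨w, rfl⟩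
    exact ⟨w, by simp [planeMap]⟩
  · rintro ⟨w, hw⟩
    exact ⟨w, by rw [planeMap, hw]; abel⟩

theorem apply_planeNormal (hj : range j = (P.range : Set (E n))) {w : E m}
    (hw : w ∈ orthPoints Ω P j z) : j (planeNormal Ω j z w) = innerNormal Ω (planeMap j z w) := by
  have h : innerNormal Ω (planeMap j z w) ∈ range j := by rw [hj]; exact hw.2
  obtain ⟨u, hu⟩ := h
  rw [planeNormal, normalField_of_mem hw.1, ← hu]
  congr 1
  refine ext_inner_right ℝ fun y => ?_
  rw [ContinuousLinearMap.adjoint_inner_left]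
  exact j.inner_map_map u y

theorem inner_planeNormal (w h : E m) :
    ⟪planeNormal Ω j z w, h⟫ = ⟪normalField Ω (planeMap j z w), j h⟫ :=
  ContinuousLinearMap.adjoint_inner_left _ _ _

/-- The part of the boundary of a plane section at which the normal is tangent to the plane
satisfies the cone conditions, with the same normal. -/
theorem isConeBoundary_planeBody (hΩ : IsBoundedC2Domain Ω)
    (hj : range j = (P.range : Set (E n))) :
    IsConeBoundary (planeBody Ω j z) (orthPoints Ω P j z) (planeNormal Ω j z) where
  isCompact := (isometry_planeMap j z).isClosedEmbedding.isCompact_preimage hΩ.isCompact_closure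
  isClosed := by
    have h : IsClosed (frontier Ω ∩ innerNormal Ω ⁻¹' (P.range : Set (E n))) :=
      hΩ.continuousOn_innerNormal.preimage_isClosed_of_isClosed isClosed_frontier
        (Submodule.closed_of_finiteDimensional _)
    exact h.preimage (isometry_planeMap j z).continuous
  subset_frontier := by
    intro w hw
    refine ⟨subset_closure hw.1.1, fun hint => ?_⟩
    have hlim : Filter.Tendsto (fun t : ℝ => w + t • -planeNormal Ω j z w) (𝓝[>] 0) (𝓝 w) :=
      tendsto_add_smul_nhdsGT _ _
    have h := hΩ.inner_innerNormal_nonneg hw.1 (w := -innerNormal Ω (planeMap j z w))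
      (Filter.Eventually.frequently ?_)
    · rw [inner_neg_right, real_inner_self_eq_norm_sq, hΩ.norm_innerNormal hw.1] at h
      norm_num at h
    · filter_upwards [hlim (isOpen_interior.mem_nhds hint)] with t ht
      have h1 : planeMap j z (w + t • -planeNormal Ω j z w) ∈ closure Ω :=
        interior_subset (s := planeBody Ω j z) ht
      rw [planeMap, map_add, map_smul, map_neg, apply_planeNormal hj hw, ← add_assoc] at h1
      exact h1
  norm_eq_one := by
    intro w hw
    rw [← j.norm_map, apply_planeNormal hj hw, hΩ.norm_innerNormal hw.1]
  continuousOn := by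
    refine (ContinuousLinearMap.continuous _).comp_continuousOn ?_
    have h : ContinuousOn (fun w => innerNormal Ω (planeMap j z w)) (orthPoints Ω P j z) :=
      hΩ.continuousOn_innerNormal.comp (isometry_planeMap j z).continuous.continuousOn
        fun w hw => hw.1
    exact h.congr fun w hw => normalField_of_mem hw.1
  cone := by
    intro w₀ hw₀ ε hε
    obtain ⟨r, hr, hcone⟩ := hΩ.exists_cone hw₀.1 hε
    refine ⟨r, hr, ?_⟩
    rintro x ⟨hxC, hx⟩ y hy hxy
    have hball : ∀ w ∈ Metric.ball w₀ r, planeMap j z w ∈ Metric.ball (planeMap j z w₀) r :=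
      fun w hw => by rwa [Metric.mem_ball, (isometry_planeMap j z).dist_eq]
    have hdiff : planeMap j z y - planeMap j z x = j (y - x) := by
      simp [planeMap]
    have hyΩ : planeMap j z y ∈ Ω := by
      refine hcone _ ⟨hxC, hball x hx⟩ _ (hball y hy) ?_
      rwa [hdiff, j.norm_map, ← apply_planeNormal hj hw₀, j.inner_map_map]
    exact mem_interior.2 ⟨planeMap j z ⁻¹' Ω, fun w hw => subset_closure hw,
      hΩ.isOpen.preimage (isometry_planeMap j z).continuous, hyΩ⟩

theorem planeInterior_eq_image (hj : range j = (P.range : Set (E n))) :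
    planeInterior Ω P z = planeMap j z '' interior (planeBody Ω j z) := by
  ext x
  have hind := (isometry_planeMap j z).isClosedEmbedding.isInducing
  constructor
  · rintro ⟨hx, hxn⟩
    rw [← range_planeMap (z := z) hj] at hx hxn
    obtain ⟨w, rfl⟩ := hx
    refine ⟨w, mem_interior_iff_mem_nhds.2 ?_, rfl⟩
    rw [← hind.map_nhds_eq] at hxn
    exact hxn
  · rintro ⟨w, hw, rfl⟩
    refine ⟨range_planeMap (z := z) hj ▸ mem_range_self w, ?_⟩
    rw [← range_planeMap (z := z) hj, ← hind.map_nhds_eq]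
    exact mem_interior_iff_mem_nhds.1 hw

/-- Unlike `Homeomorph.image_connectedComponentIn`, this allows a map that is not onto. -/
theorem image_connectedComponentIn_of_isInducing {X Y : Type*} [TopologicalSpace X]
    [TopologicalSpace Y] {f : X → Y} (hf : IsInducing f) {U : Set X} {x : X} (hx : x ∈ U) :
    f '' connectedComponentIn U x = connectedComponentIn (f '' U) (f x) := by
  refine Subset.antisymm ?_ ?_
  · exact IsPreconnected.subset_connectedComponentIn
      (isPreconnected_connectedComponentIn.image f hf.continuous.continuousOn)
      (mem_image_of_mem f (mem_connectedComponentIn hx))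
      (image_mono (connectedComponentIn_subset U x))
  · set K := connectedComponentIn (f '' U) (f x) with hK
    have hKU : K ⊆ f '' U := connectedComponentIn_subset _ _
    have himg : f '' (U ∩ f ⁻¹' K) = K := by
      rw [image_inter_preimage, inter_eq_right]
      exact hKU
    have hpre : IsPreconnected (U ∩ f ⁻¹' K) := by
      rw [← hf.isPreconnected_image, himg]
      exact isPreconnected_connectedComponentIn
    rw [← himg]
    exact image_mono (hpre.subset_connectedComponentIn
      ⟨hx, mem_connectedComponentIn (mem_image_of_mem f hx)⟩ inter_subset_left)

theorem isSlice_iff (hj : range j = (P.range : Set (E n))) {Δ : Set (E n)} :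
    IsSlice Ω P z Δ ↔ ∃ D, IsComponent (planeBody Ω j z) D ∧ Δ = planeMap j z '' D := by
  have hind := (isometry_planeMap j z).isClosedEmbedding.isInducing
  rw [IsSlice, planeInterior_eq_image hj]
  constructor
  · rintro ⟨_, ⟨w, hw, rfl⟩, rfl⟩
    exact ⟨_, isComponent_of_mem hw, (image_connectedComponentIn_of_isInducing hind hw).symm⟩
  · rintro ⟨D, ⟨w, hw, rfl⟩, rfl⟩
    exact ⟨_, mem_image_of_mem _ hw, image_connectedComponentIn_of_isInducing hind hw⟩

theorem sliceBoundary_image {D : Set (E m)} (hD : IsOpen D) :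
    sliceBoundary (planeMap j z '' D) = planeMap j z '' frontier D := by
  rw [sliceBoundary, (isometry_planeMap j z).isClosedEmbedding.closure_image_eq, frontier,
    hD.interior_eq, image_sdiff (isometry_planeMap j z).injective]

theorem planeMap_mem_frontier (hΩ : IsBoundedC2Domain Ω) {w : E m}
    (hw : w ∈ frontier (planeBody Ω j z)) : planeMap j z w ∈ frontier Ω := by
  have hclosed : IsClosed (planeBody Ω j z) :=
    isClosed_closure.preimage (isometry_planeMap j z).continuous
  refine hΩ.mem_frontier_iff.2 ⟨hclosed.closure_subset hw.1, fun hwΩ => hw.2 ?_⟩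
  exact mem_interior.2 ⟨planeMap j z ⁻¹' Ω, fun w hw => subset_closure hw,
      hΩ.isOpen.preimage (isometry_planeMap j z).continuous, hwΩ⟩

theorem orthSlices_eq_image (hΩ : IsBoundedC2Domain Ω) (hj : range j = (P.range : Set (E n))) :
    orthSlices Ω P z =
      image (planeMap j z) '' componentsWithin (planeBody Ω j z) (orthPoints Ω P j z) := by
  ext Δ
  constructor
  · rintro ⟨hΔ, horth⟩
    obtain ⟨D, hD, rfl⟩ := (isSlice_iff hj).1 hΔ
    refine ⟨D, ⟨hD, fun w hw => ⟨?_, ?_⟩⟩, rfl⟩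
    · exact planeMap_mem_frontier hΩ (hD.frontier_subset_frontier hw)
    · exact horth _ (sliceBoundary_image hD.isOpen ▸ mem_image_of_mem _ hw)
  · rintro ⟨D, ⟨hD, hDT⟩, rfl⟩
    refine ⟨(isSlice_iff hj).2 ⟨D, hD, rfl⟩, fun x hx => ?_⟩
    rw [sliceBoundary_image hD.isOpen] at hx
    obtain ⟨w, hw, rfl⟩ := hx
    exact (hDT hw).2

theorem finite_orthSlices (hm : 1 ≤ m) (hΩ : IsBoundedC2Domain Ω) (hP : P ∈ Gr n m) (z : E n) :
    (orthSlices Ω P z).Finite := by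
  obtain ⟨j, hj⟩ := exists_linearIsometry_range hP
  have : NeZero m := ⟨by omega⟩
  rw [orthSlices_eq_image hΩ hj]
  exact (isConeBoundary_planeBody hΩ hj).finite_componentsWithin.image _

theorem sliceBoundary_subset_frontier (hΩ : IsBoundedC2Domain Ω) (hP : P ∈ Gr n m)
    {Δ : Set (E n)} (hΔ : IsSlice Ω P z Δ) : sliceBoundary Δ ⊆ frontier Ω := by
  obtain ⟨j, hj⟩ := exists_linearIsometry_range hP
  obtain ⟨D, hD, rfl⟩ := (isSlice_iff hj).1 hΔ
  rw [sliceBoundary_image hD.isOpen]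
  rintro _ ⟨w, hw, rfl⟩
  exact planeMap_mem_frontier hΩ (hD.frontier_subset_frontier hw)

theorem slice_subset_closure {Δ : Set (E n)} (hΔ : IsSlice Ω P z Δ) : Δ ⊆ closure Ω := by
  obtain ⟨x, -, rfl⟩ := hΔ
  exact fun y hy => mem_of_mem_nhdsWithin ((connectedComponentIn_subset _ _ hy).1)
    ((connectedComponentIn_subset _ _ hy).2)

theorem measurableSet_slice (hP : P ∈ Gr n m) {Δ : Set (E n)} (hΔ : IsSlice Ω P z Δ) :
    MeasurableSet Δ := by
  obtain ⟨j, hj⟩ := exists_linearIsometry_range hP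
  obtain ⟨D, hD, rfl⟩ := (isSlice_iff hj).1 hΔ
  exact (isometry_planeMap j z).isClosedEmbedding.measurableEmbedding.measurableSet_image.2
    hD.isOpen.measurableSet

theorem measurableSet_sliceBoundary (hP : P ∈ Gr n m) {Δ : Set (E n)} (hΔ : IsSlice Ω P z Δ) :
    MeasurableSet (sliceBoundary Δ) :=
  isClosed_closure.measurableSet.diff (measurableSet_slice hP hΔ)

theorem euclideanHausdorffMeasure_slice_lt_top (hΩ : IsBoundedC2Domain Ω) (hP : P ∈ Gr n m)
    {Δ : Set (E n)} (hΔ : IsSlice Ω P z Δ) : μHE[m] Δ < ∞ := by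
  obtain ⟨j, hj⟩ := exists_linearIsometry_range hP
  obtain ⟨D, hD, rfl⟩ := (isSlice_iff hj).1 hΔ
  rw [(isometry_planeMap j z).euclideanHausdorffMeasure_image,
    EuclideanSpace.euclideanHausdorffMeasure_eq_volume]
  exact (hD.volume_ne_top (isConeBoundary_planeBody hΩ hj).isCompact).lt_top

theorem euclideanHausdorffMeasure_slice_ne_zero (hP : P ∈ Gr n m) {Δ : Set (E n)}
    (hΔ : IsSlice Ω P z Δ) : μHE[m] Δ ≠ 0 := by
  obtain ⟨j, hj⟩ := exists_linearIsometry_range hP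
  obtain ⟨D, hD, rfl⟩ := (isSlice_iff hj).1 hΔ
  rw [(isometry_planeMap j z).euclideanHausdorffMeasure_image,
    EuclideanSpace.euclideanHausdorffMeasure_eq_volume]
  exact hD.volume_ne_zero

theorem euclideanHausdorffMeasure_sliceBoundary_lt_top (hΩ : IsBoundedC2Domain Ω)
    (hP : P ∈ Gr n m) {Δ : Set (E n)} (hΔ : Δ ∈ orthSlices Ω P z) :
    μHE[m - 1] (sliceBoundary Δ) < ∞ := by
  obtain ⟨j, hj⟩ := exists_linearIsometry_range hP
  rw [orthSlices_eq_image hΩ hj] at hΔ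
  obtain ⟨D, hD, rfl⟩ := hΔ
  rw [sliceBoundary_image hD.1.isOpen, (isometry_planeMap j z).euclideanHausdorffMeasure_image]
  have := (isConeBoundary_planeBody hΩ hj).euclideanHausdorffMeasure_frontier_lt_top hD
  rwa [finrank_euclideanSpace_fin] at this

/-- A slice determines its affine plane: it is relatively open, so it contains small displacements
in every direction of the plane. -/
theorem slice_plane_unique {P' : Op n} {z' : E n} (hP : P ∈ Gr n m) (hP' : P' ∈ Gr n m)
    (hz : P z = 0) (hz' : P' z' = 0) {Δ : Set (E n)} (hΔ : IsSlice Ω P z Δ)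
    (hΔ' : IsSlice Ω P' z' Δ) : P = P' ∧ z = z' := by
  have hsub : ∀ {Q Q' : Op n} {y y' : E n}, Q ∈ Gr n m → IsSlice Ω Q y Δ → IsSlice Ω Q' y' Δ →
      Q.range ≤ Q'.range := by
    intro Q Q' y y' hQ hΔ hΔ' u hu
    obtain ⟨j, hj⟩ := exists_linearIsometry_range hQ
    have hplane : ∀ x ∈ Δ, x - y' ∈ Q'.range := by
      obtain ⟨x₀, -, rfl⟩ := hΔ'
      exact fun x hx => (connectedComponentIn_subset _ _ hx).1
    obtain ⟨D, hD, rfl⟩ := (isSlice_iff hj).1 hΔ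
    obtain ⟨w, hw⟩ := hD.nonempty
    obtain ⟨h, rfl⟩ : u ∈ range j := by rw [hj]; exact hu
    have hlim : Filter.Tendsto (fun t : ℝ => w + t • h) (𝓝[>] 0) (𝓝 w) :=
      tendsto_add_smul_nhdsGT _ _
    obtain ⟨t, ht, ht0⟩ := ((hlim.eventually (hD.isOpen.mem_nhds hw)).and
      self_mem_nhdsWithin).exists
    have ht0' : t ≠ 0 := ne_of_gt ht0
    have h1 := Q'.range.sub_mem (hplane _ (mem_image_of_mem _ ht))
      (hplane _ (mem_image_of_mem _ hw))
    have h2 : planeMap j y (w + t • h) - y' - (planeMap j y w - y') = t • j h := by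
      simp only [planeMap, map_add, map_smul]; abel
    rw [h2] at h1
    exact (Q'.range.smul_mem_iff ht0').1 h1
  have hrange : P.range = P'.range := le_antisymm (hsub hP hΔ hΔ') (hsub hP' hΔ' hΔ)
  obtain ⟨_, hPr⟩ := isStarProjection_iff_eq_starProjection_range.1 hP.1
  obtain ⟨_, hPr'⟩ := isStarProjection_iff_eq_starProjection_range.1 hP'.1
  have hPP : P = P' := by
    rw [hPr, hPr']
    congr 1
  subst hPP
  refine ⟨rfl, ?_⟩
  obtain ⟨x, hx, rfl⟩ := hΔ
  obtain ⟨x', hx', h'⟩ := hΔ'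
  have hxx : x ∈ planeInterior Ω P z' := by
    have := mem_connectedComponentIn hx
    rw [h'] at this
    exact connectedComponentIn_subset _ _ this
  obtain ⟨a, ha⟩ := (P.range.sub_mem hxx.1 hx.1 : x - z' - (x - z) ∈ P.range)
  have ha' : P a = z - z' := ha.trans (by abel)
  have hid : P (P a) = P a := congrArg (fun T : Op n => T a) hP.1.isIdempotentElem
  rw [ha', map_sub, hz, hz', sub_zero] at hid
  exact (sub_eq_zero.1 hid.symm)

theorem map_restrict_planeMap (D : Set (E m)) (hD : MeasurableSet D) (k : ℕ) :
    (μHE[k].restrict D).map (planeMap j z) = μHE[k].restrict (planeMap j z '' D) := by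
  have hi := isometry_planeMap j z
  have he := hi.isClosedEmbedding.measurableEmbedding
  have h1 : D = planeMap j z ⁻¹' (planeMap j z '' D) := (preimage_image_eq D hi.injective).symm
  rw [h1, ← Measure.restrict_map he.measurable (he.measurableSet_image.2 hD),
    hi.map_euclideanHausdorffMeasure, Measure.restrict_restrict (he.measurableSet_image.2 hD),
    ← h1, inter_eq_left.2 (image_subset_range _ _)]

/-- The decomposition of a measure `κ` on a plane section whose gradient along the plane is the
normal field times a measure `γ` living where the normal is tangent to the plane. -/
theorem eq_sum_orthSlices (hm : 1 ≤ m) (hΩ : IsBoundedC2Domain Ω) (hP : P ∈ Gr n m)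
    {κ γ : Measure (E n)} [IsFiniteMeasure κ] [IsFiniteMeasure γ]
    (hκ : ∀ᵐ x ∂κ, x ∈ closure Ω ∧ x ∈ affPlane P z)
    (hγ : ∀ᵐ x ∂γ, x ∈ frontier Ω ∧ x ∈ affPlane P z ∧ normalField Ω x ∈ P.range)
    (hgrad : ∀ ξ h : E n, ⟪P h, ξ⟫ * Complex.I * charFun κ ξ =
      -∫ x, (⟪normalField Ω x, h⟫ : ℝ) * Complex.exp (⟪x, ξ⟫ * Complex.I) ∂γ) :
    κ = ∑ Δ ∈ (finite_orthSlices hm hΩ hP z).toFinset,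
        (κ Δ / μHE[m] Δ) • μHE[m].restrict Δ ∧
    γ = ∑ Δ ∈ (finite_orthSlices hm hΩ hP z).toFinset,
        (κ Δ / μHE[m] Δ) • μHE[m - 1].restrict (sliceBoundary Δ) := by
  obtain ⟨j, hj⟩ := exists_linearIsometry_range hP
  have : NeZero m := ⟨by omega⟩
  set i := planeMap j z with hi'
  have hi := isometry_planeMap j z
  have he : MeasurableEmbedding i := hi.isClosedEmbedding.measurableEmbedding
  have hrange := range_planeMap (z := z) hj
  have hκr : κ.restrict (range i) = κ := by
    rw [Measure.restrict_eq_self_of_ae_mem]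
    filter_upwards [hκ] with x hx
    rw [hrange]; exact hx.2
  have hγr : γ.restrict (range i) = γ := by
    rw [Measure.restrict_eq_self_of_ae_mem]
    filter_upwards [hγ] with x hx
    rw [hrange]; exact hx.2.1
  set κ' := κ.comap i with hκ'
  set γ' := γ.comap i with hγ'
  have hκm : κ'.map i = κ := by rw [hκ', he.map_comap, hκr]
  have hγm : γ'.map i = γ := by rw [hγ', he.map_comap, hγr]
  have hfκ : IsFiniteMeasure κ' := ⟨by
    rw [hκ', he.comap_apply]; exact measure_lt_top _ _⟩
  have hfγ : IsFiniteMeasure γ' := ⟨by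
    rw [hγ', he.comap_apply]; exact measure_lt_top _ _⟩
  have hcone := isConeBoundary_planeBody (z := z) hΩ hj
  have hmeas : Measurable (planeNormal Ω j z) :=
    (ContinuousLinearMap.continuous _).measurable.comp
      (hΩ.measurable_normalField.comp hi.continuous.measurable)
  have hnorm : ∀ w, ‖planeNormal Ω j z w‖ ≤ 1 := fun w => by
    refine (ContinuousLinearMap.le_opNorm _ _).trans ?_
    rw [LinearIsometryEquiv.norm_map]
    have h1 : ‖j.toContinuousLinearMap‖ ≤ 1 := j.norm_toContinuousLinearMap_le
    have h2 := hΩ.norm_normalField_le (planeMap j z w)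
    nlinarith [norm_nonneg j.toContinuousLinearMap, norm_nonneg (normalField Ω (planeMap j z w))]
  have hexp : ∀ (w ξ : E m), Complex.exp (⟪i w, j ξ⟫ * Complex.I) =
      Complex.exp (⟪z, j ξ⟫ * Complex.I) * Complex.exp (⟪w, ξ⟫ * Complex.I) := fun w ξ => by
    rw [← Complex.exp_add, hi', planeMap, inner_add_left, j.inner_map_map]
    push_cast
    ring_nf
  have H : HasNormalGradient (planeBody Ω j z) (orthPoints Ω P j z) (planeNormal Ω j z) κ' γ' := by
    refine ⟨hcone, hmeas, ?_, ?_, ?_⟩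
    · rw [hκ', he.comap_apply]
      refine measure_mono_null ?_ (ae_iff.1 hκ)
      rintro _ ⟨w, hw, rfl⟩ hx
      exact hw hx.1
    · rw [hγ', he.comap_apply]
      refine measure_mono_null ?_ (ae_iff.1 hγ)
      rintro _ ⟨w, hw, rfl⟩ hx
      exact hw ⟨hx.1, by rw [← normalField_of_mem hx.1]; exact hx.2.2⟩
    · refine map_add_drift_of_charFun hmeas (Filter.Eventually.of_forall hnorm) fun ξ h => ?_
      have hjh : P (j h) = j h := by
        obtain ⟨a, ha⟩ : j h ∈ P.range := by
          have : j h ∈ range j := mem_range_self h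
          rw [hj] at this
          exact this
        rw [← ha]
        exact congrArg (fun T : Op n => T a) hP.1.isIdempotentElem
      have hg := hgrad (j ξ) (j h)
      rw [hjh, j.inner_map_map, charFun_apply, ← hκm, ← hγm, he.integral_map, he.integral_map] at hg
      simp only [hexp] at hg
      rw [integral_const_mul] at hg
      have h2 : ∫ w, ((⟪normalField Ω (i w), j h⟫ : ℝ) : ℂ) *
          (Complex.exp (⟪z, j ξ⟫ * Complex.I) * Complex.exp (⟪w, ξ⟫ * Complex.I)) ∂γ' =
          Complex.exp (⟪z, j ξ⟫ * Complex.I) * ∫ w, (⟪planeNormal Ω j z w, h⟫ : ℝ) *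
            Complex.exp (⟪w, ξ⟫ * Complex.I) ∂γ' := by
        rw [← integral_const_mul]
        refine integral_congr_ae (Filter.Eventually.of_forall fun w => ?_)
        simp only [inner_planeNormal]
        ring
      rw [h2] at hg
      rw [charFun_apply]
      refine mul_left_cancel₀ (Complex.exp_ne_zero (⟪z, j ξ⟫ * Complex.I)) ?_
      linear_combination hg
  have hfin := hcone.finite_componentsWithin
  have hset : (finite_orthSlices hm hΩ hP z).toFinset =
      hfin.toFinset.image (image i) := by
    ext Δ
    simp only [Finite.mem_toFinset, Finset.mem_image, orthSlices_eq_image hΩ hj]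
    rfl
  have hweight : ∀ D ∈ hfin.toFinset, κ (i '' D) / μHE[m] (i '' D) = κ' D / volume D := by
    intro D hD
    rw [hi.euclideanHausdorffMeasure_image, EuclideanSpace.euclideanHausdorffMeasure_eq_volume,
      hκ', he.comap_apply]
  have hinj : Set.InjOn (image i) (hfin.toFinset : Set (Set (E m))) :=
    (image_injective.2 hi.injective).injOn
  constructor
  · rw [hset, Finset.sum_image hinj]
    conv_lhs => rw [← hκm, H.eq_sum_restrict, Measure.map_finset_sum he.measurable.aemeasurable]
    refine Finset.sum_congr rfl fun D hD => ?_
    have hDm := (hfin.mem_toFinset.1 hD).1.isOpen.measurableSet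
    rw [hweight D hD, Measure.map_smul, ← EuclideanSpace.euclideanHausdorffMeasure_eq_volume,
      map_restrict_planeMap D hDm]
  · rw [hset, Finset.sum_image hinj]
    conv_lhs => rw [← hγm, H.boundary_eq_sum_restrict,
      Measure.map_finset_sum he.measurable.aemeasurable]
    refine Finset.sum_congr rfl fun D hD => ?_
    have hDo := (hfin.mem_toFinset.1 hD).1.isOpen
    rw [hweight D hD, Measure.map_smul, finrank_euclideanSpace_fin,
      map_restrict_planeMap _ isClosed_frontier.measurableSet, sliceBoundary_image hDo]

end PlaneSection

end OrthVarifold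

/-! ### The Grassmannian -/

namespace OrthVarifold

open scoped ENNReal NNReal

section Grassmannian

variable {n m k : ℕ} {Ω : Set (E n)}

theorem Gr.apply_apply {P : Op n} (hP : P ∈ Gr n m) (x : E n) : P (P x) = P x :=
  congrArg (fun T : Op n => T x) hP.1.isIdempotentElem

theorem Gr.apply_of_mem_range {P : Op n} (hP : P ∈ Gr n m) {x : E n} (hx : x ∈ P.range) :
    P x = x := by
  obtain ⟨a, rfl⟩ := hx
  exact Gr.apply_apply hP a

theorem Gr.inner_apply_left {P : Op n} (hP : P ∈ Gr n m) (x y : E n) : ⟪P x, y⟫ = ⟪x, P y⟫ := by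
  have h : P.adjoint = P := hP.1.isSelfAdjoint
  conv_rhs => rw [← h]
  rw [ContinuousLinearMap.adjoint_inner_right]

theorem Gr.norm_le_one {P : Op n} (hP : P ∈ Gr n m) : ‖P‖ ≤ 1 := IsStarProjection.norm_le P hP.1

/-- The rank of a projection is its trace, so the Grassmannian is given by equations between
continuous functions. -/
theorem Gr.eq_setOf_trace : Gr n m =
    {P : Op n | P * P = P ∧ star P = P ∧ LinearMap.trace ℝ (E n) (P : E n →ₗ[ℝ] E n) = m} := by
  ext P
  have htrace : P * P = P → LinearMap.trace ℝ (E n) (P : E n →ₗ[ℝ] E n) =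
      Module.finrank ℝ P.range := fun h => by
    refine LinearMap.IsProj.trace ⟨fun x => ⟨x, rfl⟩, ?_⟩
    rintro _ ⟨x, rfl⟩
    exact congrArg (fun T : Op n => T x) h
  constructor
  · rintro ⟨hP, hr⟩
    exact ⟨hP.isIdempotentElem, hP.isSelfAdjoint, by rw [htrace hP.isIdempotentElem, hr]⟩
  · rintro ⟨h1, h2, h3⟩
    refine ⟨⟨h1, h2⟩, ?_⟩
    rw [htrace h1] at h3
    exact_mod_cast h3

theorem isCompact_Gr : IsCompact (Gr n m) := by
  have : ProperSpace (Op n) := FiniteDimensional.proper ℝ (Op n)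
  refine Metric.isCompact_of_isClosed_isBounded ?_ ?_
  · rw [Gr.eq_setOf_trace]
    refine (isClosed_eq (by fun_prop) continuous_id).inter
      ((isClosed_eq (ContinuousLinearMap.adjoint : Op n ≃ₗᵢ⋆[ℝ] Op n).continuous
        continuous_id).inter (isClosed_eq ?_ continuous_const))
    exact LinearMap.continuous_of_finiteDimensional
      ((LinearMap.trace ℝ (E n)).comp (ContinuousLinearMap.coeLM ℝ))
  · refine (Metric.isBounded_closedBall (x := (0 : Op n)) (r := 1)).subset fun P hP => ?_
    rw [mem_closedBall_zero_iff]
    exact Gr.norm_le_one hP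

/-- The orthogonal projection onto the line spanned by a unit vector. -/
noncomputable def lineProj (v : E n) : Op n := InnerProductSpace.rankOne ℝ v v

theorem lineProj_apply (v x : E n) : lineProj v x = ⟪v, x⟫ • v := rfl

theorem continuous_lineProj : Continuous (lineProj : E n → Op n) := by
  unfold lineProj
  simp only [InnerProductSpace.rankOne_def]
  fun_prop

theorem range_le_orthogonal_iff {Q : Op n} (hQ : Q ∈ Gr n k) {v : E n} :
    Q.range ≤ (Submodule.span ℝ {v})ᗮ ↔ Q v = 0 := by
  constructor
  · intro h
    have h1 := Submodule.mem_orthogonal_singleton_iff_inner_right.1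
      (h (LinearMap.mem_range_self (Q : E n →ₗ[ℝ] E n) v))
    rw [← inner_self_eq_zero (𝕜 := ℝ)]
    change ⟪Q v, Q v⟫ = 0
    rw [Gr.inner_apply_left hQ, Gr.apply_apply hQ]
    exact h1
  · rintro h _ ⟨x, rfl⟩
    rw [Submodule.mem_orthogonal_singleton_iff_inner_right]
    change ⟪v, Q x⟫ = 0
    rw [← Gr.inner_apply_left hQ, h, inner_zero_left]

theorem wedge_eq {Q : Op n} (hQ : Q ∈ Gr n k) {v : E n} (hv : ‖v‖ = 1) (hQv : Q v = 0) :
    wedge v Q = Q + lineProj v := by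
  ext1 x
  rw [wedge, planeProj, _root_.add_apply, lineProj_apply]
  refine Submodule.eq_starProjection_of_mem_of_inner_eq_zero ?_ ?_
  · exact add_comm (⟪v, x⟫ • v) (Q x) ▸ Submodule.add_mem_sup
      (Submodule.smul_mem _ _ (Submodule.mem_span_singleton_self v)) ⟨x, rfl⟩
  · intro w hw
    obtain ⟨a, ha, b, ⟨c, rfl⟩, rfl⟩ := Submodule.mem_sup.1 hw
    obtain ⟨t, rfl⟩ := Submodule.mem_span_singleton.1 ha
    change ⟪x - (Q x + ⟪v, x⟫ • v), t • v + Q c⟫ = 0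
    have h1 : ⟪Q x, v⟫ = 0 := by rw [Gr.inner_apply_left hQ, hQv, inner_zero_right]
    have h2 : ⟪Q x, Q c⟫ = ⟪x, Q c⟫ := by rw [Gr.inner_apply_left hQ, Gr.apply_apply hQ]
    have h3 : ⟪v, Q c⟫ = 0 := by rw [← Gr.inner_apply_left hQ, hQv, inner_zero_left]
    have h4 : ⟪v, v⟫ = 1 := by rw [real_inner_self_eq_norm_sq, hv, one_pow]
    simp only [inner_sub_left, inner_add_left, inner_add_right, inner_smul_left, inner_smul_right,
      h1, h2, h3, h4, conj_trivial, real_inner_comm x v]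
    ring

theorem planeProj_range_inf_eq {P : Op n} (hP : P ∈ Gr n m) {v : E n} (hv : ‖v‖ = 1)
    (hPv : v ∈ P.range) :
    planeProj (P.range ⊓ (Submodule.span ℝ {v})ᗮ) = P - lineProj v := by
  have hPv' := Gr.apply_of_mem_range hP hPv
  ext1 x
  rw [planeProj, _root_.sub_apply, lineProj_apply]
  have h4 : ⟪v, v⟫ = 1 := by rw [real_inner_self_eq_norm_sq, hv, one_pow]
  refine Submodule.eq_starProjection_of_mem_of_inner_eq_zero ⟨?_, ?_⟩ ?_
  · exact Submodule.sub_mem _ ⟨x, rfl⟩ (Submodule.smul_mem _ _ hPv)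
  · refine Submodule.mem_orthogonal_singleton_iff_inner_right.2 ?_
    rw [inner_sub_right, ← Gr.inner_apply_left hP, hPv', inner_smul_right, h4, mul_one, sub_self]
  · rintro w ⟨hw1, hw2⟩
    have hw3 : ⟪v, w⟫ = 0 := Submodule.mem_orthogonal_singleton_iff_inner_right.1 hw2
    rw [inner_sub_left, inner_sub_left, inner_smul_left, hw3, Gr.inner_apply_left hP,
      Gr.apply_of_mem_range hP hw1]
    simp

theorem isCompact_boundaryGr (hΩ : IsBoundedC2Domain Ω) : IsCompact (boundaryGr Ω k) := by
  have hS : IsCompact (frontier Ω) :=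
    hΩ.isCompact_closure.of_isClosed_subset isClosed_frontier frontier_subset_closure
  have hprod : IsCompact (frontier Ω ×ˢ Gr n k) := hS.prod isCompact_Gr
  have hcont : ContinuousOn (fun q : E n × Op n => q.2 (innerNormal Ω q.1))
      (frontier Ω ×ˢ Gr n k) :=
    continuousOn_snd.clm_apply
      (hΩ.continuousOn_innerNormal.comp continuousOn_fst fun q hq => hq.1)
  have hclosed := hcont.preimage_isClosed_of_isClosed hprod.isClosed (isClosed_singleton (x := 0))
  have heq : boundaryGr Ω k = (frontier Ω ×ˢ Gr n k) ∩
      (fun q : E n × Op n => q.2 (innerNormal Ω q.1)) ⁻¹' {0} := by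
    ext q
    constructor
    · rintro ⟨h1, h2, h3⟩
      exact ⟨⟨h1, h2⟩, (range_le_orthogonal_iff h2).1 h3⟩
    · rintro ⟨⟨h1, h2⟩, h3⟩
      exact ⟨h1, h2, (range_le_orthogonal_iff h2).2 h3⟩
  rw [heq]
  exact hprod.of_isClosed_subset hclosed inter_subset_left

theorem isFiniteMeasure_of_compl_null {X : Type*} [TopologicalSpace X] [MeasurableSpace X]
    {ν : Measure X} [IsLocallyFiniteMeasure ν] {K : Set X} (hK : IsCompact K) (h : ν Kᶜ = 0) :
    IsFiniteMeasure ν := ⟨by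
  rw [← union_compl_self K]
  refine (measure_union_le _ _).trans_lt ?_
  rw [h, add_zero]
  exact hK.measure_lt_top⟩

end Grassmannian

end OrthVarifold

/-! ### Disintegration of measures on a product -/

namespace OrthVarifold

open scoped ENNReal NNReal

section ProductMeasure

variable {Y X : Type*} [MeasurableSpace Y] [MeasurableSpace X]

/-- A finite measure whose first marginal is absolutely continuous with respect to `l` disintegrates
over `l`, into finite measures that need not be normalized. -/
theorem exists_kernel_of_fst_absolutelyContinuous [StandardBorelSpace X] [Nonempty X]
    {M : Measure (Y × X)} [IsFiniteMeasure M] {l : Measure Y} [IsFiniteMeasure l]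
    (h : M.fst ≪ l) :
    ∃ γ : Kernel Y X, IsSFiniteKernel γ ∧ (∀ y, IsFiniteMeasure (γ y)) ∧ l ⊗ₘ γ = M := by
  -- The Radon-Nikodym derivative is made finite everywhere: densities with the value `∞` would take
  -- the kernel out of the class of s-finite kernels.
  set d : Y → ℝ≥0 := fun y => (M.fst.rnDeriv l y).toNNReal with hd
  have hdm : Measurable d := (Measure.measurable_rnDeriv _ _).ennreal_toNNReal
  have hunc : Measurable (Function.uncurry fun (y : Y) (_ : X) => (d y : ℝ≥0∞)) :=
    (hdm.comp measurable_fst).coe_nnreal_ennreal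
  have hs : IsSFiniteKernel (M.condKernel.withDensity fun y _ => (d y : ℝ≥0∞)) :=
    Kernel.IsSFiniteKernel.withDensity _ fun _ _ => ENNReal.coe_ne_top
  refine ⟨M.condKernel.withDensity fun y _ => (d y : ℝ≥0∞), hs, fun y => ?_, ?_⟩
  · rw [Kernel.withDensity_apply _ hunc]
    exact isFiniteMeasure_withDensity (by simp)
  · have hl : l.withDensity (fun y => (d y : ℝ≥0∞)) = M.fst := by
      rw [← Measure.withDensity_rnDeriv_eq _ _ h]
      refine withDensity_congr_ae ?_
      filter_upwards [Measure.rnDeriv_ne_top M.fst l] with y hy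
      exact ENNReal.coe_toNNReal hy
    conv_rhs => rw [← M.disintegrate M.condKernel, ← hl]
    refine Measure.ext_of_lintegral _ fun f hf => ?_
    rw [Measure.lintegral_compProd hf, Measure.lintegral_compProd hf,
      lintegral_withDensity_eq_lintegral_mul _ hdm.coe_nnreal_ennreal
        hf.lintegral_kernel_prod_right']
    refine lintegral_congr fun y => ?_
    rw [Kernel.lintegral_withDensity _ hunc _ (by fun_prop),
      lintegral_const_mul _ (by fun_prop)]
    rfl

theorem _root_.MeasureTheory.Integrable.integral_measure_compProd {l : Measure Y} [SFinite l]
    {κ : Kernel Y X} [IsSFiniteKernel κ] {f : Y × X → ℝ} (hf : Integrable f (l ⊗ₘ κ)) :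
    Integrable (fun y => ∫ x, f (y, x) ∂κ y) l :=
  Integrable.integral_compProd (κ := Kernel.const Unit l) (η := Kernel.prodMkLeft Unit κ)
    (a := ()) hf

/-- An identity between integrals over all vertical strips passes to almost every fibre. -/
theorem ae_integral_eq_neg_of_setIntegral_eq {l : Measure Y} [IsFiniteMeasure l]
    {κ γ : Kernel Y X} [IsSFiniteKernel κ] [IsSFiniteKernel γ] {f g : Y × X → ℝ}
    (hf : Integrable f (l ⊗ₘ κ)) (hg : Integrable g (l ⊗ₘ γ))
    (h : ∀ Z, MeasurableSet Z →
      ∫ p in Prod.fst ⁻¹' Z, f p ∂(l ⊗ₘ κ) = -∫ p in Prod.fst ⁻¹' Z, g p ∂(l ⊗ₘ γ)) :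
    ∀ᵐ y ∂l, ∫ x, f (y, x) ∂κ y = -∫ x, g (y, x) ∂γ y := by
  refine Integrable.ae_eq_of_forall_setIntegral_eq _ _ hf.integral_measure_compProd
    hg.integral_measure_compProd.neg fun Z hZ _ => ?_
  have h1 := h Z hZ
  rw [← prod_univ, Measure.setIntegral_compProd hZ MeasurableSet.univ hf.integrableOn,
    Measure.setIntegral_compProd hZ MeasurableSet.univ hg.integrableOn] at h1
  simp only [Measure.restrict_univ] at h1
  rw [integral_neg]
  exact h1

theorem enorm_integral_sub_setIntegral_le [TopologicalSpace Y] [OpensMeasurableSpace Y]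
    {M : Measure (Y × X)} [IsFiniteMeasure M]
    {l : Measure Y} (hl : M.fst ≤ l) {f : Y × X → ℝ} (hf : Measurable f) {C : ℝ≥0}
    (hC : ∀ᵐ p ∂M, ‖f p‖ₑ ≤ C) {g : Y → ℝ} (hg : Continuous g) (hgc : HasCompactSupport g)
    {Z : Set Y} (hZ : MeasurableSet Z) :
    ‖∫ p, g p.1 * f p ∂M - ∫ p in Prod.fst ⁻¹' Z, f p ∂M‖ₑ ≤
      C * eLpNorm (Z.indicator (1 : Y → ℝ) - g) 1 l := by
  obtain ⟨K, hK⟩ := hgc.exists_bound_of_continuous hg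
  have hfC : ∀ᵐ p ∂M, ‖f p‖ ≤ C := by
    filter_upwards [hC] with p hp
    rw [enorm_le_coe] at hp
    exact_mod_cast hp
  have hfi : Integrable f M := .of_bound hf.aestronglyMeasurable C hfC
  have hgi : Integrable (fun p : Y × X => g p.1 * f p) M := by
    refine .of_bound ((hg.measurable.comp measurable_fst).mul hf).aestronglyMeasurable (K * C) ?_
    filter_upwards [hfC] with p hp
    rw [norm_mul]
    exact mul_le_mul (hK _) hp (norm_nonneg _) ((norm_nonneg _).trans (hK p.1))
  rw [← integral_indicator (measurable_fst hZ),
    ← integral_sub hgi (hfi.indicator (measurable_fst hZ))]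
  have hmeas : Measurable fun y => ‖(Z.indicator (1 : Y → ℝ) - g) y‖ₑ :=
    ((measurable_one.indicator hZ).sub hg.measurable).enorm
  refine (enorm_integral_le_lintegral_enorm _).trans ?_
  calc ∫⁻ p, ‖g p.1 * f p - (Prod.fst ⁻¹' Z).indicator f p‖ₑ ∂M
      ≤ ∫⁻ p, C * ‖(Z.indicator (1 : Y → ℝ) - g) p.1‖ₑ ∂M := by
        refine lintegral_mono_ae ?_
        filter_upwards [hC] with p hp
        have : g p.1 * f p - (Prod.fst ⁻¹' Z).indicator f p =
            f p * -((Z.indicator (1 : Y → ℝ) - g) p.1) := by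
          by_cases hpZ : p.1 ∈ Z
          · rw [indicator_of_mem (show p ∈ Prod.fst ⁻¹' Z from hpZ), Pi.sub_apply,
              indicator_of_mem hpZ]
            simp only [Pi.one_apply]
            ring
          · rw [indicator_of_notMem (show p ∉ Prod.fst ⁻¹' Z from hpZ), Pi.sub_apply,
              indicator_of_notMem hpZ]
            ring
        rw [this, enorm_mul, enorm_neg]
        gcongr
    _ = C * ∫⁻ y, ‖(Z.indicator (1 : Y → ℝ) - g) y‖ₑ ∂M.fst := by
        rw [Measure.fst, lintegral_map hmeas measurable_fst]
        exact lintegral_const_mul _ (hmeas.comp measurable_fst)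
    _ ≤ C * eLpNorm (Z.indicator (1 : Y → ℝ) - g) 1 l := by
        rw [eLpNorm_one_eq_lintegral_enorm]
        gcongr

variable [NormedAddCommGroup Y] [NormedSpace ℝ Y] [FiniteDimensional ℝ Y] [BorelSpace Y]

/-- An identity tested against smooth functions of the first variable extends to vertical strips,
because smooth functions with compact support are dense in `L¹` of the sum of the marginals. -/
theorem setIntegral_eq_neg_of_forall_contDiff {M M' : Measure (Y × X)} [IsFiniteMeasure M]
    [IsFiniteMeasure M'] {f f' : Y × X → ℝ} (hf : Measurable f) (hf' : Measurable f') {C : ℝ≥0}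
    (hC : ∀ᵐ p ∂M, ‖f p‖ₑ ≤ C) (hC' : ∀ᵐ p ∂M', ‖f' p‖ₑ ≤ C)
    (h : ∀ g : Y → ℝ, ContDiff ℝ 1 g →
      ∫ p, g p.1 * f p ∂M = -∫ p, g p.1 * f' p ∂M')
    {Z : Set Y} (hZ : MeasurableSet Z) :
    ∫ p in Prod.fst ⁻¹' Z, f p ∂M = -∫ p in Prod.fst ⁻¹' Z, f' p ∂M' := by
  set l := M.fst + M'.fst with hl
  have hmem : MemLp (Z.indicator (1 : Y → ℝ)) 1 l :=
    (memLp_const (1 : ℝ)).indicator hZ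
  rw [← sub_eq_zero, ← enorm_eq_zero, ← nonpos_iff_eq_zero]
  refine ENNReal.le_of_forall_pos_le_add fun ε hε _ => ?_
  rw [zero_add]
  obtain ⟨g, hgc, hg, hgl⟩ := hmem.exist_eLpNorm_sub_le ENNReal.one_ne_top le_rfl
    (ε := (ε / (2 * (C + 1)) : ℝ≥0)) (by positivity)
  have h1 := enorm_integral_sub_setIntegral_le (l := l) (Measure.le_add_right le_rfl) hf hC
    hg.continuous hgc hZ
  have h2 := enorm_integral_sub_setIntegral_le (M := M') (l := l) (Measure.le_add_left le_rfl)
    hf' hC' hg.continuous hgc hZ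
  have h3 := h g (hg.of_le (by exact_mod_cast le_top))
  have h4 : ∫ p in Prod.fst ⁻¹' Z, f p ∂M - -∫ p in Prod.fst ⁻¹' Z, f' p ∂M' =
      -((∫ p, g p.1 * f p ∂M - ∫ p in Prod.fst ⁻¹' Z, f p ∂M) +
        (∫ p, g p.1 * f' p ∂M' - ∫ p in Prod.fst ⁻¹' Z, f' p ∂M')) := by
    rw [h3]
    ring
  rw [h4, enorm_neg]
  refine (enorm_add_le _ _).trans ((add_le_add h1 h2).trans ?_)
  rw [ENNReal.ofReal_coe_nnreal] at hgl
  rw [← two_mul, ← mul_assoc]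
  refine (mul_le_mul_right hgl _).trans ?_
  norm_cast
  rw [mul_div_assoc', div_le_iff₀ (by positivity)]
  have : 2 * C * ε ≤ 2 * (C + 1) * ε := by gcongr; simp
  exact this.trans (mul_comm _ _).le

end ProductMeasure

end OrthVarifold

/-! ### The boundary identity in plane coordinates -/

namespace OrthVarifold

open scoped ENNReal NNReal

section FiberCoordinates

variable {n m : ℕ} {Ω : Set (E n)} {V Γ : Measure (E n × Op n)} {B : E n × Op n → Bil n}

/-- A point `x` and a plane `P` are recorded as `((P, x - P x), x)`: the first entry determines the
affine plane through `x` in the direction of `P`. -/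
noncomputable def fiberCoord (p : E n × Op n) : (Op n × E n) × E n := ((p.2, p.1 - p.2 p.1), p.1)

theorem continuous_fiberCoord : Continuous (fiberCoord : E n × Op n → (Op n × E n) × E n) := by
  unfold fiberCoord
  fun_prop

theorem measurable_fiberCoord : Measurable (fiberCoord : E n × Op n → (Op n × E n) × E n) :=
  continuous_fiberCoord.measurable

/-- The map `(x, Q) ↦ (x, ν^S(x) ∧ Q)`, given by a formula that is measurable on the whole space. -/
noncomputable def conormalLift (Ω : Set (E n)) (q : E n × Op n) : E n × Op n :=
  (q.1, q.2 + lineProj (normalField Ω q.1))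

theorem measurable_conormalLift (hΩ : IsBoundedC2Domain Ω) : Measurable (conormalLift Ω) :=
  measurable_fst.prodMk (measurable_snd.add
    (continuous_lineProj.measurable.comp (hΩ.measurable_normalField.comp measurable_fst)))

theorem conormalLift_eq (hΩ : IsBoundedC2Domain Ω) {k : ℕ} {q : E n × Op n}
    (hq : q ∈ boundaryGr Ω k) :
    conormalLift Ω q = (q.1, wedge (innerNormal Ω q.1) q.2) := by
  rw [wedge_eq hq.2.1 (hΩ.norm_innerNormal hq.1) ((range_le_orthogonal_iff hq.2.1).1 hq.2.2),
    conormalLift, normalField_of_mem hq.1]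

theorem IsOrthogonalAlong.isFiniteMeasure (hΩ : IsBoundedC2Domain Ω)
    (hV : IsOrthogonalAlong Ω m V B Γ) : IsFiniteMeasure V := by
  have := hV.varifold.locallyFinite
  refine isFiniteMeasure_of_compl_null (hΩ.isCompact_closure.prod (isCompact_Gr (n := n) (m := m)))
    ?_
  refine measure_mono_null ?_ (measure_union_null hV.support hV.varifold.concentrated)
  rintro ⟨x, P⟩ h
  by_contra h'
  simp_all

theorem IsOrthogonalAlong.isFiniteMeasure_boundary (hΩ : IsBoundedC2Domain Ω)
    (hV : IsOrthogonalAlong Ω m V B Γ) : IsFiniteMeasure Γ := by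
  have := hV.boundary.locallyFinite
  exact isFiniteMeasure_of_compl_null (isCompact_boundaryGr hΩ) hV.boundary.concentrated

theorem IsOrthogonalAlong.ae_mem (hV : IsOrthogonalAlong Ω m V B Γ) :
    ∀ᵐ p ∂V, p.1 ∈ closure Ω ∧ p.2 ∈ Gr n m := by
  have h1 : ∀ᵐ p ∂V, p ∈ closure Ω ×ˢ (univ : Set (Op n)) := hV.support
  have h2 : ∀ᵐ p ∂V, p ∈ (univ : Set (E n)) ×ˢ Gr n m := hV.varifold.concentrated
  filter_upwards [h1, h2] with p hp1 hp2
  exact ⟨hp1.1, hp2.2⟩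

theorem IsOrthogonalAlong.ae_mem_boundaryGr (hV : IsOrthogonalAlong Ω m V B Γ) :
    ∀ᵐ q ∂Γ, q ∈ boundaryGr Ω (m - 1) := hV.boundary.concentrated

theorem sum_apply_stdVec_mul_inner (L : E n →ₗ[ℝ] ℝ) (x : E n) :
    ∑ i, L (stdVec n i) * ⟪x, stdVec n i⟫ = L x := by
  conv_rhs => rw [← (EuclideanSpace.basisFun (Fin n) ℝ).sum_repr x, map_sum]
  refine Finset.sum_congr rfl fun i _ => ?_
  rw [map_smul, smul_eq_mul, mul_comm]
  simp [stdVec, EuclideanSpace.inner_single_right]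

/-- The test field `φ(x, P) = g(P, x - P x) e(x) h`: the derivative of `g` does not contribute,
because `x - P x` is constant in the directions of `P`. -/
theorem derivXDot_test {P : Op n} (hP : P ∈ Gr n m) {g : Op n × E n → ℝ} (hg : ContDiff ℝ 1 g)
    {e : E n → ℝ} (he : ContDiff ℝ 1 e) (x h : E n) :
    derivXDot (fun p : E n × Op n => (g (fiberCoord p).1 * e p.1) • h) (x, P) =
      g (fiberCoord (x, P)).1 * fderiv ℝ e x (P h) := by
  have hf : HasFDerivAt (fun y : E n => y - P y) (ContinuousLinearMap.id ℝ (E n) - P) x :=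
    (hasFDerivAt_id x).sub P.hasFDerivAt
  have hu : ContDiff ℝ 1 fun p : E n × Op n => (g (fiberCoord p).1 * e p.1) • h := by
    unfold fiberCoord
    fun_prop
  have hgx : HasFDerivAt (fun y : E n => g (P, y - P y))
      ((fderiv ℝ g (P, x - P x)).comp
        ((0 : E n →L[ℝ] Op n).prod (ContinuousLinearMap.id ℝ (E n) - P))) x :=
    (hg.differentiable one_ne_zero (P, x - P x)).hasFDerivAt.comp x
      ((hasFDerivAt_const P x).prodMk hf)
  have hex : HasFDerivAt e (fderiv ℝ e x) x := (he.differentiable one_ne_zero x).hasFDerivAt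
  have hline := ((hgx.mul hex).smul_const h)
  have hpart : ∀ v, fderiv ℝ (fun p : E n × Op n => (g (fiberCoord p).1 * e p.1) • h) (x, P)
      (v, 0) = (g (P, x - P x) * fderiv ℝ e x v +
        e x * fderiv ℝ g (P, x - P x) (0, v - P v)) • h := by
    intro v
    have h1 : HasFDerivAt (fun y : E n => (y, P))
        ((ContinuousLinearMap.id ℝ (E n)).prod (0 : E n →L[ℝ] Op n)) x :=
      (hasFDerivAt_id x).prodMk (hasFDerivAt_const P x)
    have h2 := (hu.differentiable one_ne_zero (x, P)).hasFDerivAt.comp x h1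
    have h3 := congrArg (fun T => T v) (h2.unique hline)
    simpa using h3
  let L : E n →ₗ[ℝ] ℝ :=
    ((g (P, x - P x)) • (fderiv ℝ e x) + (e x) • ((fderiv ℝ g (P, x - P x)).comp
      ((0 : E n →L[ℝ] Op n).prod (ContinuousLinearMap.id ℝ (E n) - P))) : E n →L[ℝ] ℝ)
  have hL : ∀ v, L v = g (P, x - P x) * fderiv ℝ e x v +
      e x * fderiv ℝ g (P, x - P x) (0, v - P v) := fun v => rfl
  have hsum := sum_apply_stdVec_mul_inner L (P h)
  rw [hL, Gr.apply_apply hP, sub_self] at hsum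
  rw [derivXDot]
  simp only [hpart, ← hL, inner_smul_left h (P _), conj_trivial, ← Gr.inner_apply_left hP h]
  rw [hsum, show ((0 : Op n), (0 : E n)) = 0 from rfl, map_zero, mul_zero, add_zero]
  rfl

/-- The boundary identity of an orthogonal varifold with curvature zero, for test fields that are
products of a function of the affine plane, a function of the point and a constant vector. -/
theorem IsOrthogonalAlong.integral_fiberCoord (hΩ : IsBoundedC2Domain Ω)
    (hV : IsOrthogonalAlong Ω m V B Γ) (hB : ∀ᵐ p ∂V, B p = 0) {g : Op n × E n → ℝ}
    (hg : ContDiff ℝ 1 g) {e : E n → ℝ} (he : ContDiff ℝ 1 e) (h : E n) :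
    ∫ p, g p.1 * fderiv ℝ e p.2 (p.1.1 h) ∂(V.map fiberCoord) =
      -∫ p, g p.1 * (e p.2 * ⟪normalField Ω p.2, h⟫)
        ∂((Γ.map (conormalLift Ω)).map fiberCoord) := by
  have hde : Continuous (fderiv ℝ e) := he.continuous_fderiv one_ne_zero
  have hgc := hg.continuous
  have hec := he.continuous
  have hN := hΩ.measurable_normalField
  rw [integral_map measurable_fiberCoord.aemeasurable
      (by fun_prop : Continuous _).aestronglyMeasurable,
    integral_map measurable_fiberCoord.aemeasurable
      (by fun_prop : Measurable _).aestronglyMeasurable,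
    integral_map (f := fun q : E n × Op n => g (fiberCoord q).1 *
        (e (fiberCoord q).2 * ⟪normalField Ω (fiberCoord q).2, h⟫))
      (measurable_conormalLift hΩ).aemeasurable
      ((by fun_prop : Measurable fun p : (Op n × E n) × E n =>
        g p.1 * (e p.2 * ⟪normalField Ω p.2, h⟫)).comp measurable_fiberCoord).aestronglyMeasurable]
  have hu : ContDiff ℝ 1 fun p : E n × Op n => (g (fiberCoord p).1 * e p.1) • h := by
    unfold fiberCoord
    fun_prop
  have key := hV.identity _ hu
  have hleft : ∫ p, g (fiberCoord p).1 * fderiv ℝ e (fiberCoord p).2 ((fiberCoord p).1.1 h) ∂V =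
      ∫ p, (derivPDot (fun p : E n × Op n => (g (fiberCoord p).1 * e p.1) • h) p (B p) +
        ⟪traceBil (B p), (g (fiberCoord p).1 * e p.1) • h⟫ +
        derivXDot (fun p : E n × Op n => (g (fiberCoord p).1 * e p.1) • h) p) ∂V := by
    refine integral_congr_ae ?_
    filter_upwards [hB, hV.ae_mem] with p hp hp'
    rw [derivXDot_test hp'.2 hg he p.1 h, hp]
    simp [derivPDot, traceBil, fiberCoord, show ((0 : E n), (0 : Op n)) = 0 from rfl]
  rw [hleft, key]
  congr 1
  refine integral_congr_ae ?_
  filter_upwards [hV.ae_mem_boundaryGr] with q hq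
  simp only [conormalLift_eq hΩ hq, inner_smul_right]
  simp only [fiberCoord]
  rw [normalField_of_mem hq.1, mul_assoc]

end FiberCoordinates

end OrthVarifold

/-! ### Disintegration over the affine planes -/

namespace OrthVarifold

open scoped ENNReal NNReal

section Fibers

variable {n m : ℕ} {Ω : Set (E n)} {V Γ : Measure (E n × Op n)} {B : E n × Op n → Bil n}

/-- The varifold `V` as a measure on pairs of an affine plane and a point. -/
noncomputable def fiberMeasure (V : Measure (E n × Op n)) : Measure ((Op n × E n) × E n) :=
  V.map fiberCoord

/-- The boundary varifold `Γ` as a measure on pairs of an affine plane and a point, the plane at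
`(x, Q)` being the one through `x` in the direction of `ν^S(x) ∧ Q`. -/
noncomputable def boundaryFiberMeasure (Ω : Set (E n)) (Γ : Measure (E n × Op n)) :
    Measure ((Op n × E n) × E n) :=
  (Γ.map (conormalLift Ω)).map fiberCoord

/-- The conditional measures `κ` of the varifold and `γ` of its boundary on a single affine plane
`z + P`, related by the boundary identity in Fourier form: the gradient of `κ` in the directions of
`P` is the vector measure `ν^S γ`. -/
structure IsOrthogonalFiber (Ω : Set (E n)) (m : ℕ) (P : Op n) (z : E n) (κ γ : Measure (E n)) :
    Prop where
  plane_mem : P ∈ Gr n m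
  apply_offset : P z = 0
  interior : ∀ᵐ x ∂κ, x ∈ closure Ω ∧ x ∈ affPlane P z
  boundary : ∀ᵐ x ∂γ, x ∈ frontier Ω ∧ x ∈ affPlane P z ∧ normalField Ω x ∈ P.range
  gradient : ∀ ξ h, ⟪P h, ξ⟫ * Complex.I * charFun κ ξ =
    -∫ x, (⟪normalField Ω x, h⟫ : ℝ) * Complex.exp (⟪x, ξ⟫ * Complex.I) ∂γ

theorem ae_fiberMeasure (hV : IsOrthogonalAlong Ω m V B Γ) :
    ∀ᵐ p ∂fiberMeasure V, p.1.1 ∈ Gr n m ∧ p.2 - p.1.1 p.2 = p.1.2 ∧ p.2 ∈ closure Ω := by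
  refine (ae_map_iff measurable_fiberCoord.aemeasurable ?_).2 ?_
  · refine ((isCompact_Gr.isClosed.preimage (by fun_prop)).inter
      ((isClosed_eq (f := fun p : (Op n × E n) × E n => p.2 - p.1.1 p.2) (g := fun p => p.1.2)
        (by fun_prop) (by fun_prop)).inter
        (isClosed_closure.preimage (by fun_prop)))).measurableSet
  · filter_upwards [hV.ae_mem] with p hp
    exact ⟨hp.2, rfl, hp.1⟩

theorem ae_boundaryFiberMeasure (hΩ : IsBoundedC2Domain Ω) (hV : IsOrthogonalAlong Ω m V B Γ) :
    ∀ᵐ p ∂boundaryFiberMeasure Ω Γ, p.2 ∈ frontier Ω ∧ p.2 - p.1.1 p.2 = p.1.2 ∧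
      normalField Ω p.2 ∈ p.1.1.range := by
  have hN := hΩ.measurable_normalField
  have h : ∀ᵐ p ∂boundaryFiberMeasure Ω Γ, p.2 ∈ frontier Ω ∧ p.2 - p.1.1 p.2 = p.1.2 ∧
      p.1.1 (normalField Ω p.2) = normalField Ω p.2 := by
    have hS : MeasurableSet {p : (Op n × E n) × E n | p.2 ∈ frontier Ω ∧
        p.2 - p.1.1 p.2 = p.1.2 ∧ p.1.1 (normalField Ω p.2) = normalField Ω p.2} := by
      refine (measurable_snd isClosed_frontier.measurableSet).inter ((isClosed_eq (f :=
        fun p : (Op n × E n) × E n => p.2 - p.1.1 p.2) (g := fun p => p.1.2)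
        (by fun_prop) (by fun_prop)).measurableSet.inter
        (measurableSet_eq_fun (by fun_prop) (by fun_prop)))
    refine (ae_map_iff measurable_fiberCoord.aemeasurable hS).2
      ((ae_map_iff (measurable_conormalLift hΩ).aemeasurable (measurable_fiberCoord hS)).2 ?_)
    filter_upwards [hV.ae_mem_boundaryGr] with q hq
    rw [conormalLift_eq hΩ hq]
    refine ⟨hq.1, rfl, ?_⟩
    simp only [fiberCoord]
    rw [normalField_of_mem hq.1]
    exact Submodule.starProjection_eq_self_iff.2
      (Submodule.mem_sup_left (Submodule.mem_span_singleton_self _))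
  filter_upwards [h] with p hp
  exact ⟨hp.1, hp.2.1, ⟨_, hp.2.2⟩⟩

/-- The boundary identity restricted to an arbitrary Borel set of affine planes. -/
theorem IsOrthogonalAlong.setIntegral_fiber (hΩ : IsBoundedC2Domain Ω)
    (hV : IsOrthogonalAlong Ω m V B Γ) (hB : ∀ᵐ p ∂V, B p = 0) {e : E n → ℝ}
    (he : ContDiff ℝ 1 e) {K : ℝ≥0} (heK : ∀ x, ‖e x‖ ≤ K) (hdK : ∀ x, ‖fderiv ℝ e x‖ ≤ K)
    (h : E n) {Z : Set (Op n × E n)} (hZ : MeasurableSet Z) :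
    ∫ p in Prod.fst ⁻¹' Z, fderiv ℝ e p.2 (p.1.1 h) ∂fiberMeasure V =
      -∫ p in Prod.fst ⁻¹' Z, e p.2 * ⟪normalField Ω p.2, h⟫ ∂boundaryFiberMeasure Ω Γ := by
  have := hV.isFiniteMeasure hΩ
  have := hV.isFiniteMeasure_boundary hΩ
  have : IsFiniteMeasure (fiberMeasure V) := by unfold fiberMeasure; infer_instance
  have : IsFiniteMeasure (boundaryFiberMeasure Ω Γ) := by
    unfold boundaryFiberMeasure; infer_instance
  have hde : Continuous (fderiv ℝ e) := he.continuous_fderiv one_ne_zero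
  have hec := he.continuous
  have hN := hΩ.measurable_normalField
  refine setIntegral_eq_neg_of_forall_contDiff (C := K * ‖h‖₊) (by fun_prop) (by fun_prop) ?_ ?_
    (fun g hg => hV.integral_fiberCoord hΩ hB hg he h) hZ
  · filter_upwards [ae_fiberMeasure hV] with p hp
    rw [enorm_le_coe, ← NNReal.coe_le_coe, NNReal.coe_mul, coe_nnnorm, coe_nnnorm]
    refine (ContinuousLinearMap.le_opNorm _ _).trans ?_
    refine mul_le_mul (hdK _) ?_ (norm_nonneg _) K.2
    exact (ContinuousLinearMap.le_opNorm _ _).trans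
      (mul_le_of_le_one_left (norm_nonneg _) (Gr.norm_le_one hp.1))
  · refine ae_of_all _ fun p => ?_
    rw [enorm_le_coe, ← NNReal.coe_le_coe, NNReal.coe_mul, coe_nnnorm, coe_nnnorm, norm_mul]
    refine mul_le_mul (heK _) ?_ (norm_nonneg _) K.2
    exact (norm_inner_le_norm _ _).trans
      (mul_le_of_le_one_left (norm_nonneg _) (hΩ.norm_normalField_le _))

/-- Over a set of affine planes negligible for `V` the normal has zero integral against every test
function, hence vanishes almost everywhere for `Γ`; it being a unit vector, `Γ` does not charge
these planes. -/
theorem IsOrthogonalAlong.fst_absolutelyContinuous (hΩ : IsBoundedC2Domain Ω)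
    (hV : IsOrthogonalAlong Ω m V B Γ) (hB : ∀ᵐ p ∂V, B p = 0) :
    (boundaryFiberMeasure Ω Γ).fst ≪ (fiberMeasure V).fst := by
  have := hV.isFiniteMeasure_boundary hΩ
  have : IsFiniteMeasure (boundaryFiberMeasure Ω Γ) := by
    unfold boundaryFiberMeasure; infer_instance
  have hN := hΩ.measurable_normalField
  refine Measure.AbsolutelyContinuous.mk fun Z hZ hZ0 => ?_
  rw [Measure.fst_apply hZ] at hZ0 ⊢
  set ρ : Measure (E n) := ((boundaryFiberMeasure Ω Γ).restrict (Prod.fst ⁻¹' Z)).snd with hρ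
  have hzero : ∀ h : E n, ∀ᵐ x ∂ρ, ⟪normalField Ω x, h⟫ = 0 := by
    intro h
    have hint : Integrable (fun x => ⟪normalField Ω x, h⟫) ρ := by
      refine .of_bound (by fun_prop : Measurable _).aestronglyMeasurable ‖h‖
        (ae_of_all _ fun x => ?_)
      exact (norm_inner_le_norm _ _).trans
        (mul_le_of_le_one_left (norm_nonneg _) (hΩ.norm_normalField_le _))
    refine ae_eq_zero_of_integral_contDiff_smul_eq_zero hint.locallyIntegrable fun e he hec => ?_
    have he1 : ContDiff ℝ 1 e := he.of_le (by exact_mod_cast le_top)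
    obtain ⟨K₁, hK₁⟩ := hec.exists_bound_of_continuous he.continuous
    obtain ⟨K₂, hK₂⟩ := (hec.fderiv ℝ).exists_bound_of_continuous
      (he1.continuous_fderiv one_ne_zero)
    have h1 := hV.setIntegral_fiber hΩ hB he1 (K := (max K₁ K₂).toNNReal)
      (fun x => (hK₁ x).trans ((le_max_left _ _).trans (Real.le_coe_toNNReal _)))
      (fun x => (hK₂ x).trans ((le_max_right _ _).trans (Real.le_coe_toNNReal _))) h hZ
    rw [Measure.restrict_eq_zero.2 hZ0, integral_zero_measure, eq_comm, neg_eq_zero] at h1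
    rw [hρ, Measure.snd, integral_map measurable_snd.aemeasurable]
    · exact h1
    · have hec := he.continuous
      exact (by fun_prop : Measurable _).aestronglyMeasurable
  have hN0 : ∀ᵐ x ∂ρ, normalField Ω x = 0 := by
    filter_upwards [ae_all_iff.2 fun i : Fin n => hzero (stdVec n i)] with x hx
    ext i
    simpa [stdVec, EuclideanSpace.inner_single_right] using hx i
  have h2 : ∀ᵐ p ∂(boundaryFiberMeasure Ω Γ).restrict (Prod.fst ⁻¹' Z), normalField Ω p.2 = 0 :=
    ae_of_ae_map measurable_snd.aemeasurable hN0
  have h3 : ∀ᵐ p ∂(boundaryFiberMeasure Ω Γ).restrict (Prod.fst ⁻¹' Z), False := by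
    filter_upwards [h2, ae_restrict_of_ae (ae_boundaryFiberMeasure hΩ hV)] with p hp hp'
    rw [normalField_of_mem hp'.1] at hp
    have := hΩ.norm_innerNormal hp'.1
    rw [hp, norm_zero] at this
    exact zero_ne_one this
  rwa [Filter.eventually_false_iff_eq_bot, ae_eq_bot, Measure.restrict_eq_zero] at h3

theorem fderiv_cos_inner (ξ x v : E n) :
    fderiv ℝ (fun x : E n => Real.cos ⟪x, ξ⟫) x v = -(Real.sin ⟪x, ξ⟫ * ⟪v, ξ⟫) := by
  have h : HasFDerivAt (fun x : E n => ⟪x, ξ⟫) ((innerSL ℝ ξ : E n →L[ℝ] ℝ)) x := by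
    simp only [real_inner_comm ξ]
    exact (innerSL ℝ ξ).hasFDerivAt
  rw [h.cos.fderiv]
  simp [real_inner_comm ξ]

theorem fderiv_sin_inner (ξ x v : E n) :
    fderiv ℝ (fun x : E n => Real.sin ⟪x, ξ⟫) x v = Real.cos ⟪x, ξ⟫ * ⟪v, ξ⟫ := by
  have h : HasFDerivAt (fun x : E n => ⟪x, ξ⟫) ((innerSL ℝ ξ : E n →L[ℝ] ℝ)) x := by
    simp only [real_inner_comm ξ]
    exact (innerSL ℝ ξ).hasFDerivAt
  rw [h.sin.fderiv]
  simp [real_inner_comm ξ]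

theorem integral_mul_cexp_inner {ρ : Measure (E n)} [IsFiniteMeasure ρ] {w : E n → ℝ}
    (hw : Measurable w) {C : ℝ} (hC : ∀ x, ‖w x‖ ≤ C) (ξ : E n) :
    ∫ x, (w x : ℂ) * Complex.exp (⟪x, ξ⟫ * Complex.I) ∂ρ =
      ((∫ x, Real.cos ⟪x, ξ⟫ * w x ∂ρ : ℝ) : ℂ) +
        Complex.I * ((∫ x, Real.sin ⟪x, ξ⟫ * w x ∂ρ : ℝ) : ℂ) := by
  have hb : ∀ c : ℝ, |c| ≤ 1 → ∀ x, ‖c * w x‖ ≤ C := fun c hc x => by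
    rw [norm_mul, Real.norm_eq_abs c]
    exact (mul_le_of_le_one_left (norm_nonneg _) hc).trans (hC x)
  have h1 : Integrable (fun x => Real.cos ⟪x, ξ⟫ * w x) ρ :=
    .of_bound (by fun_prop : Measurable _).aestronglyMeasurable C
      (ae_of_all _ fun x => hb _ (Real.abs_cos_le_one _) x)
  have h2 : Integrable (fun x => Real.sin ⟪x, ξ⟫ * w x) ρ :=
    .of_bound (by fun_prop : Measurable _).aestronglyMeasurable C
      (ae_of_all _ fun x => hb _ (Real.abs_sin_le_one _) x)
  rw [← integral_complex_ofReal, ← integral_complex_ofReal, ← integral_const_mul,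
    ← integral_add h1.ofReal (h2.ofReal.const_mul _)]
  refine integral_congr_ae (ae_of_all _ fun x => ?_)
  simp only [Complex.exp_mul_I]
  push_cast
  ring

theorem continuous_integral_inner_mul_cexp {γ : Measure (E n)} [IsFiniteMeasure γ]
    (hΩ : IsBoundedC2Domain Ω) : Continuous fun p : E n × E n =>
      ∫ x, ((⟪normalField Ω x, p.2⟫ : ℝ) : ℂ) * Complex.exp (⟪x, p.1⟫ * Complex.I) ∂γ := by
  have hN := hΩ.measurable_normalField
  refine continuous_iff_continuousAt.2 fun p₀ => ?_
  refine continuousAt_of_dominated (bound := fun _ => ‖p₀.2‖ + 1)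
    (Filter.Eventually.of_forall fun p =>
      (by fun_prop : Measurable fun x : E n => ((⟪normalField Ω x, p.2⟫ : ℝ) : ℂ) *
        Complex.exp (⟪x, p.1⟫ * Complex.I)).aestronglyMeasurable) ?_ (integrable_const _)
    (ae_of_all _ fun x => (by fun_prop : Continuous _).continuousAt)
  filter_upwards [(continuous_snd.norm.tendsto p₀).eventually_lt_const (lt_add_one ‖p₀.2‖)]
    with p hp
  refine ae_of_all _ fun x => ?_
  rw [norm_mul, Complex.norm_exp_ofReal_mul_I, mul_one, Complex.norm_real]
  exact ((norm_inner_le_norm _ _).trans (mul_le_of_le_one_left (norm_nonneg _)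
    (hΩ.norm_normalField_le _))).trans hp.le

/-- The boundary identity on almost every affine plane, for fixed vectors. -/
theorem IsOrthogonalAlong.ae_gradient (hΩ : IsBoundedC2Domain Ω)
    (hV : IsOrthogonalAlong Ω m V B Γ) (hB : ∀ᵐ p ∂V, B p = 0) {l : Measure (Op n × E n)}
    [IsFiniteMeasure l] {κ γ : Kernel (Op n × E n) (E n)} [IsFiniteKernel κ] [IsSFiniteKernel γ]
    (hγ : ∀ y, IsFiniteMeasure (γ y)) (hκV : l ⊗ₘ κ = fiberMeasure V)
    (hγΓ : l ⊗ₘ γ = boundaryFiberMeasure Ω Γ) (ξ h : E n) :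
    ∀ᵐ y ∂l, ⟪y.1 h, ξ⟫ * Complex.I * charFun (κ y) ξ =
      -∫ x, (⟪normalField Ω x, h⟫ : ℝ) * Complex.exp (⟪x, ξ⟫ * Complex.I) ∂(γ y) := by
  have := hV.isFiniteMeasure_boundary hΩ
  have : IsFiniteMeasure (l ⊗ₘ γ) := by
    rw [hγΓ, boundaryFiberMeasure]; infer_instance
  have hN := hΩ.measurable_normalField
  have fiber : ∀ e : E n → ℝ, ContDiff ℝ 1 e → (∀ x, ‖e x‖ ≤ 1) →
      (∀ x, ‖fderiv ℝ e x‖ ≤ ‖ξ‖) → ∀ᵐ y ∂l,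
      ∫ x, fderiv ℝ e x (y.1 h) ∂κ y = -∫ x, e x * ⟪normalField Ω x, h⟫ ∂γ y := by
    intro e he he1 hde1
    have hde : Continuous (fderiv ℝ e) := he.continuous_fderiv one_ne_zero
    have hec := he.continuous
    refine ae_integral_eq_neg_of_setIntegral_eq
      (f := fun p : (Op n × E n) × E n => fderiv ℝ e p.2 (p.1.1 h))
      (g := fun p => e p.2 * ⟪normalField Ω p.2, h⟫) ?_ ?_ fun Z hZ => ?_
    · refine .of_bound (by fun_prop : Continuous _).aestronglyMeasurable (‖ξ‖ * ‖h‖) ?_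
      rw [hκV]
      filter_upwards [ae_fiberMeasure hV] with p hp
      refine (ContinuousLinearMap.le_opNorm _ _).trans ?_
      refine mul_le_mul (hde1 _) ?_ (norm_nonneg _) (norm_nonneg _)
      exact (ContinuousLinearMap.le_opNorm _ _).trans
        (mul_le_of_le_one_left (norm_nonneg _) (Gr.norm_le_one hp.1))
    · refine .of_bound (by fun_prop : Measurable _).aestronglyMeasurable ‖h‖
        (ae_of_all _ fun p => ?_)
      rw [norm_mul]
      refine (mul_le_of_le_one_left (norm_nonneg _) (he1 _)).trans ?_
      exact (norm_inner_le_norm _ _).trans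
        (mul_le_of_le_one_left (norm_nonneg _) (hΩ.norm_normalField_le _))
    · rw [hκV, hγΓ]
      exact hV.setIntegral_fiber hΩ hB he (K := max 1 ‖ξ‖₊)
        (fun x => (he1 x).trans (by simp)) (fun x => (hde1 x).trans (by simp)) h hZ
  -- Test functions `cos ⟪x, ξ⟫` and `sin ⟪x, ξ⟫`: not compactly supported, but bounded with bounded
  -- derivative.
  have hcos := fiber (fun x => Real.cos ⟪x, ξ⟫) (contDiff_id.inner ℝ contDiff_const).cos
    (fun x => Real.abs_cos_le_one _)
    fun x => ContinuousLinearMap.opNorm_le_bound _ (norm_nonneg _) fun v => by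
      rw [fderiv_cos_inner, norm_neg, norm_mul, mul_comm ‖ξ‖]
      exact (mul_le_of_le_one_left (norm_nonneg _) (Real.abs_sin_le_one _)).trans
        (norm_inner_le_norm _ _)
  have hsin := fiber (fun x => Real.sin ⟪x, ξ⟫) (contDiff_id.inner ℝ contDiff_const).sin
    (fun x => Real.abs_sin_le_one _)
    fun x => ContinuousLinearMap.opNorm_le_bound _ (norm_nonneg _) fun v => by
      rw [fderiv_sin_inner, norm_mul, mul_comm ‖ξ‖]
      exact (mul_le_of_le_one_left (norm_nonneg _) (Real.abs_cos_le_one _)).trans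
        (norm_inner_le_norm _ _)
  filter_upwards [hcos, hsin] with y hyc hys
  have h1 := integral_mul_cexp_inner (ρ := κ y) (w := fun _ => 1) measurable_const (C := 1)
    (by simp) ξ
  have h2 := integral_mul_cexp_inner (ρ := γ y) (w := fun x => ⟪normalField Ω x, h⟫)
    (by fun_prop) (C := ‖h‖) (fun x => (norm_inner_le_norm _ _).trans
        (mul_le_of_le_one_left (norm_nonneg _) (hΩ.norm_normalField_le _))) ξ
  simp only [Complex.ofReal_one, one_mul, mul_one] at h1
  simp only [fderiv_cos_inner, fderiv_sin_inner, integral_neg, integral_mul_const] at hyc hys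
  rw [charFun_apply, h1, h2]
  have hyc' := congrArg (fun t : ℝ => (t : ℂ)) hyc
  have hys' := congrArg (fun t : ℝ => (t : ℂ)) hys
  simp only [Complex.ofReal_neg, Complex.ofReal_mul] at hyc' hys'
  linear_combination hyc' + Complex.I * hys' +
    ((∫ x, Real.sin ⟪x, ξ⟫ ∂κ y : ℝ) : ℂ) * ((⟪y.1 h, ξ⟫ : ℝ) : ℂ) * Complex.I_sq

/-- Disintegration of an orthogonal varifold with curvature zero and of its boundary over the space
of affine planes. -/
theorem IsOrthogonalAlong.exists_fibers (hΩ : IsBoundedC2Domain Ω)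
    (hV : IsOrthogonalAlong Ω m V B Γ) (hB : ∀ᵐ p ∂V, B p = 0) :
    ∃ κ γ : Kernel (Op n × E n) (E n), IsMarkovKernel κ ∧ IsSFiniteKernel γ ∧
      (∀ y, IsFiniteMeasure (γ y)) ∧ (fiberMeasure V).fst ⊗ₘ κ = fiberMeasure V ∧
      (fiberMeasure V).fst ⊗ₘ γ = boundaryFiberMeasure Ω Γ ∧
      ∀ᵐ y ∂(fiberMeasure V).fst, IsOrthogonalFiber Ω m y.1 y.2 (κ y) (γ y) := by
  have := hV.isFiniteMeasure hΩ
  have := hV.isFiniteMeasure_boundary hΩ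
  have : IsFiniteMeasure (fiberMeasure V) := by unfold fiberMeasure; infer_instance
  have : IsFiniteMeasure (boundaryFiberMeasure Ω Γ) := by
    unfold boundaryFiberMeasure; infer_instance
  obtain ⟨γ, hγ, hγf, hγΓ⟩ := exists_kernel_of_fst_absolutelyContinuous
    (hV.fst_absolutelyContinuous hΩ hB)
  have hκV := (fiberMeasure V).disintegrate (fiberMeasure V).condKernel
  refine ⟨(fiberMeasure V).condKernel, γ, inferInstance, hγ, hγf, hκV, hγΓ, ?_⟩
  set κ := (fiberMeasure V).condKernel with hκ
  obtain ⟨D, hDc, hD⟩ := TopologicalSpace.exists_countable_dense (E n × E n)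
  have hgrad : ∀ᵐ y ∂(fiberMeasure V).fst, ∀ p ∈ D, ⟪y.1 p.2, p.1⟫ * Complex.I *
      charFun (κ y) p.1 = -∫ x, (⟪normalField Ω x, p.2⟫ : ℝ) *
        Complex.exp (⟪x, p.1⟫ * Complex.I) ∂(γ y) :=
    (ae_ball_iff hDc).2 fun p _ => hV.ae_gradient hΩ hB hγf hκV hγΓ p.1 p.2
  have hint := Measure.ae_ae_of_ae_compProd (hκV.symm ▸ ae_fiberMeasure hV)
  have hbdry := Measure.ae_ae_of_ae_compProd (hγΓ.symm ▸ ae_boundaryFiberMeasure hΩ hV)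
  filter_upwards [hgrad, hint, hbdry] with y hy1 hy2 hy3
  have hmem : ∀ x, x - y.1 x = y.2 → x ∈ affPlane y.1 y.2 := fun x hx =>
    ⟨x, by rw [← hx, sub_sub_cancel]; rfl⟩
  obtain ⟨x, hx⟩ := hy2.exists
  refine ⟨hx.1, ?_, ?_, ?_, ?_⟩
  · rw [← hx.2.1, map_sub, Gr.apply_apply hx.1, sub_self]
  · filter_upwards [hy2] with x hx
    exact ⟨hx.2.2, hmem x hx.2.1⟩
  · filter_upwards [hy3] with x hx
    exact ⟨hx.1, hmem x hx.2.1, hx.2.2⟩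
  -- Both sides are continuous in `(ξ, h)`, so that a countable dense set of pairs suffices.
  · have hcont : Continuous fun p : E n × E n => ((⟪y.1 p.2, p.1⟫ : ℝ) : ℂ) * Complex.I *
        charFun (κ y) p.1 := by
      have := continuous_charFun (μ := κ y)
      fun_prop
    have := Continuous.ext_on hD hcont (continuous_integral_inner_mul_cexp (γ := γ y) hΩ).neg hy1
    exact fun ξ h => congrFun this (ξ, h)

end Fibers

end OrthVarifold

/-! ### Integration over the slices -/

namespace OrthVarifold

open scoped ENNReal NNReal

section SliceIntegrals

variable {n m : ℕ} {Ω : Set (E n)} {V Γ : Measure (E n × Op n)} {B : E n × Op n → Bil n}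
  {P : Op n} {z : E n} {Δ : Set (E n)}

theorem integrableOn_of_continuousOn_of_mapsTo {X Y : Type*} [TopologicalSpace X]
    [MeasurableSpace X] [OpensMeasurableSpace X] [SecondCountableTopology X] [TopologicalSpace Y]
    {ρ : Measure X} {s : Set X} (hs : MeasurableSet s) (hρ : ρ s < ∞) {f : X → Y} {K : Set Y}
    (hK : IsCompact K) (hf : ContinuousOn f s) (hfK : MapsTo f s K) {φ : Y → ℝ}
    (hφ : ContinuousOn φ K) : IntegrableOn (fun x => φ (f x)) s ρ := by
  have : IsFiniteMeasure (ρ.restrict s) := ⟨by simpa using hρ⟩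
  obtain ⟨C, hC⟩ := hK.exists_bound_of_continuousOn hφ
  refine Integrable.of_bound ((hφ.comp hf hfK).aestronglyMeasurable hs) C ?_
  filter_upwards [ae_restrict_mem hs] with x hx
  exact hC _ (hfK hx)

theorem IsOrthogonalAlong.integrable_of_continuousOn (hΩ : IsBoundedC2Domain Ω)
    (hV : IsOrthogonalAlong Ω m V B Γ) {φ : E n × Op n → ℝ}
    (hφ : ContinuousOn φ (univ ×ˢ Gr n m)) : Integrable φ V := by
  have := hV.isFiniteMeasure hΩ
  have hK : IsCompact (closure Ω ×ˢ Gr n m) := hΩ.isCompact_closure.prod isCompact_Gr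
  have h := integrableOn_of_continuousOn_of_mapsTo (ρ := V) hK.measurableSet
    (measure_lt_top _ _) hK continuousOn_id (mapsTo_id _)
    (hφ.mono (prod_mono (subset_univ _) le_rfl))
  rwa [IntegrableOn, Measure.restrict_eq_self_of_ae_mem (s := closure Ω ×ˢ Gr n m) hV.ae_mem] at h

theorem IsOrthogonalAlong.integrable_boundary_of_continuousOn (hΩ : IsBoundedC2Domain Ω)
    (hV : IsOrthogonalAlong Ω m V B Γ) {ψ : E n × Op n → ℝ}
    (hψ : ContinuousOn ψ (boundaryGr Ω (m - 1))) : Integrable ψ Γ := by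
  have := hV.isFiniteMeasure_boundary hΩ
  have hK : IsCompact (boundaryGr Ω (m - 1)) := isCompact_boundaryGr hΩ
  have h := integrableOn_of_continuousOn_of_mapsTo (ρ := Γ) hK.measurableSet
    (measure_lt_top _ _) hK continuousOn_id (mapsTo_id _) hψ
  rwa [IntegrableOn, Measure.restrict_eq_self_of_ae_mem hV.ae_mem_boundaryGr] at h

theorem integrableOn_slice (hΩ : IsBoundedC2Domain Ω) (hP : P ∈ Gr n m) (hΔ : IsSlice Ω P z Δ)
    {φ : E n × Op n → ℝ} (hφ : ContinuousOn φ (univ ×ˢ Gr n m)) :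
    IntegrableOn (fun x => φ (x, P)) Δ μHE[m] :=
  integrableOn_of_continuousOn_of_mapsTo (measurableSet_slice hP hΔ)
    (euclideanHausdorffMeasure_slice_lt_top hΩ hP hΔ)
    (hΩ.isCompact_closure.prod isCompact_Gr) (by fun_prop)
    (fun _ hx => ⟨slice_subset_closure hΔ hx, hP⟩) (hφ.mono (prod_mono (subset_univ _) le_rfl))

/-- The plane `P ∩ T_x S` at a boundary point of an orthogonal slice. -/
theorem planeProj_sliceBoundary (hΩ : IsBoundedC2Domain Ω) (hP : P ∈ Gr n m)
    (hΔ : Δ ∈ orthSlices Ω P z) {x : E n} (hx : x ∈ sliceBoundary Δ) :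
    planeProj (P.range ⊓ tangentSpace Ω x) = P - lineProj (normalField Ω x) := by
  have hxS := sliceBoundary_subset_frontier hΩ hP hΔ.1 hx
  rw [normalField_of_mem hxS]
  exact planeProj_range_inf_eq hP (hΩ.norm_innerNormal hxS) (hΔ.2 x hx)

theorem mem_boundaryGr_of_mem_sliceBoundary (hΩ : IsBoundedC2Domain Ω) (hP : P ∈ Gr n m)
    (hΔ : Δ ∈ orthSlices Ω P z) {x : E n} (hx : x ∈ sliceBoundary Δ) :
    (x, planeProj (P.range ⊓ tangentSpace Ω x)) ∈ boundaryGr Ω (m - 1) := by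
  have hxS := sliceBoundary_subset_frontier hΩ hP hΔ.1 hx
  have hrange : (planeProj (P.range ⊓ tangentSpace Ω x)).range = P.range ⊓ tangentSpace Ω x :=
    Submodule.range_starProjection _
  refine ⟨hxS, ⟨isStarProjection_starProjection, ?_⟩, ?_⟩
  · have h1 : Submodule.span ℝ {innerNormal Ω x} ≤ P.range :=
      (Submodule.span_singleton_le_iff_mem _ _).2 (hΔ.2 x hx)
    have h2 := Submodule.finrank_add_inf_finrank_orthogonal h1
    have h3 : innerNormal Ω x ≠ 0 := by
      rw [← norm_ne_zero_iff, hΩ.norm_innerNormal hxS]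
      exact one_ne_zero
    rw [finrank_span_singleton h3, hP.2, inf_comm] at h2
    rw [hrange, tangentSpace]
    omega
  · rw [hrange]
    exact inf_le_right

theorem integrableOn_sliceBoundary (hΩ : IsBoundedC2Domain Ω) (hP : P ∈ Gr n m)
    (hΔ : Δ ∈ orthSlices Ω P z) {ψ : E n × Op n → ℝ}
    (hψ : ContinuousOn ψ (boundaryGr Ω (m - 1))) :
    IntegrableOn (fun x => ψ (x, planeProj (P.range ⊓ tangentSpace Ω x)))
      (sliceBoundary Δ) μHE[m - 1] := by
  refine integrableOn_of_continuousOn_of_mapsTo (measurableSet_sliceBoundary hP hΔ.1)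
    (euclideanHausdorffMeasure_sliceBoundary_lt_top hΩ hP hΔ) (isCompact_boundaryGr hΩ) ?_
    (fun x hx => mem_boundaryGr_of_mem_sliceBoundary hΩ hP hΔ hx) hψ
  have h : ContinuousOn (fun x => (x, P - lineProj (innerNormal Ω x))) (sliceBoundary Δ) :=
    continuousOn_id.prodMk (continuousOn_const.sub (continuous_lineProj.comp_continuousOn
      (hΩ.continuousOn_innerNormal.mono (sliceBoundary_subset_frontier hΩ hP hΔ.1))))
  refine h.congr fun x hx => ?_
  simp only [planeProj_sliceBoundary hΩ hP hΔ hx,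
    normalField_of_mem (sliceBoundary_subset_frontier hΩ hP hΔ.1 hx)]

variable {κ γ : Measure (E n)} [IsFiniteMeasure κ] [IsFiniteMeasure γ] {θ : Set (E n) → ℝ}

/-- On an affine plane with an orthogonal fibre the sum over the slices is the integral against the
conditional measure. -/
theorem IsOrthogonalFiber.sliceSum_eq (hm : 1 ≤ m) (hΩ : IsBoundedC2Domain Ω)
    (h : IsOrthogonalFiber Ω m P z κ γ)
    (hθ : ∀ Δ ∈ orthSlices Ω P z, θ Δ = (κ Δ / μHE[m] Δ).toReal) {φ : E n × Op n → ℝ}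
    (hφ : ContinuousOn φ (univ ×ˢ Gr n m)) :
    sliceSum Ω m θ φ P z = ∫ x, φ (x, P) ∂κ := by
  have hκ := (eq_sum_orthSlices hm hΩ h.plane_mem h.interior h.boundary h.gradient).1
  conv_rhs => rw [hκ]
  rw [integral_finsetSum_measure, sliceSum,
    finsum_mem_eq_finite_toFinset_sum _ (finite_orthSlices hm hΩ h.plane_mem z)]
  · refine Finset.sum_congr rfl fun Δ hΔ => ?_
    rw [integral_smul_measure, hθ Δ ((Finite.mem_toFinset _).1 hΔ), smul_eq_mul]
  · intro Δ hΔ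
    have hΔ' := ((Finite.mem_toFinset _).1 hΔ).1
    exact (integrableOn_slice hΩ h.plane_mem hΔ' hφ).smul_measure (ENNReal.div_ne_top
      (measure_ne_top _ _) (euclideanHausdorffMeasure_slice_ne_zero h.plane_mem hΔ'))

theorem IsOrthogonalFiber.sliceBoundarySum_eq (hm : 1 ≤ m) (hΩ : IsBoundedC2Domain Ω)
    (h : IsOrthogonalFiber Ω m P z κ γ)
    (hθ : ∀ Δ ∈ orthSlices Ω P z, θ Δ = (κ Δ / μHE[m] Δ).toReal) {ψ : E n × Op n → ℝ}
    (hψ : ContinuousOn ψ (boundaryGr Ω (m - 1))) :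
    sliceBoundarySum Ω m θ ψ P z = ∫ x, ψ (x, P - lineProj (normalField Ω x)) ∂γ := by
  have hγ := (eq_sum_orthSlices hm hΩ h.plane_mem h.interior h.boundary h.gradient).2
  conv_rhs => rw [hγ]
  have hcongr : ∀ Δ ∈ orthSlices Ω P z, EqOn
      (fun x => ψ (x, planeProj (P.range ⊓ tangentSpace Ω x)))
      (fun x => ψ (x, P - lineProj (normalField Ω x))) (sliceBoundary Δ) := fun Δ hΔ x hx => by
    simp only [planeProj_sliceBoundary hΩ h.plane_mem hΔ hx]
  rw [integral_finsetSum_measure, sliceBoundarySum,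
    finsum_mem_eq_finite_toFinset_sum _ (finite_orthSlices hm hΩ h.plane_mem z)]
  · refine Finset.sum_congr rfl fun Δ hΔ => ?_
    have hΔ' := (Finite.mem_toFinset _).1 hΔ
    rw [integral_smul_measure, hθ Δ hΔ', smul_eq_mul,
      setIntegral_congr_fun (measurableSet_sliceBoundary h.plane_mem hΔ'.1) (hcongr Δ hΔ')]
  · intro Δ hΔ
    have hΔ' := (Finite.mem_toFinset _).1 hΔ
    refine Integrable.smul_measure ?_ (ENNReal.div_ne_top
      (measure_ne_top _ _) (euclideanHausdorffMeasure_slice_ne_zero h.plane_mem hΔ'.1))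
    exact (integrableOn_sliceBoundary hΩ h.plane_mem hΔ' hψ).congr_fun (hcongr Δ hΔ')
      (measurableSet_sliceBoundary h.plane_mem hΔ'.1)

end SliceIntegrals

/-! ### The superposition of slices -/

section Superposition

variable {n m : ℕ} {Ω : Set (E n)} {V Γ : Measure (E n × Op n)} {B : E n × Op n → Bil n}

/-- The family of measures `μ_P^⊥` as a kernel. -/
noncomputable def perpKernel (μ : Kernel (Op n) (E n)) [IsMarkovKernel μ] : Kernel (Op n) (E n) :=
  (Kernel.id ×ₖ μ).map fun p : Op n × E n => p.2 - p.1 p.2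

theorem perpKernel_apply (μ : Kernel (Op n) (E n)) [IsMarkovKernel μ] (P : Op n) :
    perpKernel μ P = perpMarginal μ P := by
  have h : Measurable fun p : Op n × E n => p.2 - p.1 p.2 :=
    (by fun_prop : Continuous fun p : Op n × E n => p.2 - p.1 p.2).measurable
  rw [perpKernel, Kernel.map_apply _ h, Kernel.prod_apply, Kernel.id_apply, Measure.dirac_prod,
    Measure.map_map h measurable_prodMk_left]
  rfl

instance (μ : Kernel (Op n) (E n)) [IsMarkovKernel μ] : IsMarkovKernel (perpKernel μ) :=
  Kernel.IsMarkovKernel.map _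
    (by fun_prop : Continuous fun p : Op n × E n => p.2 - p.1 p.2).measurable

/-- The first marginal of the varifold in plane coordinates, the measure over which it is
disintegrated, is the iterated measure `μ_P^⊥(dz) ν(dP)`. -/
theorem compProd_perpKernel [IsFiniteMeasure V] {μ : Kernel (Op n) (E n)} [IsMarkovKernel μ]
    (hμ : IsDisintegration V μ) :
    grassMarginal V ⊗ₘ perpKernel μ = (fiberMeasure V).fst := by
  have : IsFiniteMeasure (grassMarginal V) := by unfold grassMarginal; infer_instance
  refine Measure.ext_of_lintegral _ fun f hf => ?_
  have h : Measurable fun p : E n × Op n => (p.2, p.1 - p.2 p.1) :=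
    (by fun_prop : Continuous fun p : E n × Op n => (p.2, p.1 - p.2 p.1)).measurable
  rw [Measure.lintegral_compProd hf, Measure.fst, fiberMeasure,
    Measure.map_map measurable_fst measurable_fiberCoord,
    lintegral_map hf (measurable_fst.comp measurable_fiberCoord)]
  refine Eq.trans ?_ (hμ.2 _ (hf.comp h)).symm
  refine lintegral_congr fun P => ?_
  rw [perpKernel_apply, perpMarginal]
  exact lintegral_map (hf.comp measurable_prodMk_left)
    (by fun_prop : Continuous fun x : E n => x - P x).measurable

theorem hasIteratedIntegral_of_ae_eq [IsFiniteMeasure V] {μ : Kernel (Op n) (E n)}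
    (hμ : IsDisintegration V μ) {F : Op n → E n → ℝ} {G : Op n × E n → ℝ}
    (hG : Integrable G (fiberMeasure V).fst)
    (hFG : ∀ᵐ y ∂(fiberMeasure V).fst, F y.1 y.2 = G y) :
    HasIteratedIntegral V μ F (∫ y, G y ∂(fiberMeasure V).fst) := by
  have := hμ.1
  have : IsFiniteMeasure (grassMarginal V) := by unfold grassMarginal; infer_instance
  have hF : Integrable (fun y : Op n × E n => F y.1 y.2) (grassMarginal V ⊗ₘ perpKernel μ) := by
    rw [compProd_perpKernel hμ]
    exact hG.congr (hFG.mono fun y hy => hy.symm)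
  have h1 := ((Measure.integrable_compProd_iff hF.aestronglyMeasurable).1 hF).1
  have h2 := hF.integral_measure_compProd
  have h3 := Measure.integral_compProd hF
  rw [compProd_perpKernel hμ, integral_congr_ae hFG] at h3
  simp only [perpKernel_apply] at h1 h2 h3
  exact ⟨h1, h2, h3⟩

theorem measurableEmbedding_fiberCoord :
    MeasurableEmbedding (fiberCoord : E n × Op n → (Op n × E n) × E n) :=
  continuous_fiberCoord.measurableEmbedding fun p q h => by
    simp only [fiberCoord, Prod.mk.injEq] at h
    exact Prod.ext h.2 h.1.1

theorem measurableEmbedding_conormalLift (hΩ : IsBoundedC2Domain Ω) :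
    MeasurableEmbedding (conormalLift Ω) :=
  (measurable_conormalLift hΩ).measurableEmbedding fun p q h => by
    simp only [conormalLift, Prod.mk.injEq] at h
    refine Prod.ext h.1 ?_
    have h2 := h.2
    rw [h.1] at h2
    exact add_right_cancel h2

end Superposition

end OrthVarifold

theorem theorem2p10 (n m : ℕ) (hm : 1 ≤ m) (hmn : m ≤ n)
    (Ω : Set (E n)) (hΩ : IsBoundedC2Domain Ω)
    (V Γ : Measure (E n × Op n)) (B : E n × Op n → Bil n)
    (hV : IsOrthogonalAlong Ω m V B Γ) (hB : ∀ᵐ p ∂V, B p = 0)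
    (μ : Kernel (Op n) (E n)) (hμ : IsDisintegration V μ) :
    (∀ P ∈ Gr n m, ∀ z : E n, (orthSlices Ω P z).Finite) ∧
    ∃ θ : Set (E n) → ℝ, (∀ Δ, 0 ≤ θ Δ) ∧
      (∀ φ : E n × Op n → ℝ, ContinuousOn φ (univ ×ˢ Gr n m) →
        Integrable φ V ∧
        (∀ P ∈ Gr n m, ∀ z : E n, ∀ Δ ∈ orthSlices Ω P z,
          IntegrableOn (fun x => φ (x, P)) Δ μHE[m]) ∧
        HasIteratedIntegral V μ (sliceSum Ω m θ φ) (∫ p, φ p ∂V)) ∧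
      (∀ ψ : E n × Op n → ℝ, ContinuousOn ψ (boundaryGr Ω (m - 1)) →
        Integrable ψ Γ ∧
        (∀ P ∈ Gr n m, ∀ z : E n, ∀ Δ ∈ orthSlices Ω P z,
          IntegrableOn (fun x => ψ (x, planeProj (P.range ⊓ tangentSpace Ω x)))
            (sliceBoundary Δ) μHE[m - 1]) ∧
        HasIteratedIntegral V μ (sliceBoundarySum Ω m θ ψ) (∫ q, ψ q ∂Γ)) := by
  classical
  refine ⟨fun P hP z => finite_orthSlices hm hΩ hP z, ?_⟩
  have := hV.isFiniteMeasure hΩ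
  have := hV.isFiniteMeasure_boundary hΩ
  have : IsFiniteMeasure (fiberMeasure V) := by unfold fiberMeasure; infer_instance
  obtain ⟨κ, γ, hκ, hγ, hγf, hκV, hγΓ, hfib⟩ := hV.exists_fibers hΩ hB
  -- The density of a slice is read off from the conditional measure on its affine plane; the slice
  -- determines the plane.
  let θ : Set (E n) → ℝ := fun Δ =>
    if h : ∃ y : Op n × E n, IsOrthogonalFiber Ω m y.1 y.2 (κ y) (γ y) ∧
        Δ ∈ orthSlices Ω y.1 y.2 then (κ h.choose Δ / μHE[m] Δ).toReal else 0
  have hθ : ∀ y : Op n × E n, IsOrthogonalFiber Ω m y.1 y.2 (κ y) (γ y) →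
      ∀ Δ ∈ orthSlices Ω y.1 y.2, θ Δ = (κ y Δ / μHE[m] Δ).toReal := by
    intro y hy Δ hΔ
    have h : ∃ y : Op n × E n, IsOrthogonalFiber Ω m y.1 y.2 (κ y) (γ y) ∧
        Δ ∈ orthSlices Ω y.1 y.2 := ⟨y, hy, hΔ⟩
    have hchoose : h.choose = y := by
      have hs := h.choose_spec
      have := slice_plane_unique hs.1.plane_mem hy.plane_mem hs.1.apply_offset hy.apply_offset
        hs.2.1 hΔ.1
      exact Prod.ext this.1 this.2
    simp only [θ, dif_pos h, hchoose]
  refine ⟨θ, fun Δ => ?_, fun φ hφ => ⟨hV.integrable_of_continuousOn hΩ hφ,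
    fun P hP z Δ hΔ => integrableOn_slice hΩ hP hΔ.1 hφ, ?_⟩,
    fun ψ hψ => ⟨hV.integrable_boundary_of_continuousOn hΩ hψ,
    fun P hP z Δ hΔ => integrableOn_sliceBoundary hΩ hP hΔ hψ, ?_⟩⟩
  · by_cases h : ∃ y : Op n × E n, IsOrthogonalFiber Ω m y.1 y.2 (κ y) (γ y) ∧
        Δ ∈ orthSlices Ω y.1 y.2
    · simp only [θ, dif_pos h, ENNReal.toReal_nonneg]
    · simp only [θ, dif_neg h, le_refl]
  · have hint : Integrable (fun p : (Op n × E n) × E n => φ (p.2, p.1.1))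
        ((fiberMeasure V).fst ⊗ₘ κ) := by
      rw [hκV, fiberMeasure, measurableEmbedding_fiberCoord.integrable_map_iff]
      exact hV.integrable_of_continuousOn hΩ hφ
    have heq : ∫ p, φ p ∂V = ∫ y, ∫ x, φ (x, y.1) ∂κ y ∂(fiberMeasure V).fst := by
      rw [← Measure.integral_compProd hint, hκV, fiberMeasure,
        measurableEmbedding_fiberCoord.integral_map]
      rfl
    rw [heq]
    refine hasIteratedIntegral_of_ae_eq hμ hint.integral_measure_compProd ?_
    filter_upwards [hfib] with y hy
    exact hy.sliceSum_eq hm hΩ (hθ y hy) hφ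
  · have hemb := measurableEmbedding_conormalLift hΩ
    have hid : (fun p : (Op n × E n) × E n => ψ (p.2, p.1.1 - lineProj (normalField Ω p.2))) ∘
        fiberCoord ∘ conormalLift Ω = ψ := by
      funext q
      simp [fiberCoord, conormalLift]
    have hint : Integrable (fun p : (Op n × E n) × E n =>
        ψ (p.2, p.1.1 - lineProj (normalField Ω p.2))) ((fiberMeasure V).fst ⊗ₘ γ) := by
      rw [hγΓ, boundaryFiberMeasure, measurableEmbedding_fiberCoord.integrable_map_iff,
        hemb.integrable_map_iff, Function.comp_assoc, hid]
      exact hV.integrable_boundary_of_continuousOn hΩ hψ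
    have heq : ∫ q, ψ q ∂Γ = ∫ y, ∫ x, ψ (x, y.1 - lineProj (normalField Ω x)) ∂γ y
        ∂(fiberMeasure V).fst := by
      rw [← Measure.integral_compProd hint, hγΓ, boundaryFiberMeasure,
        measurableEmbedding_fiberCoord.integral_map, hemb.integral_map]
      exact integral_congr_ae (ae_of_all _ fun q => (congrFun hid q).symm)
    rw [heq]
    refine hasIteratedIntegral_of_ae_eq hμ hint.integral_measure_compProd ?_
    filter_upwards [hfib] with y hy
    have := hγf y
    exact hy.sliceBoundarySum_eq hm hΩ (hθ y hy) hψ
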